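/- Let $(Q,\langle\cdot,\cdot\rangle)$ be a finite-dimensional smooth Riemannian manifold with Levi-Civita connection $\nabla$ and curvature $R(X,Y)Z=\nabla_X\nabla_YZ-\nabla_Y\nabla_XZ-\nabla_{[X,Y]}Z$, let $V:Q\to\mathbb R$ be smooth, let $T>0$, and let $q:[0,T]\to Q$ be a smooth curve (for instance a modified cubic polynomial, i.e. a solution of $\frac{D^3\dot q}{dt^3}+R\big(\frac{D\dot q}{dt},\dot q\big)\dot q+\operatorname{grad}V(q)=0$). Let $T_q\Omega$ be the space of piecewise smooth $C^1$ vector fields $X$ along $q$ with $X=\frac{DX}{dt}=0$ at $t=0$ and at $t=T$, and let $\mathring H^2_q$ be its completion for the norm $$\|X\|=\Big(\int_0^T\Big[\|X\|^2+\Big\|\frac{DX}{dt}\Big\|^2+\Big\|\frac{D^2X}{dt^2}\Big\|^2\Big]dt\Big)^{1/2}.$$ The index form is the (not assumed symmetric) bilinear form $$I(X,Y)=\int_0^T\Big[\Big\langle\frac{D^2X}{dt^2},\frac{D^2Y}{dt^2}\Big\rangle+\big\langle Y,\,F(X,\dot q)+\nabla_X\operatorname{grad}V\big\rangle\Big]dt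 ,$$ where, with $Y=\dot q$ and $\nabla_Y=\frac{D}{dt}$ (so that $\nabla_Y^2=\frac{D^2}{dt^2}$, also when applied to the tensor $R$ along $q$), $$\begin{aligned}F(X,Y)={}&(\nabla^2_YR)(X,Y)Y+(\nabla_XR)(\nabla_YY,Y)Y+R(R(X,Y)Y,Y)Y+R(X,\nabla^2_YY)Y\\&+2\big[(\nabla_YR)(\nabla_YX,Y)Y+(\nabla_YR)(X,\nabla_YY)Y+R(\nabla^2_YX,Y)Y\big]\\&+3\big[(\nabla_YR)(X,Y)\nabla_YY+R(X,Y)\nabla^2_YY+R(X,\nabla_YY)\nabla_YY\big]+4R(\nabla_YX,Y)\nabla_YY .\end{aligned}$$ Then $I$, defined on $T_q\Omega$, extends to a bounded bilinear form on the Hilbert space $\mathring H^2_q$ (necessarily unique, as $T_q\Omega$ is dense), again denoted by $I$, and the extended index $\operatorname{Ind}_0(q)$ of $q$, i.e. the supremum of the dimensions of the linear subspaces of $\mathring H^2_q$ on which $I$ is negative semidefinite ($I(X,X)\le 0$), is finite. -/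

import Mathlib

open scoped Manifold ContDiff

namespace VariationalObstacle

open Set Filter Topology MeasureTheory Bundle

noncomputable section

set_option synthInstance.maxHeartbeats 200000

/-- The Christoffel symbols of the Levi-Civita connection of a metric `G` on an open subset of `E`,
as a bilinear map: `Γ_y(u, v)` is the vector with
`2 G_y(Γ_y(u, v), w) = (D_u G)(v, w) + (D_v G)(u, w) - (D_w G)(u, v)` for all `w`, so that
`∇_u v = D_u v + Γ(u, v)`. The operator `(G y).inverse` is the isomorphism from covectors to
vectors (`G y` is nondegenerate). -/
def christoffel {E : Type*} [NormedAddCommGroup E] [NormedSpace ℝ E]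
    (G : E → E →L[ℝ] E →L[ℝ] ℝ) (y u v : E) : E :=
  (G y).inverse ((1 / 2 : ℝ) • (fderiv ℝ (fun z => G z v) y u + fderiv ℝ (fun z => G z u) y v
    - fderiv ℝ (fun z => G z u v) y))

theorem christoffel_eq {E : Type*} [NormedAddCommGroup E] [NormedSpace ℝ E]
    {G : E → E →L[ℝ] E →L[ℝ] ℝ} {y : E} (h : (G y).IsInvertible)
    (hG : DifferentiableAt ℝ G y) (u v w : E) :
    G y (christoffel G y u v) w =
      (1 / 2) * (fderiv ℝ (fun z => G z v w) y u + fderiv ℝ (fun z => G z u w) y v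
        - fderiv ℝ (fun z => G z u v) y w) := by
  have h1 : ∀ a b c : E, fderiv ℝ (fun z => G z a) y b c = fderiv ℝ (fun z => G z a c) y b := by
    intro a b c
    have ha : DifferentiableAt ℝ (fun z => G z a) y := hG.clm_apply (differentiableAt_const a)
    have := (ha.hasFDerivAt.clm_apply (hasFDerivAt_const c y)).fderiv
    rw [this]; simp
  simp [christoffel, h.self_apply_inverse, h1]

theorem christoffel_transform {E : Type*} [NormedAddCommGroup E] [NormedSpace ℝ E]
    {G G' : E → E →L[ℝ] E →L[ℝ] ℝ} {τ : E → E} {y : E}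
    (hG : DifferentiableAt ℝ G y) (hG' : DifferentiableAt ℝ G' (τ y))
    (hτ : DifferentiableAt ℝ τ y) (hτ2 : DifferentiableAt ℝ (fderiv ℝ τ) y)
    (hsymm2 : ∀ u v, fderiv ℝ (fderiv ℝ τ) y u v = fderiv ℝ (fderiv ℝ τ) y v u)
    (hsurj : Function.Surjective (fderiv ℝ τ y))
    (hsymm : ∀ u v, G' (τ y) u v = G' (τ y) v u)
    (hi : (G y).IsInvertible) (hi' : (G' (τ y)).IsInvertible)
    (h : ∀ᶠ z in 𝓝 y, ∀ u v, G z u v = G' (τ z) (fderiv ℝ τ z u) (fderiv ℝ τ z v)) (u v : E) :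
    fderiv ℝ τ y (christoffel G y u v) = fderiv ℝ (fderiv ℝ τ) y u v
      + christoffel G' (τ y) (fderiv ℝ τ y u) (fderiv ℝ τ y v) := by
  have key : ∀ a b c : E, fderiv ℝ (fun z => G z b c) y a =
      fderiv ℝ (fun z => G' z (fderiv ℝ τ y b) (fderiv ℝ τ y c)) (τ y) (fderiv ℝ τ y a)
      + G' (τ y) (fderiv ℝ (fderiv ℝ τ) y a b) (fderiv ℝ τ y c)
      + G' (τ y) (fderiv ℝ τ y b) (fderiv ℝ (fderiv ℝ τ) y a c) := by
    intro a b c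
    have hb := (hτ2.hasFDerivAt.clm_apply (hasFDerivAt_const b y))
    have hc := (hτ2.hasFDerivAt.clm_apply (hasFDerivAt_const c y))
    have h2 : HasFDerivAt (fun z => G' (τ z) (fderiv ℝ τ z b) (fderiv ℝ τ z c)) _ y :=
      ((hG'.hasFDerivAt.comp y hτ.hasFDerivAt).clm_apply hb).clm_apply hc
    have h3 : (fun z => G z b c) =ᶠ[𝓝 y]
      (fun z => G' (τ z) (fderiv ℝ τ z b) (fderiv ℝ τ z c)) := by
      filter_upwards [h] with z hz using hz b c
    have h6 := ((hG'.hasFDerivAt.clm_apply (hasFDerivAt_const (fderiv ℝ τ y b) (τ y))).clm_apply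
      (hasFDerivAt_const (fderiv ℝ τ y c) (τ y))).fderiv
    rw [(h2.congr_of_eventuallyEq h3).fderiv, h6]
    simp; ring
  have hinj : Function.Injective (G' (τ y)) := by
    obtain ⟨e, he⟩ := hi'
    rw [← he]; exact e.injective
  apply hinj
  ext c'
  obtain ⟨c, rfl⟩ := hsurj c'
  have h0 := h.self_of_nhds
  rw [map_add, add_apply, ← h0, christoffel_eq hi hG, christoffel_eq hi' hG',
    key, key, key]
  rw [hsymm2 v u, hsymm2 c u, hsymm2 c v, hsymm (fderiv ℝ τ y v) (fderiv ℝ (fderiv ℝ τ) y u c)]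
  rw [hsymm (fderiv ℝ (fderiv ℝ τ) y u c)]
  ring

theorem christoffel_add_left {E : Type*} [NormedAddCommGroup E] [NormedSpace ℝ E]
    {G : E → E →L[ℝ] E →L[ℝ] ℝ} {y : E} (hG : DifferentiableAt ℝ G y) (u u' v : E) :
    christoffel G y (u + u') v = christoffel G y u v + christoffel G y u' v := by
  have h1 : ∀ a, DifferentiableAt ℝ (fun z => G z a) y :=
    fun a => hG.clm_apply (differentiableAt_const a)
  have h2 : ∀ a b, DifferentiableAt ℝ (fun z => G z a b) y :=
    fun a b => (h1 a).clm_apply (differentiableAt_const b)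
  simp only [christoffel, ← map_add]
  congr 1
  have e1 : fderiv ℝ (fun z => G z (u + u')) y = fderiv ℝ (fun z => G z u) y
      + fderiv ℝ (fun z => G z u') y := by
    simp only [map_add]; exact fderiv_fun_add (h1 u) (h1 u')
  have e2 : fderiv ℝ (fun z => G z (u + u') v) y = fderiv ℝ (fun z => G z u v) y
      + fderiv ℝ (fun z => G z u' v) y := by
    simp only [map_add, add_apply]; exact fderiv_fun_add (h2 u v) (h2 u' v)
  rw [e1, e2]
  simp only [map_add, add_apply]
  module

theorem christoffel_smul_left {E : Type*} [NormedAddCommGroup E] [NormedSpace ℝ E]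
    {G : E → E →L[ℝ] E →L[ℝ] ℝ} {y : E} (hG : DifferentiableAt ℝ G y) (r : ℝ) (u v : E) :
    christoffel G y (r • u) v = r • christoffel G y u v := by
  have h1 : ∀ a, DifferentiableAt ℝ (fun z => G z a) y :=
    fun a => hG.clm_apply (differentiableAt_const a)
  have h2 : ∀ a b, DifferentiableAt ℝ (fun z => G z a b) y :=
    fun a b => (h1 a).clm_apply (differentiableAt_const b)
  simp only [christoffel, ← map_smul]
  congr 1
  have e1 : fderiv ℝ (fun z => G z (r • u)) y = r • fderiv ℝ (fun z => G z u) y := by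
    simp only [map_smul]; exact fderiv_fun_const_smul (h1 u) r
  have e2 : fderiv ℝ (fun z => G z (r • u) v) y = r • fderiv ℝ (fun z => G z u v) y := by
    simp only [map_smul, smul_apply]; exact fderiv_fun_const_smul (h2 u v) r
  rw [e1, e2]
  simp only [map_smul, smul_apply]
  module

theorem christoffel_symm {E : Type*} [NormedAddCommGroup E] [NormedSpace ℝ E]
    {G : E → E →L[ℝ] E →L[ℝ] ℝ} {y : E} (hs : ∀ᶠ z in 𝓝 y, ∀ u v, G z u v = G z v u) (u v : E) :
    christoffel G y u v = christoffel G y v u := by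
  have : fderiv ℝ (fun z => G z u v) y = fderiv ℝ (fun z => G z v u) y := by
    apply Filter.EventuallyEq.fderiv_eq
    filter_upwards [hs] with z hz using hz u v
  simp only [christoffel]
  rw [this, add_comm (fderiv ℝ (fun z => G z v) y u)]

theorem contDiffOn_christoffel_const {E : Type*} [NormedAddCommGroup E] [NormedSpace ℝ E]
    [CompleteSpace E] {G : E → E →L[ℝ] E →L[ℝ] ℝ} {U : Set E} (hU : IsOpen U)
    (hG : ContDiffOn ℝ ∞ G U) (hi : ∀ y ∈ U, (G y).IsInvertible) (u v : E) :
    ContDiffOn ℝ ∞ (fun y => christoffel G y u v) U := by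
  have hinv : ContDiffOn ℝ ∞ (fun y => (G y).inverse) U := fun y hy =>
    ((hi y hy).contDiffAt_map_inverse).comp_contDiffWithinAt y (hG y hy)
  have h1 : ∀ a b : E, ContDiffOn ℝ ∞ (fun y => fderiv ℝ (fun z => G z a) y b) U := fun a b =>
    ((hG.clm_apply contDiffOn_const).fderiv_of_isOpen hU (m := ∞) (by simp)).clm_apply
      contDiffOn_const
  have h2 : ContDiffOn ℝ ∞ (fun y => fderiv ℝ (fun z => G z u v) y) U :=
    ((hG.clm_apply contDiffOn_const).clm_apply contDiffOn_const).fderiv_of_isOpen hU (m := ∞)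
      (by simp)
  unfold christoffel
  exact hinv.clm_apply ((((h1 v u).add (h1 u v)).sub h2).const_smul (1/2 : ℝ))

theorem contDiffWithinAt_christoffel {E : Type*} [NormedAddCommGroup E] [NormedSpace ℝ E]
    [FiniteDimensional ℝ E] {G : E → E →L[ℝ] E →L[ℝ] ℝ} {U : Set E} (hU : IsOpen U)
    (hG : ContDiffOn ℝ ∞ G U) (hi : ∀ y ∈ U, (G y).IsInvertible)
    (hs : ∀ y ∈ U, ∀ u v, G y u v = G y v u)
    {n : ℕ∞} {c a b : ℝ → E} {S : Set ℝ} {t : ℝ}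
    (hc : ContDiffWithinAt ℝ n c S t) (ha : ContDiffWithinAt ℝ n a S t)
    (hb : ContDiffWithinAt ℝ n b S t) (hct : c t ∈ U) :
    ContDiffWithinAt ℝ n (fun s => christoffel G (c s) (a s) (b s)) S t := by
  have : CompleteSpace E := FiniteDimensional.complete ℝ E
  let B := Module.finBasis ℝ E
  have hd : ∀ y ∈ U, DifferentiableAt ℝ G y := fun y hy =>
    (hG.contDiffAt (hU.mem_nhds hy)).differentiableAt (by simp)
  have hsy : ∀ y ∈ U, ∀ᶠ z in 𝓝 y, ∀ u v, G z u v = G z v u := fun y hy => by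
    filter_upwards [hU.mem_nhds hy] with z hz using hs z hz
  have sumL : ∀ y ∈ U, ∀ (w : E) (ι : Finset (Fin (Module.finrank ℝ E)))
      (r : Fin (Module.finrank ℝ E) → ℝ),
      christoffel G y (∑ i ∈ ι, r i • B i) w = ∑ i ∈ ι, r i • christoffel G y (B i) w := by
    intro y hy w ι r
    induction ι using Finset.induction_on with
    | empty =>
      have := christoffel_smul_left (hd y hy) 0 0 w
      simpa using this
    | insert i s hi ih =>
      rw [Finset.sum_insert hi, Finset.sum_insert hi, christoffel_add_left (hd y hy), ih,
        christoffel_smul_left (hd y hy)]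
  have expand : ∀ y ∈ U, ∀ u v : E, christoffel G y u v =
      ∑ i, B.coord i u • ∑ j, B.coord j v • christoffel G y (B j) (B i) := by
    intro y hy u v
    conv_lhs => rw [← B.sum_repr u]
    rw [sumL y hy]
    refine Finset.sum_congr rfl fun i _ => ?_
    rw [christoffel_symm (hsy y hy)]
    conv_lhs => rw [← B.sum_repr v]
    rw [sumL y hy]
    rfl
  have hev : (fun s => christoffel G (c s) (a s) (b s)) =ᶠ[𝓝[S] t] fun s =>
      ∑ i, B.coord i (a s) • ∑ j, B.coord j (b s) • christoffel G (c s) (B j) (B i) := by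
    filter_upwards [hc.continuousWithinAt.preimage_mem_nhdsWithin (hU.mem_nhds hct)] with s hsU
    exact expand _ hsU _ _
  refine ContDiffWithinAt.congr_of_eventuallyEq ?_ hev (expand _ hct _ _)
  have hco : ∀ i, ContDiff ℝ n (fun x => B.coord i x) := fun i =>
    (LinearMap.toContinuousLinearMap (B.coord i)).contDiff
  refine ContDiffWithinAt.sum fun i _ => ((hco i).contDiffAt.comp_contDiffWithinAt t ha).smul
    (ContDiffWithinAt.sum fun j _ => ((hco j).contDiffAt.comp_contDiffWithinAt t hb).smul ?_)
  have h1 : ContDiffAt ℝ n (fun y => christoffel G y (B j) (B i)) (c t) :=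
    ((contDiffOn_christoffel_const hU hG hi (B j) (B i)).contDiffAt (hU.mem_nhds hct)).of_le
      (by exact_mod_cast le_top)
  exact h1.comp_contDiffWithinAt t hc

section Manifold
variable {E : Type*} [NormedAddCommGroup E] [NormedSpace ℝ E]
  {Q : Type*} [TopologicalSpace Q] [ChartedSpace E Q] [IsManifold 𝓘(ℝ, E) ∞ Q]

/-- A smooth Riemannian metric on the manifold `Q` modelled on the vector space `E`. -/
abbrev SmoothMetric (E Q : Type*) [NormedAddCommGroup E] [NormedSpace ℝ E]
    [TopologicalSpace Q] [ChartedSpace E Q] [IsManifold 𝓘(ℝ, E) ∞ Q] : Type _ :=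
  ContMDiffRiemannianMetric 𝓘(ℝ, E) ∞ E (fun x : Q => TangentSpace 𝓘(ℝ, E) x)

/-- The metric `g` in the preferred chart at `x`, as a function on (the target of) that chart. Recall
that in Mathlib `TangentSpace 𝓘(ℝ, E) p` is `E` by means of the preferred chart at `p`, and that
`tangentCoordChange 𝓘(ℝ, E) x p p` sends the components of a vector of `T_p Q` in the chart at `x`
to its components in the chart at `p`. -/
def chartMetric
    (g : SmoothMetric E Q)
    (x : Q) (y : E) : E →L[ℝ] E →L[ℝ] ℝ :=
  let p : Q := (extChartAt 𝓘(ℝ, E) x).symm y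
  let B : E →L[ℝ] E →L[ℝ] ℝ := g.inner p
  let A : E →L[ℝ] E := tangentCoordChange 𝓘(ℝ, E) x p p
  B.bilinearComp A A

/-- The velocity `q'(t)` of a curve (one-sided at the end points of an interval `S`). -/
def velocityWithin (q : ℝ → Q) (S : Set ℝ) (t : ℝ) : TangentSpace 𝓘(ℝ, E) (q t) :=
  mfderivWithin 𝓘(ℝ, ℝ) 𝓘(ℝ, E) q S t (1 : ℝ)

/-- The components at time `t` of a vector field `X` along `q` in the preferred chart at `x`. -/
def coordAlong (q : ℝ → Q) (X : ∀ t, TangentSpace 𝓘(ℝ, E) (q t)) (x : Q) (t : ℝ) : E :=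
  tangentCoordChange 𝓘(ℝ, E) (q t) x (q t) (X t)

/-- The covariant derivative `DX/dt` of a vector field `X` along the curve `q` for the Levi-Civita
connection, computed at time `t` in the preferred chart at `q t`:
`(DX/dt)^k = (X^k)' + Γ^k_{ij} (q')^i X^j`. -/
def covDerivAlong
    (g : SmoothMetric E Q)
    (q : ℝ → Q) (S : Set ℝ) (X : ∀ t, TangentSpace 𝓘(ℝ, E) (q t)) (t : ℝ) :
    TangentSpace 𝓘(ℝ, E) (q t) :=
  derivWithin (coordAlong q X (q t)) S t +
    christoffel (chartMetric g (q t)) (extChartAt 𝓘(ℝ, E) (q t) (q t))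
      (velocityWithin q S t) (X t)

theorem chartMetric_apply
    (g : SmoothMetric E Q)
    (x p : Q) (hp : p ∈ (extChartAt 𝓘(ℝ, E) x).source) (u v : E) :
    chartMetric g x (extChartAt 𝓘(ℝ, E) x p) u v =
      g.inner p (tangentCoordChange 𝓘(ℝ, E) x p p u) (tangentCoordChange 𝓘(ℝ, E) x p p v) := by
  simp only [chartMetric]
  rw [(extChartAt 𝓘(ℝ, E) x).left_inv hp]
  rfl

theorem chartMetric_symm
    (g : SmoothMetric E Q)
    (x : Q) (y u v : E) : chartMetric g x y u v = chartMetric g x y v u :=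
  by
  simp only [chartMetric]
  exact g.symm _ _ _

theorem chartMetric_isInvertible [FiniteDimensional ℝ E]
    (g : SmoothMetric E Q)
    (x : Q) (y : E) (hy : y ∈ (extChartAt 𝓘(ℝ, E) x).target) :
    (chartMetric g x y).IsInvertible := by
  have hp : (extChartAt 𝓘(ℝ, E) x).symm y ∈ (extChartAt 𝓘(ℝ, E) x).source :=
    (extChartAt 𝓘(ℝ, E) x).map_target hy
  have hinj : Function.Injective (chartMetric g x y) := by
    rw [injective_iff_map_eq_zero]
    intro u hu
    have h1 : chartMetric g x y u u = 0 := by rw [hu]; rfl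
    by_contra hne
    have h2 : tangentCoordChange 𝓘(ℝ, E) x ((extChartAt 𝓘(ℝ, E) x).symm y)
        ((extChartAt 𝓘(ℝ, E) x).symm y) u ≠ 0 := by
      intro h0
      apply hne
      have h3 := tangentCoordChange_comp (I := 𝓘(ℝ, E)) (w := x)
        (x := (extChartAt 𝓘(ℝ, E) x).symm y) (y := x)
        (z := (extChartAt 𝓘(ℝ, E) x).symm y) (v := u)
        ⟨⟨hp, mem_extChartAt_source _⟩, hp⟩
      rw [h0, map_zero, tangentCoordChange_self hp] at h3
      exact h3.symm
    exact absurd h1 (g.pos _ _ h2).ne'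
  have hfin : Module.finrank ℝ E = Module.finrank ℝ (E →L[ℝ] ℝ) := by
    rw [← (LinearMap.toContinuousLinearMap (𝕜 := ℝ) (E := E) (F' := ℝ)).finrank_eq]
    exact (Subspace.dual_finrank_eq (K := ℝ) (V := E)).symm
  refine ⟨(LinearEquiv.ofInjectiveOfFinrankEq
    (chartMetric g x y : E →ₗ[ℝ] (E →L[ℝ] ℝ)) hinj hfin).toContinuousLinearEquiv, ?_⟩
  ext; rfl

theorem contDiffOn_chartMetric [FiniteDimensional ℝ E]
    (g : SmoothMetric E Q) (x : Q) :
    ContDiffOn ℝ ∞ (chartMetric g x) (extChartAt 𝓘(ℝ, E) x).target := by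
  rw [contDiffOn_clm_apply]
  intro u
  rw [contDiffOn_clm_apply]
  intro v
  rw [← contMDiffOn_iff_contDiffOn]
  have hsec : ∀ w : E, ContMDiffOn 𝓘(ℝ, E) (𝓘(ℝ, E).prod 𝓘(ℝ, E)) ∞
      (fun y => TotalSpace.mk' E (E := fun p : Q => TangentSpace 𝓘(ℝ, E) p)
        ((extChartAt 𝓘(ℝ, E) x).symm y)
        (tangentCoordChange 𝓘(ℝ, E) x ((extChartAt 𝓘(ℝ, E) x).symm y)
          ((extChartAt 𝓘(ℝ, E) x).symm y) w)) (extChartAt 𝓘(ℝ, E) x).target := by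
    intro w y hy
    have hp : (extChartAt 𝓘(ℝ, E) x).symm y ∈ (extChartAt 𝓘(ℝ, E) x).source :=
      (extChartAt 𝓘(ℝ, E) x).map_target hy
    rw [Trivialization.contMDiffWithinAt_iff
      (e := trivializationAt E (fun p : Q => TangentSpace 𝓘(ℝ, E) p) x)]
    · refine ⟨contMDiffOn_extChartAt_symm x y hy, ?_⟩
      refine (contMDiffWithinAt_const (c := w)).congr_of_eventuallyEq_of_mem ?_ hy
      filter_upwards [self_mem_nhdsWithin] with z hz
      have hz' : (extChartAt 𝓘(ℝ, E) x).symm z ∈ (extChartAt 𝓘(ℝ, E) x).source :=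
        (extChartAt 𝓘(ℝ, E) x).map_target hz
      change tangentCoordChange 𝓘(ℝ, E) _ x _ _ = w
      rw [tangentCoordChange_comp ⟨⟨hz', mem_extChartAt_source _⟩, hz'⟩,
        tangentCoordChange_self hz']
    · simpa using hp
  have hg : ContMDiffOn 𝓘(ℝ, E) (𝓘(ℝ, E).prod 𝓘(ℝ, E →L[ℝ] E →L[ℝ] ℝ)) ∞
      (fun y => TotalSpace.mk' (E →L[ℝ] E →L[ℝ] ℝ)
        (E := fun p : Q => (TangentSpace 𝓘(ℝ, E) p →L[ℝ] TangentSpace 𝓘(ℝ, E) p →L[ℝ] ℝ))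
        ((extChartAt 𝓘(ℝ, E) x).symm y)
        (g.inner ((extChartAt 𝓘(ℝ, E) x).symm y))) (extChartAt 𝓘(ℝ, E) x).target :=
    g.contMDiff.comp_contMDiffOn (contMDiffOn_extChartAt_symm x)
  intro y hy
  have := ContMDiffWithinAt.clm_bundle_apply₂ (F₁ := E) (F₂ := E) (F₃ := ℝ)
    (E₃ := Bundle.Trivial Q ℝ) (hg y hy) (hsec u y hy) (hsec v y hy)
  simp only [contMDiffWithinAt_totalSpace] at this
  exact this.2

/-- The covariant derivative in an arbitrary chart. -/
theorem covDeriv_core [FiniteDimensional ℝ E]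
    (g : SmoothMetric E Q)
    {q : ℝ → Q} {S : Set ℝ} {X : ∀ t, TangentSpace 𝓘(ℝ, E) (q t)} {t : ℝ} (htS : t ∈ S)
    (hS : UniqueDiffWithinAt ℝ S t)
    (hq : MDifferentiableWithinAt 𝓘(ℝ, ℝ) 𝓘(ℝ, E) q S t) (x : Q)
    (hx : q t ∈ (extChartAt 𝓘(ℝ, E) x).source)
    (hX : DifferentiableWithinAt ℝ (coordAlong q X x) S t) :
    tangentCoordChange 𝓘(ℝ, E) (q t) x (q t) (covDerivAlong g q S X t) =
      derivWithin (coordAlong q X x) S t +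
        christoffel (chartMetric g x) (extChartAt 𝓘(ℝ, E) x (q t))
          (derivWithin (fun s => extChartAt 𝓘(ℝ, E) x (q s)) S t) (coordAlong q X x t) := by
  have : CompleteSpace E := FiniteDimensional.complete ℝ E
  set p := q t with hp
  have hpp : p ∈ (extChartAt 𝓘(ℝ, E) p).source := mem_extChartAt_source _
  -- the change of chart
  let τ : E → E := extChartAt 𝓘(ℝ, E) x ∘ (extChartAt 𝓘(ℝ, E) p).symm
  let y₀ : E := extChartAt 𝓘(ℝ, E) p p
  have hder : ∀ z, fderivWithin ℝ τ (range 𝓘(ℝ, E)) z = fderiv ℝ τ z := by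
    intro z; simp
  -- open neighbourhood
  let O : Set E := ((extChartAt 𝓘(ℝ, E) p).symm ≫ extChartAt 𝓘(ℝ, E) x).source
  have hO : IsOpen O := by
    have := isOpen_extChartAt_source (I := 𝓘(ℝ, E)) x
    simp only [O, PartialEquiv.trans_source, PartialEquiv.symm_source]
    exact (continuousOn_extChartAt_symm p).isOpen_inter_preimage (isOpen_extChartAt_target p) this
  have hy₀ : y₀ ∈ O := by
    simp [O, y₀, PartialEquiv.trans_source] 
    simpa using hx
  have hτ : ContDiffOn ℝ ∞ τ O := by
    have := contDiffOn_ext_coord_change (I := 𝓘(ℝ, E)) (n := ∞) x p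
    exact this
  have hτ' : ∀ z ∈ O, ContDiffAt ℝ ∞ τ z := fun z hz => hτ.contDiffAt (hO.mem_nhds hz)
  have hτ2 : ContDiffAt ℝ ∞ (fderiv ℝ τ) y₀ := (hτ' y₀ hy₀).fderiv_right (m := ∞) (by simp)
  have hD : ∀ z ∈ O, fderiv ℝ τ z = tangentCoordChange 𝓘(ℝ, E) p x
      ((extChartAt 𝓘(ℝ, E) p).symm z) := by
    intro z hz
    rw [tangentCoordChange_def, hder, (extChartAt 𝓘(ℝ, E) p).right_inv hz.1]
  have hD0 : fderiv ℝ τ y₀ = tangentCoordChange 𝓘(ℝ, E) p x p := by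
    rw [hD y₀ hy₀, (extChartAt 𝓘(ℝ, E) p).left_inv hpp]
  -- the curve in charts
  let c : ℝ → E := fun s => extChartAt 𝓘(ℝ, E) p (q s)
  let ξ : ℝ → E := coordAlong q X p
  have hct : c t = y₀ := rfl
  have hqc : ContinuousWithinAt q S t := hq.continuousWithinAt
  have hnear : ∀ᶠ s in 𝓝[S] t, q s ∈ (extChartAt 𝓘(ℝ, E) p).source ∧
      q s ∈ (extChartAt 𝓘(ℝ, E) x).source :=
    (hqc.eventually (extChartAt_source_mem_nhds (I := 𝓘(ℝ, E)) p)).and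
      (hqc.eventually ((isOpen_extChartAt_source (I := 𝓘(ℝ, E)) x).mem_nhds hx))
  have hcd : DifferentiableWithinAt ℝ c S t := by
    have h1 : MDifferentiableAt 𝓘(ℝ, E) 𝓘(ℝ, E) (extChartAt 𝓘(ℝ, E) p) (q t) :=
      mdifferentiableAt_extChartAt (by simp [← hp])
    exact (h1.comp_mdifferentiableWithinAt t hq).differentiableWithinAt
  have hvel : velocityWithin q S t = derivWithin c S t := by
    simp only [velocityWithin, mfderivWithin, hq]
    simp [writtenInExtChartAt, c, ← hp, derivWithin, Function.comp_def]
    rfl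
  have hc0 : (fun s => extChartAt 𝓘(ℝ, E) x (q s)) =ᶠ[𝓝[S] t] fun s => τ (c s) := by
    filter_upwards [hnear] with s hs
    simp only [τ, c, Function.comp_apply, (extChartAt 𝓘(ℝ, E) p).left_inv hs.1]
  have hξ0 : coordAlong q X x =ᶠ[𝓝[S] t] fun s => fderiv ℝ τ (c s) (ξ s) := by
    filter_upwards [hnear] with s hs
    have hcs : c s ∈ O := by
      refine ⟨(extChartAt 𝓘(ℝ, E) p).map_source hs.1, ?_⟩
      change (extChartAt 𝓘(ℝ, E) p).symm (extChartAt 𝓘(ℝ, E) p (q s)) ∈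
        (extChartAt 𝓘(ℝ, E) x).source
      rw [(extChartAt 𝓘(ℝ, E) p).left_inv hs.1]
      exact hs.2
    rw [hD _ hcs]
    change _ = tangentCoordChange 𝓘(ℝ, E) p x
      ((extChartAt 𝓘(ℝ, E) p).symm (extChartAt 𝓘(ℝ, E) p (q s))) _
    rw [(extChartAt 𝓘(ℝ, E) p).left_inv hs.1]
    exact (tangentCoordChange_comp ⟨⟨mem_extChartAt_source _, hs.1⟩, hs.2⟩).symm
  -- differentiability of ξ
  have hξd : DifferentiableWithinAt ℝ ξ S t := by
    have h1 : ξ =ᶠ[𝓝[S] t] fun s => fderiv ℝ (extChartAt 𝓘(ℝ, E) p ∘ (extChartAt 𝓘(ℝ, E) x).symm)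
        (τ (c s)) (coordAlong q X x s) := by
      filter_upwards [hnear] with s hs
      have e1 : τ (c s) = extChartAt 𝓘(ℝ, E) x (q s) := by
        simp only [τ, c, Function.comp_apply, (extChartAt 𝓘(ℝ, E) p).left_inv hs.1]
      have e2 : fderiv ℝ (extChartAt 𝓘(ℝ, E) p ∘ (extChartAt 𝓘(ℝ, E) x).symm)
          (extChartAt 𝓘(ℝ, E) x (q s)) = tangentCoordChange 𝓘(ℝ, E) x p (q s) := by
        rw [tangentCoordChange_def]; simp
      rw [e1, e2]
      exact (tangentCoordChange_comp ⟨⟨mem_extChartAt_source _, hs.2⟩, hs.1⟩).symm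
    have h2 : ContDiffOn ℝ ∞ (extChartAt 𝓘(ℝ, E) p ∘ (extChartAt 𝓘(ℝ, E) x).symm)
        ((extChartAt 𝓘(ℝ, E) x).symm ≫ extChartAt 𝓘(ℝ, E) p).source :=
      contDiffOn_ext_coord_change (I := 𝓘(ℝ, E)) (n := ∞) p x
    have h3 : IsOpen ((extChartAt 𝓘(ℝ, E) x).symm ≫ extChartAt 𝓘(ℝ, E) p).source := by
      simp only [PartialEquiv.trans_source, PartialEquiv.symm_source]
      exact (continuousOn_extChartAt_symm x).isOpen_inter_preimage (isOpen_extChartAt_target x)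
        (isOpen_extChartAt_source p)
    have h4 : τ (c t) ∈ ((extChartAt 𝓘(ℝ, E) x).symm ≫ extChartAt 𝓘(ℝ, E) p).source := by
      have e1 : τ (c t) = extChartAt 𝓘(ℝ, E) x (q t) := by
        simp only [τ, c, Function.comp_apply, ← hp, (extChartAt 𝓘(ℝ, E) p).left_inv hpp]
      rw [e1]
      refine ⟨(extChartAt 𝓘(ℝ, E) x).map_source hx, ?_⟩
      change (extChartAt 𝓘(ℝ, E) x).symm (extChartAt 𝓘(ℝ, E) x (q t)) ∈
        (extChartAt 𝓘(ℝ, E) p).source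
      rw [← hp, (extChartAt 𝓘(ℝ, E) x).left_inv hx]
      exact hpp
    have h5 : DifferentiableAt ℝ
        (fderiv ℝ (extChartAt 𝓘(ℝ, E) p ∘ (extChartAt 𝓘(ℝ, E) x).symm)) (τ (c t)) :=
      ((h2.contDiffAt (h3.mem_nhds h4)).fderiv_right (m := 1)
        (by norm_cast)).differentiableAt (by simp)
    have h6 : DifferentiableWithinAt ℝ (fun s => τ (c s)) S t := by
      have h7 : DifferentiableAt ℝ τ (c t) := (hτ' y₀ hy₀).differentiableAt (by simp)
      exact DifferentiableAt.comp_differentiableWithinAt (g := τ) (f := c) t h7 hcd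
    exact ((h5.comp_differentiableWithinAt t h6).clm_apply hX).congr_of_eventuallyEq h1
      (h1.self_of_nhdsWithin htS)
  have hξt : ξ t = X t := tangentCoordChange_self hpp
  -- derivatives
  have d1 : derivWithin (fun s => extChartAt 𝓘(ℝ, E) x (q s)) S t =
      fderiv ℝ τ y₀ (derivWithin c S t) := by
    rw [hc0.derivWithin_eq (hc0.self_of_nhdsWithin htS)]
    exact (((hτ' y₀ hy₀).differentiableAt (by simp)).hasFDerivAt.comp_hasDerivWithinAt t
      hcd.hasDerivWithinAt).derivWithin hS
  have d2 : derivWithin (coordAlong q X x) S t =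
      fderiv ℝ (fderiv ℝ τ) y₀ (derivWithin c S t) (X t) + fderiv ℝ τ y₀ (derivWithin ξ S t) := by
    rw [hξ0.derivWithin_eq (hξ0.self_of_nhdsWithin htS)]
    have h1 : HasDerivWithinAt (fun s => fderiv ℝ τ (c s))
        (fderiv ℝ (fderiv ℝ τ) y₀ (derivWithin c S t)) S t :=
      (hτ2.differentiableAt (by simp)).hasFDerivAt.comp_hasDerivWithinAt t hcd.hasDerivWithinAt
    rw [(h1.clm_apply hξd.hasDerivWithinAt).derivWithin hS, hξt]
  have htr := christoffel_transform (G := chartMetric g p) (G' := chartMetric g x) (τ := τ)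
    (y := y₀) 
    (((contDiffOn_chartMetric g p).contDiffAt ((isOpen_extChartAt_target p).mem_nhds
      hy₀.1)).differentiableAt (by simp))
    (by
      refine ((contDiffOn_chartMetric g x).contDiffAt ((isOpen_extChartAt_target x).mem_nhds
        ?_)).differentiableAt (by simp)
      exact (extChartAt 𝓘(ℝ, E) x).map_source hy₀.2)
    ((hτ' y₀ hy₀).differentiableAt (by simp)) (hτ2.differentiableAt (by simp))
    (fun u v => ((hτ' y₀ hy₀).isSymmSndFDerivAt
      (by rw [minSmoothness_of_isRCLikeNormedField]; exact WithTop.coe_le_coe.2 le_top)).eq u v)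
    (by
      intro w
      refine ⟨tangentCoordChange 𝓘(ℝ, E) x p p w, ?_⟩
      rw [hD0, tangentCoordChange_comp ⟨⟨hx, hpp⟩, hx⟩, tangentCoordChange_self hx])
    (chartMetric_symm g x _) (chartMetric_isInvertible g p _ hy₀.1)
    (chartMetric_isInvertible g x _ ((extChartAt 𝓘(ℝ, E) x).map_source hy₀.2))
    (by
      filter_upwards [hO.mem_nhds hy₀] with z hz u v
      rw [hD z hz]
      have hz1 : (extChartAt 𝓘(ℝ, E) p).symm z ∈ (extChartAt 𝓘(ℝ, E) p).source :=
        (extChartAt 𝓘(ℝ, E) p).map_target hz.1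
      have hz2 : (extChartAt 𝓘(ℝ, E) p).symm z ∈ (extChartAt 𝓘(ℝ, E) x).source := hz.2
      have e1 := chartMetric_apply g p _ hz1 u v
      rw [(extChartAt 𝓘(ℝ, E) p).right_inv hz.1] at e1
      have e2 := chartMetric_apply g x _ hz2
        (tangentCoordChange 𝓘(ℝ, E) p x ((extChartAt 𝓘(ℝ, E) p).symm z) u)
        (tangentCoordChange 𝓘(ℝ, E) p x ((extChartAt 𝓘(ℝ, E) p).symm z) v)
      rw [tangentCoordChange_comp ⟨⟨hz1, hz2⟩, mem_extChartAt_source _⟩,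
        tangentCoordChange_comp ⟨⟨hz1, hz2⟩, mem_extChartAt_source _⟩] at e2
      exact e1.trans e2.symm) (derivWithin c S t) (X t)
  have hτy : τ y₀ = extChartAt 𝓘(ℝ, E) x p := by
    simp only [τ, y₀, Function.comp_apply, (extChartAt 𝓘(ℝ, E) p).left_inv hpp]
  have hxt : coordAlong q X x t = fderiv ℝ τ y₀ (X t) := by rw [hD0]; rfl
  rw [← hD0, covDerivAlong, hvel, map_add]
  erw [htr]
  rw [d1, d2, hxt, hτy]
  abel

/-- `X` is a vector field of class `C^k` along the curve `q` on the set `S`. -/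
def ContDiffAlong (k : WithTop ℕ∞) (q : ℝ → Q) (X : ∀ t, TangentSpace 𝓘(ℝ, E) (q t))
    (S : Set ℝ) : Prop :=
  ContMDiffOn 𝓘(ℝ, ℝ) (𝓘(ℝ, E).prod 𝓘(ℝ, E)) k
    (fun t => (TotalSpace.mk' E (q t) (X t) : TangentBundle 𝓘(ℝ, E) Q)) S

theorem contDiffAlong_iff {k : WithTop ℕ∞} {q : ℝ → Q} {X : ∀ t, TangentSpace 𝓘(ℝ, E) (q t)}
    {S : Set ℝ} (hk : k ≤ ∞) (hq : ContMDiffOn 𝓘(ℝ, ℝ) 𝓘(ℝ, E) k q S) :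
    ContDiffAlong k q X S ↔ ∀ t ∈ S, ∀ x : Q, q t ∈ (extChartAt 𝓘(ℝ, E) x).source →
      ContDiffWithinAt ℝ k (coordAlong q X x) S t := by
  have : ContMDiffVectorBundle k E (TangentSpace 𝓘(ℝ, E) : Q → Type _) 𝓘(ℝ, E) :=
    ContMDiffVectorBundle.of_le (n := ∞) hk
  constructor
  · intro h t ht x hx
    have h1 := h t ht
    rw [Trivialization.contMDiffWithinAt_iff
      (e := trivializationAt E (fun p : Q => TangentSpace 𝓘(ℝ, E) p) x) (by simpa using hx)] at h1
    exact contMDiffWithinAt_iff_contDiffWithinAt.1 h1.2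
  · intro h t ht
    rw [Trivialization.contMDiffWithinAt_iff
      (e := trivializationAt E (fun p : Q => TangentSpace 𝓘(ℝ, E) p) (q t)) (by simp)]
    exact ⟨hq t ht, contMDiffWithinAt_iff_contDiffWithinAt.2
      (h t ht (q t) (mem_extChartAt_source _))⟩

theorem contDiffAlong_add {k : WithTop ℕ∞} {q : ℝ → Q} {X Y : ∀ t, TangentSpace 𝓘(ℝ, E) (q t)}
    {S : Set ℝ} (hk : k ≤ ∞) (hq : ContMDiffOn 𝓘(ℝ, ℝ) 𝓘(ℝ, E) k q S) (hX : ContDiffAlong k q X S)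
    (hY : ContDiffAlong k q Y S) : ContDiffAlong k q (X + Y) S := by
  rw [contDiffAlong_iff hk hq] at *
  intro t ht x hx
  refine ((hX t ht x hx).add (hY t ht x hx)).congr (fun s _ => ?_) ?_ <;>
  exact map_add (tangentCoordChange 𝓘(ℝ, E) (q _) x (q _)) _ _

theorem contDiffAlong_smul {k : WithTop ℕ∞} {q : ℝ → Q} {X : ∀ t, TangentSpace 𝓘(ℝ, E) (q t)}
    {S : Set ℝ} (hk : k ≤ ∞) (hq : ContMDiffOn 𝓘(ℝ, ℝ) 𝓘(ℝ, E) k q S) (r : ℝ)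
    (hX : ContDiffAlong k q X S) : ContDiffAlong k q (r • X) S := by
  rw [contDiffAlong_iff hk hq] at *
  intro t ht x hx
  refine ((hX t ht x hx).const_smul r).congr (fun s _ => ?_) ?_ <;>
  exact map_smul (tangentCoordChange 𝓘(ℝ, E) (q _) x (q _)) _ _

theorem contDiffAlong_zero {k : WithTop ℕ∞} {q : ℝ → Q}
    {S : Set ℝ} (hk : k ≤ ∞) (hq : ContMDiffOn 𝓘(ℝ, ℝ) 𝓘(ℝ, E) k q S) :
    ContDiffAlong k q (0 : ∀ t, TangentSpace 𝓘(ℝ, E) (q t)) S := by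
  rw [contDiffAlong_iff hk hq]
  intro t ht x hx
  refine (contDiffWithinAt_const (c := (0 : E))).congr (fun s _ => ?_) ?_ <;>
  exact map_zero (tangentCoordChange 𝓘(ℝ, E) (q _) x (q _))

theorem contDiffAlong_covDeriv [FiniteDimensional ℝ E]
    (g : SmoothMetric E Q)
    {n : ℕ∞} {q : ℝ → Q} {X : ∀ t, TangentSpace 𝓘(ℝ, E) (q t)} {S : Set ℝ}
    (hS : UniqueDiffOn ℝ S) (hq : ContMDiffOn 𝓘(ℝ, ℝ) 𝓘(ℝ, E) ∞ q S)
    (hX : ContDiffAlong (n + 1) q X S) : ContDiffAlong n q (covDerivAlong g q S X) S := by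
  have hn : ((n : WithTop ℕ∞) + 1) ≤ ∞ := by exact_mod_cast le_top
  have hn0 : (n : WithTop ℕ∞) + 1 ≠ 0 := by simp
  rw [contDiffAlong_iff hn (hq.of_le hn)] at hX
  rw [contDiffAlong_iff (le_self_add.trans hn) (hq.of_le (le_self_add.trans hn))]
  intro t ht x hx
  have hU := isOpen_extChartAt_target (I := 𝓘(ℝ, E)) x
  have hnear : ∀ᶠ s in 𝓝[S] t, q s ∈ (extChartAt 𝓘(ℝ, E) x).source :=
    (hq t ht).continuousWithinAt.eventually
      ((isOpen_extChartAt_source (I := 𝓘(ℝ, E)) x).mem_nhds hx)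
  have hev : coordAlong q (covDerivAlong g q S X) x =ᶠ[𝓝[S] t] fun s =>
      derivWithin (coordAlong q X x) S s +
        christoffel (chartMetric g x) (extChartAt 𝓘(ℝ, E) x (q s))
          (derivWithin (fun s => extChartAt 𝓘(ℝ, E) x (q s)) S s) (coordAlong q X x s) := by
    filter_upwards [hnear, self_mem_nhdsWithin] with s hs hsS
    exact covDeriv_core g hsS (hS s hsS) ((hq s hsS).mdifferentiableWithinAt (by simp)) x hs
      ((hX s hsS x hs).differentiableWithinAt hn0)
  refine ContDiffWithinAt.congr_of_eventuallyEq ?_ hev (hev.self_of_nhdsWithin ht)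
  have hc : ContDiffWithinAt ℝ ∞ (fun s => extChartAt 𝓘(ℝ, E) x (q s)) S t := by
    have h1 : ContMDiffAt 𝓘(ℝ, E) 𝓘(ℝ, E) ∞ (extChartAt 𝓘(ℝ, E) x) (q t) :=
      contMDiffAt_extChartAt' (by simpa using hx)
    exact contMDiffWithinAt_iff_contDiffWithinAt.1 (h1.comp_contMDiffWithinAt t (hq t ht))
  have hxX := hX t ht x hx
  refine ContDiffWithinAt.add ?_ ?_
  · exact hxX.derivWithin hS le_rfl ht
  · exact contDiffWithinAt_christoffel hU (contDiffOn_chartMetric g x)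
      (chartMetric_isInvertible g x) (fun y _ => chartMetric_symm g x y)
      (hc.of_le (le_self_add.trans hn)) ((hc.of_le hn).derivWithin hS le_rfl ht)
      (hxX.of_le le_self_add) ((extChartAt 𝓘(ℝ, E) x).map_source hx)

theorem continuousOn_inner [FiniteDimensional ℝ E]
    (g : SmoothMetric E Q)
    {q : ℝ → Q} {X Y : ∀ t, TangentSpace 𝓘(ℝ, E) (q t)} {S : Set ℝ}
    (hX : ContDiffAlong 0 q X S) (hY : ContDiffAlong 0 q Y S)
    (hq : ContMDiffOn 𝓘(ℝ, ℝ) 𝓘(ℝ, E) 0 q S) :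
    ContinuousOn (fun t => g.inner (q t) (X t) (Y t)) S := by
  have hg : ContMDiffOn 𝓘(ℝ, ℝ) (𝓘(ℝ, E).prod 𝓘(ℝ, E →L[ℝ] E →L[ℝ] ℝ)) 0
      (fun t => TotalSpace.mk' (E →L[ℝ] E →L[ℝ] ℝ)
        (E := fun p : Q => (TangentSpace 𝓘(ℝ, E) p →L[ℝ] TangentSpace 𝓘(ℝ, E) p →L[ℝ] ℝ))
        (q t) (g.inner (q t))) S :=
    (g.contMDiff.of_le (by simp)).comp_contMDiffOn hq
  intro t ht
  have := ContMDiffWithinAt.clm_bundle_apply₂ (F₁ := E) (F₂ := E) (F₃ := ℝ)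
    (E₃ := Bundle.Trivial Q ℝ) (hg t ht) (hX t ht) (hY t ht)
  simp only [contMDiffWithinAt_totalSpace] at this
  exact this.2.continuousWithinAt

theorem covDeriv_congr_set
    (g : SmoothMetric E Q)
    {q : ℝ → Q} {X : ∀ t, TangentSpace 𝓘(ℝ, E) (q t)} {S S' : Set ℝ} {t : ℝ}
    (h : S =ᶠ[𝓝 t] S') : covDerivAlong g q S X t = covDerivAlong g q S' X t := by
  have h1 : velocityWithin (E := E) q S t = velocityWithin q S' t := by
    simp only [velocityWithin]
    rw [mfderivWithin_congr_set h]
  simp only [covDerivAlong, h1]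
  rw [derivWithin_congr_set h]

theorem covDeriv_congr_field
    (g : SmoothMetric E Q)
    {q : ℝ → Q} {X Y : ∀ t, TangentSpace 𝓘(ℝ, E) (q t)} {S : Set ℝ} {t : ℝ}
    (h : ∀ᶠ s in 𝓝[S] t, X s = Y s) (ht : X t = Y t) :
    covDerivAlong g q S X t = covDerivAlong g q S Y t := by
  have : coordAlong q X (q t) =ᶠ[𝓝[S] t] coordAlong q Y (q t) := by
    filter_upwards [h] with s hs
    simp only [coordAlong, hs]
  simp only [covDerivAlong, ht]
  rw [this.derivWithin_eq (by simp only [coordAlong, ht])]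

theorem covDeriv_add [FiniteDimensional ℝ E]
    (g : SmoothMetric E Q)
    {q : ℝ → Q} {X Y : ∀ t, TangentSpace 𝓘(ℝ, E) (q t)} {S : Set ℝ} {t : ℝ}
    (hX : DifferentiableWithinAt ℝ (coordAlong q X (q t)) S t)
    (hY : DifferentiableWithinAt ℝ (coordAlong q Y (q t)) S t) :
    covDerivAlong g q S (X + Y) t = covDerivAlong g q S X t + covDerivAlong g q S Y t := by
  have h1 : coordAlong q (X + Y) (q t) = fun s =>
      coordAlong q X (q t) s + coordAlong q Y (q t) s := by
    funext s; exact map_add (tangentCoordChange 𝓘(ℝ, E) (q s) (q t) (q s)) _ _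
  have hyt : extChartAt 𝓘(ℝ, E) (q t) (q t) ∈ (extChartAt 𝓘(ℝ, E) (q t)).target :=
    mem_extChartAt_target _
  have hd : DifferentiableAt ℝ (chartMetric g (q t)) (extChartAt 𝓘(ℝ, E) (q t) (q t)) :=
    ((contDiffOn_chartMetric g (q t)).contDiffAt
      ((isOpen_extChartAt_target (q t)).mem_nhds hyt)).differentiableAt (by simp)
  have h2 : ∀ u v w : E, christoffel (chartMetric g (q t)) (extChartAt 𝓘(ℝ, E) (q t) (q t)) u
      (v + w) = christoffel (chartMetric g (q t)) (extChartAt 𝓘(ℝ, E) (q t) (q t)) u v +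
        christoffel (chartMetric g (q t)) (extChartAt 𝓘(ℝ, E) (q t) (q t)) u w := by
    intro u v w
    have hs := fun u v => christoffel_symm
      (Eventually.of_forall fun z => chartMetric_symm g (q t) z)
      (y := extChartAt 𝓘(ℝ, E) (q t) (q t)) u v
    rw [hs, hs u v, hs u w, christoffel_add_left hd]
  simp only [covDerivAlong, h1]
  rw [derivWithin_fun_add hX hY]
  exact (congrArg (fun z : E => derivWithin (coordAlong q X (q t)) S t +
    derivWithin (coordAlong q Y (q t)) S t + z) (h2 (velocityWithin q S t) (X t) (Y t))).trans
    (add_add_add_comm _ _ _ _)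

theorem covDeriv_smul [FiniteDimensional ℝ E]
    (g : SmoothMetric E Q)
    {q : ℝ → Q} {X : ∀ t, TangentSpace 𝓘(ℝ, E) (q t)} {S : Set ℝ} {t : ℝ} (r : ℝ)
    (hX : DifferentiableWithinAt ℝ (coordAlong q X (q t)) S t) :
    covDerivAlong g q S (r • X) t = r • covDerivAlong g q S X t := by
  have h1 : coordAlong q (r • X) (q t) = fun s => r • coordAlong q X (q t) s := by
    funext s; exact map_smul (tangentCoordChange 𝓘(ℝ, E) (q s) (q t) (q s)) _ _
  have hyt : extChartAt 𝓘(ℝ, E) (q t) (q t) ∈ (extChartAt 𝓘(ℝ, E) (q t)).target :=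
    mem_extChartAt_target _
  have hd : DifferentiableAt ℝ (chartMetric g (q t)) (extChartAt 𝓘(ℝ, E) (q t) (q t)) :=
    ((contDiffOn_chartMetric g (q t)).contDiffAt
      ((isOpen_extChartAt_target (q t)).mem_nhds hyt)).differentiableAt (by simp)
  have h2 : ∀ u v : E, christoffel (chartMetric g (q t)) (extChartAt 𝓘(ℝ, E) (q t) (q t)) u
      (r • v) = r • christoffel (chartMetric g (q t)) (extChartAt 𝓘(ℝ, E) (q t) (q t)) u v := by
    intro u v
    have hs := fun u v => christoffel_symm
      (Eventually.of_forall fun z => chartMetric_symm g (q t) z)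
      (y := extChartAt 𝓘(ℝ, E) (q t) (q t)) u v
    rw [hs, hs u v, christoffel_smul_left hd]
  simp only [covDerivAlong, h1]
  rw [derivWithin_fun_const_smul r hX]
  exact (congrArg (fun z : E => r • derivWithin (coordAlong q X (q t)) S t + z)
    (h2 (velocityWithin q S t) (X t))).trans (smul_add r _ _).symm

theorem integrableOn_of_piecewise {f : ℝ → ℝ} {T : ℝ} (P : Finset ℝ)
    (h : ∀ a b, 0 ≤ a → a < b → b ≤ T → Disjoint (Ioo a b) (P : Set ℝ) →
      ∃ k : ℝ → ℝ, ContinuousOn k (Icc a b) ∧ EqOn f k (Ioo a b)) :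
    IntegrableOn f (Icc 0 T) := by
  have hpiece : ∀ a b, 0 ≤ a → b ≤ T → Disjoint (Ioo a b) (P : Set ℝ) →
      IntegrableOn f (Icc a b) := by
    intro a b ha hb hd
    rcases lt_trichotomy a b with hab | hab | hab
    · obtain ⟨k, hk, hfk⟩ := h a b ha hab hb hd
      rw [integrableOn_Icc_iff_integrableOn_Ioo]
      exact ((hk.integrableOn_Icc).mono_set Ioo_subset_Icc_self).congr_fun hfk.symm
        measurableSet_Ioo
    · subst hab; simp
    · rw [Icc_eq_empty (not_le.2 hab)]; simp
  refine LocallyIntegrableOn.integrableOn_isCompact ?_ isCompact_Icc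
  intro t ht
  have hfin : IsClosed ((P : Set ℝ) \ {t}) := (P.finite_toSet.subset sdiff_subset).isClosed
  obtain ⟨ε, hε, hball⟩ := Metric.isOpen_iff.1 hfin.isOpen_compl t (by simp)
  have hdis : ∀ s ∈ P, s ≠ t → ε ≤ |s - t| := by
    intro s hs hst
    by_contra hlt
    exact hball (show s ∈ Metric.ball t ε by rw [Metric.mem_ball, Real.dist_eq]; linarith)
      ⟨hs, hst⟩
  have h1 : IntegrableOn f (Icc (max 0 (t - ε)) t) := by
    refine hpiece _ _ (le_max_left _ _) ht.2 (Set.disjoint_left.2 ?_)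
    intro s hs hsP
    have h2 := hdis s hsP hs.2.ne
    have h3 := (max_lt_iff.1 hs.1).2
    rw [abs_of_neg (by linarith [hs.2])] at h2
    linarith
  have h2 : IntegrableOn f (Icc t (min T (t + ε))) := by
    refine hpiece _ _ ht.1 (min_le_left _ _) (Set.disjoint_left.2 ?_)
    intro s hs hsP
    have h2 := hdis s hsP hs.1.ne'
    have h3 := (lt_min_iff.1 hs.2).2
    rw [abs_of_pos (by linarith [hs.1])] at h2
    linarith
  refine ⟨Icc (max 0 (t - ε)) t ∪ Icc t (min T (t + ε)), ?_, h1.union h2⟩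
  filter_upwards [self_mem_nhdsWithin, mem_nhdsWithin_of_mem_nhds (Metric.ball_mem_nhds t hε)]
    with s hs hsε
  rw [Metric.mem_ball, Real.dist_eq, abs_lt] at hsε
  rcases le_total s t with hst | hst
  · exact Or.inl ⟨max_le hs.1 (by linarith), hst⟩
  · exact Or.inr ⟨hst, le_min hs.2 (by linarith)⟩

/-- A smooth curve `q : [0, T] → Q`, where `T > 0` (smooth up to the end points; the values outside
`[0, T]` play no role). -/
structure SmoothCurve (E Q : Type*) [NormedAddCommGroup E] [NormedSpace ℝ E]
    [TopologicalSpace Q] [ChartedSpace E Q] where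
  T : ℝ
  T_pos : 0 < T
  toFun : ℝ → Q
  contMDiffOn : ContMDiffOn 𝓘(ℝ, ℝ) 𝓘(ℝ, E) ∞ toFun (Icc 0 T)

namespace SmoothCurve

/-- The covariant derivative `D/dt` along `q`, on `[0, T]`. -/
def D (g : SmoothMetric E Q)
    (q : SmoothCurve E Q) (X : ∀ t, TangentSpace 𝓘(ℝ, E) (q.toFun t)) :
    ∀ t, TangentSpace 𝓘(ℝ, E) (q.toFun t) :=
  covDerivAlong g q.toFun (Icc 0 q.T) X

/-- `X` is a variational vector field along `q`, that is, an element of `T_q Ω`: a `C^1` vector field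
along `q` on `[0, T]` that is smooth on each of the closed subintervals cut out by finitely many
break points, such that `X` and `DX/dt` vanish at `0` and at `T`. (As `X` is encoded by a function
on the real line, it is normalised to be zero outside `[0, T]`.) -/
structure IsVariationalField
    (g : SmoothMetric E Q)
    (q : SmoothCurve E Q) (X : ∀ t, TangentSpace 𝓘(ℝ, E) (q.toFun t)) : Prop where
  contDiff_one : ContDiffAlong 1 q.toFun X (Icc 0 q.T)
  piecewise_smooth : ∃ P : Finset ℝ, ∀ a b, 0 ≤ a → a < b → b ≤ q.T →
    Disjoint (Ioo a b) (P : Set ℝ) → ContDiffAlong ∞ q.toFun X (Icc a b)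
  left : X 0 = 0
  right : X q.T = 0
  D_left : q.D g X 0 = 0
  D_right : q.D g X q.T = 0
  eq_zero : ∀ t ∉ Icc 0 q.T, X t = 0

theorem differentiableWithinAt_coord (q : SmoothCurve E Q)
    {X : ∀ t, TangentSpace 𝓘(ℝ, E) (q.toFun t)}
    (hX : ContDiffAlong 1 q.toFun X (Icc 0 q.T)) {t : ℝ} (ht : t ∈ Icc 0 q.T) :
    DifferentiableWithinAt ℝ (coordAlong q.toFun X (q.toFun t)) (Icc 0 q.T) t :=
  ((contDiffAlong_iff (by exact_mod_cast le_top) (q.contMDiffOn.of_le (by exact_mod_cast le_top))).1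
    hX t ht _ (mem_extChartAt_source _)).differentiableWithinAt one_ne_zero

theorem D_add [FiniteDimensional ℝ E]
    (g : SmoothMetric E Q)
    (q : SmoothCurve E Q) {X Y : ∀ t, TangentSpace 𝓘(ℝ, E) (q.toFun t)}
    (hX : ContDiffAlong 1 q.toFun X (Icc 0 q.T)) (hY : ContDiffAlong 1 q.toFun Y (Icc 0 q.T))
    {t : ℝ} (ht : t ∈ Icc 0 q.T) : q.D g (X + Y) t = q.D g X t + q.D g Y t :=
  covDeriv_add g (q.differentiableWithinAt_coord hX ht) (q.differentiableWithinAt_coord hY ht)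

theorem D_smul [FiniteDimensional ℝ E]
    (g : SmoothMetric E Q)
    (q : SmoothCurve E Q) (r : ℝ) {X : ∀ t, TangentSpace 𝓘(ℝ, E) (q.toFun t)}
    (hX : ContDiffAlong 1 q.toFun X (Icc 0 q.T))
    {t : ℝ} (ht : t ∈ Icc 0 q.T) : q.D g (r • X) t = r • q.D g X t :=
  covDeriv_smul g r (q.differentiableWithinAt_coord hX ht)

theorem D_zero [FiniteDimensional ℝ E]
    (g : SmoothMetric E Q)
    (q : SmoothCurve E Q) {t : ℝ} (ht : t ∈ Icc 0 q.T) :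
    q.D g (0 : ∀ t, TangentSpace 𝓘(ℝ, E) (q.toFun t)) t = 0 := by
  have h := q.D_smul g 0 (contDiffAlong_zero (by exact_mod_cast le_top)
    (q.contMDiffOn.of_le (by exact_mod_cast le_top))) ht
  rw [zero_smul, zero_smul] at h
  exact h

/-- The vector space `T_q Ω` of variational vector fields along `q`. -/
def variationalFields [FiniteDimensional ℝ E]
    (g : SmoothMetric E Q)
    (q : SmoothCurve E Q) : Submodule ℝ (∀ t, TangentSpace 𝓘(ℝ, E) (q.toFun t)) where
  carrier := {X | IsVariationalField g q X}
  zero_mem' :=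
    { contDiff_one := contDiffAlong_zero (by exact_mod_cast le_top)
        (q.contMDiffOn.of_le (by exact_mod_cast le_top))
      piecewise_smooth := ⟨∅, fun a b ha _ hb _ => contDiffAlong_zero le_rfl
        (q.contMDiffOn.mono (Icc_subset_Icc ha hb))⟩
      left := rfl
      right := rfl
      D_left := q.D_zero g ⟨le_rfl, q.T_pos.le⟩
      D_right := q.D_zero g ⟨q.T_pos.le, le_rfl⟩
      eq_zero := fun _ _ => rfl }
  add_mem' := by
    rintro X Y hX hY
    obtain ⟨P, hP⟩ := hX.piecewise_smooth
    obtain ⟨R, hR⟩ := hY.piecewise_smooth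
    exact
      { contDiff_one := contDiffAlong_add (by exact_mod_cast le_top)
          (q.contMDiffOn.of_le (by exact_mod_cast le_top)) hX.contDiff_one hY.contDiff_one
        piecewise_smooth := ⟨P ∪ R, fun a b ha hab hb hd => by
          rw [Finset.coe_union, Set.disjoint_union_right] at hd
          exact contDiffAlong_add le_rfl (q.contMDiffOn.mono (Icc_subset_Icc ha hb))
            (hP a b ha hab hb hd.1) (hR a b ha hab hb hd.2)⟩
        left := by rw [Pi.add_apply, hX.left, hY.left, add_zero]
        right := by rw [Pi.add_apply, hX.right, hY.right, add_zero]
        D_left := by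
          rw [q.D_add g hX.contDiff_one hY.contDiff_one ⟨le_rfl, q.T_pos.le⟩, hX.D_left,
            hY.D_left, add_zero]
        D_right := by
          rw [q.D_add g hX.contDiff_one hY.contDiff_one ⟨q.T_pos.le, le_rfl⟩, hX.D_right,
            hY.D_right, add_zero]
        eq_zero := fun t ht => by rw [Pi.add_apply, hX.eq_zero t ht, hY.eq_zero t ht, add_zero] }
  smul_mem' := by
    rintro r X hX
    obtain ⟨P, hP⟩ := hX.piecewise_smooth
    exact
      { contDiff_one := contDiffAlong_smul (by exact_mod_cast le_top)
          (q.contMDiffOn.of_le (by exact_mod_cast le_top)) r hX.contDiff_one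
        piecewise_smooth := ⟨P, fun a b ha hab hb hd =>
          contDiffAlong_smul le_rfl (q.contMDiffOn.mono (Icc_subset_Icc ha hb)) r
            (hP a b ha hab hb hd)⟩
        left := by rw [Pi.smul_apply, hX.left, smul_zero]
        right := by rw [Pi.smul_apply, hX.right, smul_zero]
        D_left := by
          rw [q.D_smul g r hX.contDiff_one ⟨le_rfl, q.T_pos.le⟩, hX.D_left, smul_zero]
        D_right := by
          rw [q.D_smul g r hX.contDiff_one ⟨q.T_pos.le, le_rfl⟩, hX.D_right, smul_zero]
        eq_zero := fun t ht => by rw [Pi.smul_apply, hX.eq_zero t ht, smul_zero] }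

theorem piece [FiniteDimensional ℝ E]
    (g : SmoothMetric E Q)
    (q : SmoothCurve E Q) (X : ∀ t, TangentSpace 𝓘(ℝ, E) (q.toFun t)) {a b : ℝ} (ha : 0 ≤ a)
    (hab : a < b) (hb : b ≤ q.T) (h : ContDiffAlong ∞ q.toFun X (Icc a b)) :
    ∃ Z W : ∀ t, TangentSpace 𝓘(ℝ, E) (q.toFun t), ContDiffAlong ∞ q.toFun Z (Icc a b) ∧
      ContDiffAlong ∞ q.toFun W (Icc a b) ∧
      ∀ t ∈ Ioo a b, q.D g X t = Z t ∧ q.D g (q.D g X) t = W t := by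
  have hq : ContMDiffOn 𝓘(ℝ, ℝ) 𝓘(ℝ, E) ∞ q.toFun (Icc a b) :=
    q.contMDiffOn.mono (Icc_subset_Icc ha hb)
  have h1 := contDiffAlong_covDeriv g (n := ⊤) (uniqueDiffOn_Icc hab) hq h
  have h2 := contDiffAlong_covDeriv g (n := ⊤) (uniqueDiffOn_Icc hab) hq h1
  have hset : ∀ t ∈ Ioo a b, Icc 0 q.T =ᶠ[𝓝 t] Icc a b := by
    intro t ht
    have e1 : Icc 0 q.T ∈ 𝓝 t := Icc_mem_nhds (ha.trans_lt ht.1) (ht.2.trans_le hb)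
    have e2 : Icc a b ∈ 𝓝 t := Icc_mem_nhds ht.1 ht.2
    exact (eventuallyEq_univ.2 e1).trans (eventuallyEq_univ.2 e2).symm
  have e1 : ∀ t ∈ Ioo a b, q.D g X t = covDerivAlong g q.toFun (Icc a b) X t :=
    fun t ht => covDeriv_congr_set g (hset t ht)
  refine ⟨_, _, h1, h2, fun t ht => ⟨e1 t ht, ?_⟩⟩
  rw [D, covDeriv_congr_set g (hset t ht)]
  refine covDeriv_congr_field g ?_ (e1 t ht)
  filter_upwards [mem_nhdsWithin_of_mem_nhds (Ioo_mem_nhds ht.1 ht.2)] with s hs using e1 s hs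

/-- The function `⟨X, Y⟩ + ⟨DX/dt, DY/dt⟩ + ⟨D²X/dt², D²Y/dt²⟩`. -/
def sobolevDensity
    (g : SmoothMetric E Q)
    (q : SmoothCurve E Q) (X Y : ∀ t, TangentSpace 𝓘(ℝ, E) (q.toFun t)) (t : ℝ) : ℝ :=
  g.inner (q.toFun t) (X t) (Y t) + g.inner (q.toFun t) (q.D g X t) (q.D g Y t)
    + g.inner (q.toFun t) (q.D g (q.D g X) t) (q.D g (q.D g Y) t)

theorem intervalIntegrable_sobolevDensity [FiniteDimensional ℝ E]
    (g : SmoothMetric E Q)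
    (q : SmoothCurve E Q) {X Y : ∀ t, TangentSpace 𝓘(ℝ, E) (q.toFun t)}
    (hX : IsVariationalField g q X) (hY : IsVariationalField g q Y) :
    IntervalIntegrable (q.sobolevDensity g X Y) volume 0 q.T := by
  rw [intervalIntegrable_iff_integrableOn_Icc_of_le q.T_pos.le]
  obtain ⟨P, hP⟩ := hX.piecewise_smooth
  obtain ⟨R, hR⟩ := hY.piecewise_smooth
  refine integrableOn_of_piecewise (P ∪ R) fun a b ha hab hb hd => ?_
  rw [Finset.coe_union, Set.disjoint_union_right] at hd
  have hXs := hP a b ha hab hb hd.1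
  have hYs := hR a b ha hab hb hd.2
  obtain ⟨Z, W, hZ, hW, hZW⟩ := piece g q X ha hab hb hXs
  obtain ⟨Z', W', hZ', hW', hZW'⟩ := piece g q Y ha hab hb hYs
  have hq : ContMDiffOn 𝓘(ℝ, ℝ) 𝓘(ℝ, E) 0 q.toFun (Icc a b) :=
    (q.contMDiffOn.mono (Icc_subset_Icc ha hb)).of_le (by simp)
  have z : ∀ {X : ∀ t, TangentSpace 𝓘(ℝ, E) (q.toFun t)},
      ContDiffAlong ∞ q.toFun X (Icc a b) → ContDiffAlong 0 q.toFun X (Icc a b) :=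
    fun h => ContMDiffOn.of_le h (by simp)
  refine ⟨fun t => g.inner (q.toFun t) (X t) (Y t) + g.inner (q.toFun t) (Z t) (Z' t)
      + g.inner (q.toFun t) (W t) (W' t),
    ((continuousOn_inner g (z hXs) (z hYs) hq).add (continuousOn_inner g (z hZ) (z hZ') hq)).add
      (continuousOn_inner g (z hW) (z hW') hq), ?_⟩
  intro t ht
  simp only [sobolevDensity, (hZW t ht).1, (hZW t ht).2, (hZW' t ht).1, (hZW' t ht).2]

theorem ae_differentiable_D [FiniteDimensional ℝ E]
    (g : SmoothMetric E Q)
    (q : SmoothCurve E Q) {X : ∀ t, TangentSpace 𝓘(ℝ, E) (q.toFun t)}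
    (hX : IsVariationalField g q X) :
    ∀ᵐ t, t ∈ Icc 0 q.T →
      DifferentiableWithinAt ℝ (coordAlong q.toFun (q.D g X) (q.toFun t)) (Icc 0 q.T) t := by
  obtain ⟨P, hP⟩ := hX.piecewise_smooth
  have hfin : ((P : Set ℝ) ∪ {0, q.T}).Finite := P.finite_toSet.union (by simp)
  filter_upwards [compl_mem_ae_iff.2 (hfin.measure_zero volume)] with t htP ht
  have h0 : 0 < t := lt_of_le_of_ne ht.1 fun h => htP (Or.inr (by simp [← h]))
  have hT : t < q.T := lt_of_le_of_ne ht.2 fun h => htP (Or.inr (by simp [h]))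
  obtain ⟨a, b, htab, hsub⟩ := (mem_nhds_iff_exists_Ioo_subset (a := t)).1
    (inter_mem (Ioo_mem_nhds h0 hT) (P.finite_toSet.isClosed.isOpen_compl.mem_nhds
      (fun h => htP (Or.inl h))))
  have hab : a < b := htab.1.trans htab.2
  obtain ⟨ha, hb⟩ := (Ioo_subset_Ioo_iff hab).1 fun s hs => (hsub hs).1
  have hd : Disjoint (Ioo a b) (P : Set ℝ) := Set.disjoint_left.2 fun s hs => (hsub hs).2
  obtain ⟨Z, W, hZ, -, hZW⟩ := piece g q X ha hab hb (hP a b ha hab hb hd)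
  have hq : ContMDiffOn 𝓘(ℝ, ℝ) 𝓘(ℝ, E) ∞ q.toFun (Icc a b) :=
    q.contMDiffOn.mono (Icc_subset_Icc ha hb)
  have h1 := ((contDiffAlong_iff le_rfl hq).1 hZ t ⟨htab.1.le, htab.2.le⟩ _
    (mem_extChartAt_source _)).differentiableWithinAt (by simp)
  have h2 := (h1.differentiableAt (Icc_mem_nhds htab.1 htab.2)).differentiableWithinAt
    (s := Icc 0 q.T)
  refine h2.congr_of_eventuallyEq ?_ (by simp only [coordAlong, (hZW t htab).1])
  filter_upwards [mem_nhdsWithin_of_mem_nhds (Ioo_mem_nhds htab.1 htab.2)] with s hs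
  simp only [coordAlong, (hZW s hs).1]

theorem ae_D_D_add [FiniteDimensional ℝ E]
    (g : SmoothMetric E Q)
    (q : SmoothCurve E Q) {X Y : ∀ t, TangentSpace 𝓘(ℝ, E) (q.toFun t)}
    (hX : IsVariationalField g q X) (hY : IsVariationalField g q Y) :
    ∀ᵐ t, t ∈ Icc 0 q.T → q.D g (q.D g (X + Y)) t = q.D g (q.D g X) t + q.D g (q.D g Y) t := by
  filter_upwards [q.ae_differentiable_D g hX, q.ae_differentiable_D g hY] with t h1 h2 ht
  rw [D, covDeriv_congr_field g (Y := q.D g X + q.D g Y) ?_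
    (q.D_add g hX.contDiff_one hY.contDiff_one ht), covDeriv_add g (h1 ht) (h2 ht)]
  · rfl
  · filter_upwards [self_mem_nhdsWithin] with s hs
      using q.D_add g hX.contDiff_one hY.contDiff_one hs

theorem ae_D_D_smul [FiniteDimensional ℝ E]
    (g : SmoothMetric E Q)
    (q : SmoothCurve E Q) (r : ℝ) {X : ∀ t, TangentSpace 𝓘(ℝ, E) (q.toFun t)}
    (hX : IsVariationalField g q X) :
    ∀ᵐ t, t ∈ Icc 0 q.T → q.D g (q.D g (r • X)) t = r • q.D g (q.D g X) t := by
  filter_upwards [q.ae_differentiable_D g hX] with t h1 ht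
  rw [D, covDeriv_congr_field g (Y := r • q.D g X) ?_
    (q.D_smul g r hX.contDiff_one ht), covDeriv_smul g r (h1 ht)]
  · rfl
  · filter_upwards [self_mem_nhdsWithin] with s hs
      using q.D_smul g r hX.contDiff_one hs

/-- The vector space `T_q Ω` of variational fields, as a type of its own (it carries the Sobolev
norm below, not the topology of pointwise convergence). -/
def VariationalField [FiniteDimensional ℝ E]
    (g : SmoothMetric E Q)
    (q : SmoothCurve E Q) : Type _ := variationalFields g q

instance [FiniteDimensional ℝ E]
    (g : SmoothMetric E Q)
    (q : SmoothCurve E Q) : AddCommGroup (VariationalField g q) :=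
  inferInstanceAs (AddCommGroup (variationalFields g q))

instance [FiniteDimensional ℝ E]
    (g : SmoothMetric E Q)
    (q : SmoothCurve E Q) : Module ℝ (VariationalField g q) :=
  inferInstanceAs (Module ℝ (variationalFields g q))

/-- The Sobolev product `∫_0^T (⟨X, Y⟩ + ⟨DX/dt, DY/dt⟩ + ⟨D²X/dt², D²Y/dt²⟩) dt` on `T_q Ω`. The
second covariant derivatives need not exist at the finitely many break points, which do not
contribute to the integral. -/
instance sobolevCore [FiniteDimensional ℝ E]
    (g : SmoothMetric E Q)
    (q : SmoothCurve E Q) : PreInnerProductSpace.Core ℝ (VariationalField g q) where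
  inner X Y := ∫ t in (0)..q.T, q.sobolevDensity g X.1 Y.1 t
  conj_inner_symm X Y := by
    simp only [conj_trivial]
    refine intervalIntegral.integral_congr fun t _ => ?_
    simp only [sobolevDensity]
    rw [g.symm, g.symm _ (q.D g Y.1 t), g.symm _ (q.D g (q.D g Y.1) t)]
  re_inner_nonneg X := by
    have h : ∀ (p : Q) (v : TangentSpace 𝓘(ℝ, E) p), 0 ≤ g.inner p v v := by
      intro p v
      by_cases hv : v = 0
      · rw [hv, map_zero]
      · exact (g.pos p v hv).le
    exact intervalIntegral.integral_nonneg q.T_pos.le fun t _ =>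
      add_nonneg (add_nonneg (h _ _) (h _ _)) (h _ _)
  add_left X Y Z := by
    rw [← intervalIntegral.integral_add (q.intervalIntegrable_sobolevDensity g X.2 Z.2)
      (q.intervalIntegrable_sobolevDensity g Y.2 Z.2)]
    refine intervalIntegral.integral_congr_ae ?_
    filter_upwards [q.ae_D_D_add g X.2 Y.2] with t h2 ht
    have ht' : t ∈ Icc 0 q.T := by
      rw [uIoc_of_le q.T_pos.le] at ht; exact Ioc_subset_Icc_self ht
    change q.sobolevDensity g (X.1 + Y.1) Z.1 t = _
    simp only [sobolevDensity]
    rw [h2 ht', q.D_add g X.2.contDiff_one Y.2.contDiff_one ht', Pi.add_apply]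
    simp only [map_add, add_apply]
    ring
  smul_left X Y r := by
    simp only [conj_trivial]
    rw [← intervalIntegral.integral_const_mul]
    refine intervalIntegral.integral_congr_ae ?_
    filter_upwards [q.ae_D_D_smul g r X.2] with t h2 ht
    have ht' : t ∈ Icc 0 q.T := by
      rw [uIoc_of_le q.T_pos.le] at ht; exact Ioc_subset_Icc_self ht
    change q.sobolevDensity g (r • X.1) Y.1 t = _
    simp only [sobolevDensity]
    rw [h2 ht', q.D_smul g r X.2.contDiff_one ht', Pi.smul_apply]
    simp only [map_smul, smul_apply, smul_eq_mul]
    ring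

instance [FiniteDimensional ℝ E]
    (g : SmoothMetric E Q)
    (q : SmoothCurve E Q) : SeminormedAddCommGroup (VariationalField g q) :=
  InnerProductSpace.Core.toSeminormedAddCommGroup (𝕜 := ℝ)

instance [FiniteDimensional ℝ E]
    (g : SmoothMetric E Q)
    (q : SmoothCurve E Q) : InnerProductSpace ℝ (VariationalField g q) :=
  InnerProductSpace.ofCore (sobolevCore g q)

theorem norm_sq_variationalField [FiniteDimensional ℝ E]
    (g : SmoothMetric E Q)
    (q : SmoothCurve E Q) (X : VariationalField g q) :
    ‖X‖ ^ 2 = ∫ t in (0)..q.T, (g.inner (q.toFun t) (X.1 t) (X.1 t)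
      + g.inner (q.toFun t) (q.D g X.1 t) (q.D g X.1 t)
      + g.inner (q.toFun t) (q.D g (q.D g X.1) t) (q.D g (q.D g X.1) t)) :=
  InnerProductSpace.norm_sq_eq_re_inner (𝕜 := ℝ) X

/-- The Hilbert space `H̊²_q`: the completion of `T_q Ω` for the Sobolev norm. -/
abbrev SobolevSpace [FiniteDimensional ℝ E]
    (g : SmoothMetric E Q)
    (q : SmoothCurve E Q) : Type _ := UniformSpace.Completion (VariationalField g q)

end SmoothCurve

/-- The curvature `R(u, v)w` at `y` of the connection with Christoffel symbols `Γ` on an open subset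
of `E`, with the convention `R(X, Y)Z = ∇_X ∇_Y Z - ∇_Y ∇_X Z - ∇_[X, Y] Z`. -/
def curvature (Γ : E → E → E → E) (y u v w : E) : E :=
  fderiv ℝ (fun z => Γ z v w) y u - fderiv ℝ (fun z => Γ z u w) y v
    + Γ y u (Γ y v w) - Γ y v (Γ y u w)

/-- The covariant derivative `(∇_a R)(u, v)w` of the curvature tensor at `y`. -/
def nablaCurvature (Γ : E → E → E → E) (y a u v w : E) : E :=
  fderiv ℝ (fun z => curvature Γ z u v w) y a + Γ y a (curvature Γ y u v w)
    - curvature Γ y (Γ y a u) v w - curvature Γ y u (Γ y a v) w - curvature Γ y u v (Γ y a w)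

/-- The second covariant derivative `(∇²_{b, a} R)(u, v)w` of the curvature tensor at `y`, that is,
the covariant derivative in the direction `b` of the tensor `(a, u, v, w) ↦ (∇_a R)(u, v)w`. -/
def nablaSqCurvature (Γ : E → E → E → E) (y b a u v w : E) : E :=
  fderiv ℝ (fun z => nablaCurvature Γ z a u v w) y b + Γ y b (nablaCurvature Γ y a u v w)
    - nablaCurvature Γ y (Γ y b a) u v w - nablaCurvature Γ y a (Γ y b u) v w
    - nablaCurvature Γ y a u (Γ y b v) w - nablaCurvature Γ y a u v (Γ y b w)

/-- The vector `F(X, Y)` of `T_p Q`, as a function of `X, DX = ∇_Y X, D2X = ∇²_Y X` and of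
`Y, DY = ∇_Y Y, D2Y = ∇²_Y Y` (in the application `Y` is the velocity of a curve, `X` a field along
the curve, and `∇_Y` is `D/dt`):
`F(X, Y) = (∇²_Y R)(X, Y)Y + (∇_X R)(∇_Y Y, Y)Y + R(R(X, Y)Y, Y)Y + R(X, ∇²_Y Y)Y`
`  + 2 [(∇_Y R)(∇_Y X, Y)Y + (∇_Y R)(X, ∇_Y Y)Y + R(∇²_Y X, Y)Y]`
`  + 3 [(∇_Y R)(X, Y)∇_Y Y + R(X, Y)∇²_Y Y + R(X, ∇_Y Y)∇_Y Y] + 4 R(∇_Y X, Y)∇_Y Y`.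
Here `∇²_Y R = ∇_Y (∇_Y R)` is the second covariant derivative of `R` along the curve, which is
`∇²_{Y, Y} R + ∇_{∇_Y Y} R` in terms of the tensor `∇² R`. -/
def jacobiTerm (g : SmoothMetric E Q) (p : Q) (X DX D2X Y DY D2Y : TangentSpace 𝓘(ℝ, E) p) :
    TangentSpace 𝓘(ℝ, E) p :=
  let Γ : E → E → E → E := christoffel (chartMetric g p)
  let y : E := extChartAt 𝓘(ℝ, E) p p
  let R : E → E → E → E := curvature Γ y
  let dR : E → E → E → E → E := nablaCurvature Γ y
  let ddR : E → E → E → E := fun u v w => nablaSqCurvature Γ y Y Y u v w + dR DY u v w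
  let F : E :=
    ddR X Y Y + dR X DY Y Y + R (R X Y Y) Y Y + R X D2Y Y
      + (2 : ℝ) • (dR Y DX Y Y + dR Y X DY Y + R D2X Y Y)
      + (3 : ℝ) • (dR Y X Y DY + R X Y D2Y + R X DY DY)
      + (4 : ℝ) • R DX Y DY
  F

/-- The gradient of `V` in the preferred chart at `x`: `g(grad V, w) = dV(w)`. -/
def chartGrad (g : SmoothMetric E Q) (V : Q → ℝ) (x : Q) (y : E) : E :=
  (chartMetric g x y).inverse (fderiv ℝ (fun z => V ((extChartAt 𝓘(ℝ, E) x).symm z)) y)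

/-- The covariant derivative `∇_X grad V` at `p`, for `X ∈ T_p Q`. -/
def nablaGrad (g : SmoothMetric E Q) (V : Q → ℝ) (p : Q) (X : TangentSpace 𝓘(ℝ, E) p) :
    TangentSpace 𝓘(ℝ, E) p :=
  let y : E := extChartAt 𝓘(ℝ, E) p p
  let Z : E := fderiv ℝ (chartGrad g V p) y X + christoffel (chartMetric g p) y X (chartGrad g V p y)
  Z

namespace SmoothCurve

/-- The velocity field of `q`. -/
def velocity (q : SmoothCurve E Q) : ∀ t, TangentSpace 𝓘(ℝ, E) (q.toFun t) :=
  velocityWithin q.toFun (Icc 0 q.T)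

/-- The vector field `F(X, q')` along `q`. -/
def jacobiField (g : SmoothMetric E Q) (q : SmoothCurve E Q)
    (X : ∀ t, TangentSpace 𝓘(ℝ, E) (q.toFun t)) (t : ℝ) : TangentSpace 𝓘(ℝ, E) (q.toFun t) :=
  jacobiTerm g (q.toFun t) (X t) (q.D g X t) (q.D g (q.D g X) t)
    (q.velocity t) (q.D g q.velocity t) (q.D g (q.D g q.velocity) t)

/-- The index form on `T_q Ω`:
`I(X, Y) = ∫_0^T (⟨D²X/dt², D²Y/dt²⟩ + ⟨Y, F(X, q') + ∇_X grad V⟩) dt`. -/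
def indexForm [FiniteDimensional ℝ E] (g : SmoothMetric E Q) (V : Q → ℝ) (q : SmoothCurve E Q)
    (X Y : VariationalField g q) : ℝ :=
  ∫ t in (0)..q.T,
    (g.inner (q.toFun t) (q.D g (q.D g X.1) t) (q.D g (q.D g Y.1) t)
      + g.inner (q.toFun t) (Y.1 t)
        (q.jacobiField g X.1 t + nablaGrad g V (q.toFun t) (X.1 t)))

end SmoothCurve

/-- The extended index of a bilinear form `B` on a real vector space: the supremum in `ℕ ∪ {∞}` of
the dimensions of the linear subspaces on which `B` is negative semidefinite. -/
def extendedIndex {H : Type*} [AddCommGroup H] [Module ℝ H] (B : H → H → ℝ) : ℕ∞ :=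
  ⨆ (W : Submodule ℝ H) (_ : ∀ w ∈ W, B w w ≤ 0), Cardinal.toENat (Module.rank ℝ W)

end Manifold

end

end VariationalObstacle

/-! The form `I` is the principal part $\int\|D^2X\|^2$ plus a term $\int\langle Y, F\rangle$ in
which $Y$ is not differentiated, and $F$ depends linearly on $(X, DX, D^2X)$. Everything rests on
one uniform bound along the compact curve, $\|F\|^2 \le C(\|X\|^2 + \|DX\|^2 + \|D^2X\|^2)$, which
is `SmoothCurve.exists_inner_force_le`. Young's inequality then gives two facts: `I` is bounded for
the Sobolev norm (`exists_abs_indexForm_le`), and it satisfies a Gårding inequality, $\frac34\|X\|^2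
\le I(X,X) + C(\int\|X\|^2 + \int\|DX\|^2)$ (`exists_norm_sq_le_indexForm`).

The lower-order integrals are not controlled by a compact embedding but by a subdivision, in the
manner of Morse. On an interval of length $h$ starting at $a$, $\int\|X\|^2 \le 2h\|X(a)\|^2 +
4h^2\int\|DX\|^2$, and likewise for $DX$ in place of $X$. Both follow from metric compatibility of
the connection, $\frac{d}{dt}\|Z\|^2 = 2\langle Z, DZ\rangle$. With $N$ intervals and $N$ large, the
$h^2$ terms are absorbed and there remains $\frac12\|X\|^2 \le I(X,X) + C\|\mathrm{ev}(X)\|^2$,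
where $\mathrm{ev}$ records $X$ and $DX$ at the $N$ nodes (`exists_eval_estimate`). The map
$\mathrm{ev}$ is continuous for the Sobolev norm and has values in the finite-dimensional space
$(E\times E)^N$. All these inequalities pass to the completion. On a subspace where $I \le 0$ the
extended $\mathrm{ev}$ is injective, which bounds the dimension
(`exists_extension_extendedIndex_lt_top`).

The bound on $F$ has a geometric half. The vector $F$ at $q(t)$ is defined through the preferred
chart at $q(t)$, which jumps with $t$, so its continuity in $t$ is not visible. One has to read it
in a chart that stays fixed for nearby $t$, that is, to prove that $R$, $\nabla R$, $\nabla^2R$ and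
$\nabla\operatorname{grad}V$ are tensors. The transformation law of the Christoffel symbols gives
this for $R$ by a direct computation. For covariant derivatives it follows by induction on the
number of covariant slots, organised by `TensorType`. -/

namespace VariationalObstacle

open Set Filter Topology MeasureTheory Bundle

noncomputable section

set_option synthInstance.maxHeartbeats 200000
set_option maxSynthPendingDepth 3

/-! ### Tensor calculus on open subsets of the model space. -/

section LocalCalculus

variable {E : Type*} [NormedAddCommGroup E] [NormedSpace ℝ E]
  {F : Type*} [NormedAddCommGroup F] [NormedSpace ℝ F]

/-- A type of tensors on `E`: the space `F` of tensors, the infinitesimal action of endomorphisms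
of `E` on `F`, and the relation between a tensor and its transform under a linear map. -/
structure TensorType (E F : Type*) [NormedAddCommGroup E] [NormedSpace ℝ E]
    [NormedAddCommGroup F] [NormedSpace ℝ F] where
  act : (E →L[ℝ] E) →L[ℝ] F →L[ℝ] F
  -- A relation, and not a push-forward map, so that covariant slots can be compared without
  -- inverting the linear map.
  rel : (E →L[ℝ] E) → F → F → Prop
  rel_sub : ∀ {T f₁ f₁' f₂ f₂'}, rel T f₁ f₁' → rel T f₂ f₂' → rel T (f₁ - f₂) (f₁' - f₂')
  -- In use `T` is the differential of a change of chart, `f'` is a tensor field pulled back by it,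
  -- and `M`, `M'` are the Christoffel symbols contracted with corresponding directions. The last
  -- hypothesis is then their transformation law, and the conclusion says that the covariant
  -- derivative is tensorial.
  rel_cov : ∀ {T : E → E →L[ℝ] E} {y a : E} {M M' : E →L[ℝ] E} {f f' : E → F},
    DifferentiableAt ℝ T y → DifferentiableAt ℝ f y → DifferentiableAt ℝ f' y →
    (∀ᶠ z in 𝓝 y, rel (T z) (f z) (f' z)) →
    (∀ u, T y (M u) = fderiv ℝ T y a u + M' (T y u)) →
    rel (T y) (fderiv ℝ f y a + act M (f y)) (fderiv ℝ f' y a + act M' (f' y))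

/-- Vectors, as tensors. -/
def TensorType.vec (E : Type*) [NormedAddCommGroup E] [NormedSpace ℝ E] : TensorType E E where
  act := ContinuousLinearMap.id ℝ _
  rel T v v' := T v = v'
  rel_sub := by rintro T _ _ _ _ rfl rfl; exact map_sub T _ _
  rel_cov := by
    intro T y a M M' f f' hT hf hf' h hM
    have h1 : fderiv ℝ f' y = fderiv ℝ (fun z => T z (f z)) y :=
      EventuallyEq.fderiv_eq (h.mono fun z hz => Eq.symm hz)
    rw [h1, (hT.hasFDerivAt.clm_apply hf.hasFDerivAt).fderiv]
    simp only [map_add, ContinuousLinearMap.id_apply, hM, add_apply,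
      ContinuousLinearMap.comp_apply, ContinuousLinearMap.flip_apply, h.self_of_nhds]
    rw [add_assoc]

/-- Tensors with one more covariant slot. -/
def TensorType.hom (τ : TensorType E F) : TensorType E (E →L[ℝ] F) where
  act := (ContinuousLinearMap.compL ℝ E F F).comp τ.act - (ContinuousLinearMap.compL ℝ E E F).flip
  rel T A A' := ∀ u, τ.rel T (A u) (A' (T u))
  rel_sub h₁ h₂ u := τ.rel_sub (h₁ u) (h₂ u)
  rel_cov := by
    intro T y a M M' A A' hT hA hA' h hM u
    have hTu : DifferentiableAt ℝ (fun z => T z u) y := hT.clm_apply (differentiableAt_const u)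
    have key := τ.rel_cov (f := fun z => A z u) (f' := fun z => A' z (T z u)) hT
      (hA.clm_apply (differentiableAt_const u)) (hA'.clm_apply hTu)
      (h.mono fun z hz => hz u) hM
    -- Differentiating `A' z (T z u)` also hits `T`, which produces `A' y (fderiv ℝ T y a u)`.
    -- Subtracting the relation at `M u` turns this term into `- A' y (M' (T y u))`, by `hM`; this
    -- is the correction that the new slot needs.
    have key2 := τ.rel_sub key (h.self_of_nhds (M u))
    rw [(hA.hasFDerivAt.clm_apply (hasFDerivAt_const u y)).fderiv,
      (hA'.hasFDerivAt.clm_apply (hT.hasFDerivAt.clm_apply (hasFDerivAt_const u y))).fderiv] at key2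
    convert key2 using 1
    · simp; abel
    · simp [hM]; abel

@[simp] theorem TensorType.vec_act (M : E →L[ℝ] E) (v : E) : (TensorType.vec E).act M v = M v := rfl

@[simp] theorem TensorType.hom_act (τ : TensorType E F) (M : E →L[ℝ] E) (A : E →L[ℝ] F) (u : E) :
    τ.hom.act M A u = τ.act M (A u) - A (M u) := rfl

/-- The covariant derivative of a tensor field. -/
def TensorType.nabla (τ : TensorType E F) (Γ : E → E →L[ℝ] E →L[ℝ] E) (A : E → F) (y : E) :
    E →L[ℝ] F :=
  fderiv ℝ A y + (τ.act.flip (A y)).comp (Γ y)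

theorem TensorType.nabla_apply (τ : TensorType E F) (Γ : E → E →L[ℝ] E →L[ℝ] E) (A : E → F)
    (y a : E) : τ.nabla Γ A y a = fderiv ℝ A y a + τ.act (Γ y a) (A y) := rfl

theorem TensorType.contDiffOn_nabla (τ : TensorType E F) {Γ : E → E →L[ℝ] E →L[ℝ] E} {A : E → F}
    {U : Set E} (hU : IsOpen U) (hΓ : ContDiffOn ℝ ∞ Γ U) (hA : ContDiffOn ℝ ∞ A U) :
    ContDiffOn ℝ ∞ (τ.nabla Γ A) U :=
  (hA.fderiv_of_isOpen hU (by simp)).add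
    (((ContinuousLinearMap.contDiff (F := (E →L[ℝ] E) →L[ℝ] F) τ.act.flip).comp_contDiffOn
      hA).clm_comp hΓ)

theorem TensorType.continuousWithinAt_nabla (τ : TensorType E F) {Γ : E → E →L[ℝ] E →L[ℝ] E}
    {A : E → F} {U : Set E} (hU : IsOpen U) (hΓ : ContDiffOn ℝ ∞ Γ U) (hA : ContDiffOn ℝ ∞ A U)
    {c b : ℝ → E} {S : Set ℝ} {t : ℝ} (hc : ContinuousWithinAt c S t)
    (hb : ContinuousWithinAt b S t) (hct : c t ∈ U) :
    ContinuousWithinAt (fun s => τ.nabla Γ A (c s) (b s)) S t :=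
  (((τ.contDiffOn_nabla hU hΓ hA).continuousOn.continuousAt
    (hU.mem_nhds hct)).comp_continuousWithinAt hc).clm_apply hb

/-- The covariant derivative of a tensor field is a tensor field. -/
theorem TensorType.rel_nabla (τ : TensorType E F) {Γ Γ' : E → E →L[ℝ] E →L[ℝ] E} {A A' : E → F}
    {φ : E → E} {O : Set E} (hO : IsOpen O) (hφ : ContDiffOn ℝ ∞ φ O)
    (hA : ∀ z ∈ O, DifferentiableAt ℝ A z) (hA' : ∀ z ∈ O, DifferentiableAt ℝ A' (φ z))
    (hΓ : ∀ z ∈ O, ∀ u v, fderiv ℝ φ z (Γ z u v) =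
      fderiv ℝ (fderiv ℝ φ) z u v + Γ' (φ z) (fderiv ℝ φ z u) (fderiv ℝ φ z v))
    (h : ∀ z ∈ O, τ.rel (fderiv ℝ φ z) (A z) (A' (φ z))) :
    ∀ z ∈ O, τ.hom.rel (fderiv ℝ φ z) (τ.nabla Γ A z) (τ.nabla Γ' A' (φ z)) := by
  intro z hz a
  have hφz := hφ.contDiffAt (hO.mem_nhds hz)
  have hφ1 : DifferentiableAt ℝ φ z := hφz.differentiableAt (by simp)
  have hφ2 : DifferentiableAt ℝ (fderiv ℝ φ) z :=
    (hφz.fderiv_right (m := ∞) (by simp)).differentiableAt (by simp)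
  have key := τ.rel_cov (a := a) (M := Γ z a) (M' := Γ' (φ z) (fderiv ℝ φ z a)) hφ2 (hA z hz)
    ((hA' z hz).comp z hφ1) (by filter_upwards [hO.mem_nhds hz] with w hw using h w hw)
    (hΓ z hz a)
  rw [fderiv_comp z (hA' z hz) hφ1] at key
  exact key

/-- The curvature of the connection with Christoffel symbols `Γ`, as a continuous trilinear map. -/
def curvatureL (Γ : E → E →L[ℝ] E →L[ℝ] E) (y : E) : E →L[ℝ] E →L[ℝ] E →L[ℝ] E :=
  let Q : E →L[ℝ] E →L[ℝ] E →L[ℝ] E :=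
    ((ContinuousLinearMap.compL ℝ E (E →L[ℝ] E) (E →L[ℝ] E)).flip (Γ y)).comp
      ((ContinuousLinearMap.compL ℝ E E E).comp (Γ y))
  fderiv ℝ Γ y - (fderiv ℝ Γ y).flip + Q - Q.flip

theorem curvatureL_apply (Γ : E → E →L[ℝ] E →L[ℝ] E) (y u v w : E) :
    curvatureL Γ y u v w = fderiv ℝ Γ y u v w - fderiv ℝ Γ y v u w + Γ y u (Γ y v w)
      - Γ y v (Γ y u w) := rfl

theorem contDiffOn_curvatureL {Γ : E → E →L[ℝ] E →L[ℝ] E} {U : Set E} (hU : IsOpen U)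
    (hΓ : ContDiffOn ℝ ∞ Γ U) : ContDiffOn ℝ ∞ (curvatureL Γ) U := by
  have h1 : ContDiffOn ℝ ∞ (fderiv ℝ Γ) U := hΓ.fderiv_of_isOpen hU (by simp)
  have hQ : ContDiffOn ℝ ∞ (fun y =>
    ((ContinuousLinearMap.compL ℝ E (E →L[ℝ] E) (E →L[ℝ] E)).flip (Γ y)).comp
      ((ContinuousLinearMap.compL ℝ E E E).comp (Γ y))) U :=
    ((ContinuousLinearMap.contDiff _).comp_contDiffOn hΓ).clm_comp
      (contDiffOn_const.clm_comp hΓ)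
  have hf : ∀ f : E → E →L[ℝ] E →L[ℝ] E →L[ℝ] E, ContDiffOn ℝ ∞ f U →
      ContDiffOn ℝ ∞ (fun y => (f y).flip) U := fun f h =>
    (ContinuousLinearMap.flipₗᵢ ℝ E E (E →L[ℝ] E)).contDiff.comp_contDiffOn h
  exact ((h1.sub (hf _ h1)).add hQ).sub (hf _ hQ)

/-- The curvature is a tensor field. -/
theorem curvatureL_transform {Γ Γ' : E → E →L[ℝ] E →L[ℝ] E} {φ : E → E} {O : Set E}
    (hO : IsOpen O) (hφ : ContDiffOn ℝ ∞ φ O)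
    (hΓd : ∀ z ∈ O, DifferentiableAt ℝ Γ z) (hΓd' : ∀ z ∈ O, DifferentiableAt ℝ Γ' (φ z))
    (hΓ : ∀ z ∈ O, ∀ u v, fderiv ℝ φ z (Γ z u v) =
      fderiv ℝ (fderiv ℝ φ) z u v + Γ' (φ z) (fderiv ℝ φ z u) (fderiv ℝ φ z v)) {z : E}
    (hz : z ∈ O) (u v w : E) : fderiv ℝ φ z (curvatureL Γ z u v w) =
      curvatureL Γ' (φ z) (fderiv ℝ φ z u) (fderiv ℝ φ z v) (fderiv ℝ φ z w) := by
  have hφz := hφ.contDiffAt (hO.mem_nhds hz)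
  have hφ1 : DifferentiableAt ℝ φ z := hφz.differentiableAt (by simp)
  have hφ2c : ContDiffAt ℝ ∞ (fderiv ℝ φ) z := hφz.fderiv_right (m := ∞) (by simp)
  have hφ2 : DifferentiableAt ℝ (fderiv ℝ φ) z := hφ2c.differentiableAt (by simp)
  have hφ3 : DifferentiableAt ℝ (fderiv ℝ (fderiv ℝ φ)) z :=
    (hφ2c.fderiv_right (m := ∞) (by simp)).differentiableAt (by simp)
  have hs : minSmoothness ℝ 2 ≤ (∞ : WithTop ℕ∞) := by
    rw [minSmoothness_of_isRCLikeNormedField]; exact WithTop.coe_le_coe.2 le_top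
  have sym2 : ∀ u v, fderiv ℝ (fderiv ℝ φ) z u v = fderiv ℝ (fderiv ℝ φ) z v u :=
    fun u v => (hφz.isSymmSndFDerivAt hs).eq u v
  have sym3 : ∀ u v, fderiv ℝ (fderiv ℝ (fderiv ℝ φ)) z u v =
      fderiv ℝ (fderiv ℝ (fderiv ℝ φ)) z v u :=
    fun u v => (hφ2c.isSymmSndFDerivAt hs).eq u v
  have dT : ∀ b, HasFDerivAt (fun z => fderiv ℝ φ z b) _ z := fun b =>
    hφ2.hasFDerivAt.clm_apply (hasFDerivAt_const b z)
  -- The transformation law of the Christoffel symbols, differentiated in the direction `a` and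
  -- solved for the derivative of `Γ'`.
  have key : ∀ a b c : E, fderiv ℝ Γ' (φ z) (fderiv ℝ φ z a) (fderiv ℝ φ z b) (fderiv ℝ φ z c) =
      fderiv ℝ (fderiv ℝ φ) z a (Γ z b c) + fderiv ℝ φ z (fderiv ℝ Γ z a b c)
      - fderiv ℝ (fderiv ℝ (fderiv ℝ φ)) z a b c
      - Γ' (φ z) (fderiv ℝ (fderiv ℝ φ) z a b) (fderiv ℝ φ z c)
      - Γ' (φ z) (fderiv ℝ φ z b) (fderiv ℝ (fderiv ℝ φ) z a c) := by
    intro a b c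
    have e1 : HasFDerivAt (fun z => fderiv ℝ φ z (Γ z b c)) _ z :=
      hφ2.hasFDerivAt.clm_apply (((hΓd z hz).hasFDerivAt.clm_apply
        (hasFDerivAt_const b z)).clm_apply (hasFDerivAt_const c z))
    have e2 : HasFDerivAt (fun z => fderiv ℝ (fderiv ℝ φ) z b c
        + Γ' (φ z) (fderiv ℝ φ z b) (fderiv ℝ φ z c)) _ z :=
      ((hφ3.hasFDerivAt.clm_apply (hasFDerivAt_const b z)).clm_apply (hasFDerivAt_const c z)).add
        ((((hΓd' z hz).hasFDerivAt.comp z hφ1.hasFDerivAt).clm_apply (dT b)).clm_apply (dT c))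
    have e3 : (fun z => fderiv ℝ φ z (Γ z b c)) =ᶠ[𝓝 z] (fun z => fderiv ℝ (fderiv ℝ φ) z b c
        + Γ' (φ z) (fderiv ℝ φ z b) (fderiv ℝ φ z c)) := by
      filter_upwards [hO.mem_nhds hz] with x hx using hΓ x hx b c
    have e4 := congrArg (fun L : E →L[ℝ] E => L a) (e1.unique (e2.congr_of_eventuallyEq e3))
    simp at e4
    rw [eq_sub_iff_add_eq, eq_sub_iff_add_eq, eq_sub_iff_add_eq,
      add_comm (fderiv ℝ (fderiv ℝ φ) z a _)]
    rw [e4]; abel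
  have hΓz : ∀ b c, Γ' (φ z) (fderiv ℝ φ z b) (fderiv ℝ φ z c) =
      fderiv ℝ φ z (Γ z b c) - fderiv ℝ (fderiv ℝ φ) z b c := fun b c => by
    rw [hΓ z hz]; abel
  -- Antisymmetrisation in `u, v` removes the third derivatives of `φ`. The second derivatives
  -- cancel against those that `hΓz` brings into the quadratic terms.
  rw [curvatureL_apply, curvatureL_apply, key, key, hΓz, hΓz]
  simp only [map_sub, map_add, hΓz]
  rw [sym2 v u, sym3 v u]
  abel

/-- The Christoffel symbols as a smooth family of continuous bilinear maps. -/
theorem exists_christoffelL [FiniteDimensional ℝ E] {G : E → E →L[ℝ] E →L[ℝ] ℝ} {U : Set E}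
    (hU : IsOpen U) (hG : ContDiffOn ℝ ∞ G U) (hi : ∀ y ∈ U, (G y).IsInvertible)
    (hs : ∀ y ∈ U, ∀ u v, G y u v = G y v u) :
    ∃ Γ : E → E →L[ℝ] E →L[ℝ] E, ContDiffOn ℝ ∞ Γ U ∧
      ∀ y ∈ U, ∀ u v, Γ y u v = christoffel G y u v := by
  have : CompleteSpace E := FiniteDimensional.complete ℝ E
  have hd : ∀ y ∈ U, DifferentiableAt ℝ G y := fun y hy =>
    (hG.contDiffAt (hU.mem_nhds hy)).differentiableAt (by simp)
  have hsy : ∀ y ∈ U, ∀ u v, christoffel G y u v = christoffel G y v u := fun y hy =>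
    christoffel_symm (by filter_upwards [hU.mem_nhds hy] with z hz using hs z hz)
  have h1 : ∀ y, ∃ L : E →L[ℝ] E →L[ℝ] E, y ∈ U → ∀ u v, L u v = christoffel G y u v := by
    intro y
    by_cases hy : y ∈ U
    · refine ⟨(LinearMap.mk₂ ℝ (christoffel G y) (christoffel_add_left (hd y hy))
        (christoffel_smul_left (hd y hy)) ?_ ?_).toContinuousBilinearMap, fun _ u v => rfl⟩
      · intro u v w
        rw [hsy y hy, hsy y hy u v, hsy y hy u w, christoffel_add_left (hd y hy)]
      · intro r u v
        rw [hsy y hy, hsy y hy u v, christoffel_smul_left (hd y hy)]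
    · exact ⟨0, fun h => absurd h hy⟩
  choose Γ hΓ using h1
  refine ⟨Γ, ?_, hΓ⟩
  -- In finite dimension, smoothness of an operator-valued map may be tested on fixed vectors.
  rw [contDiffOn_clm_apply]
  intro u
  rw [contDiffOn_clm_apply]
  intro v
  exact (contDiffOn_christoffel_const hU hG hi u v).congr fun y hy => hΓ y hy u v

/-- The covariant derivative of the curvature, as a continuous multilinear map. -/
def nablaCurvatureL (Γ : E → E →L[ℝ] E →L[ℝ] E) (y : E) :
    E →L[ℝ] E →L[ℝ] E →L[ℝ] E →L[ℝ] E :=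
  (TensorType.vec E).hom.hom.hom.nabla Γ (curvatureL Γ) y

/-- The second covariant derivative of the curvature, as a continuous multilinear map. -/
def nablaSqCurvatureL (Γ : E → E →L[ℝ] E →L[ℝ] E) (y b : E) :
    E →L[ℝ] E →L[ℝ] E →L[ℝ] E →L[ℝ] E :=
  (TensorType.vec E).hom.hom.hom.hom.nabla Γ (nablaCurvatureL Γ) y b

/-! ### Agreement of the pointwise curvature formulas with the multilinear ones. -/

section Bridge

variable {Γ : E → E → E → E} {ΓL : E → E →L[ℝ] E →L[ℝ] E} {U : Set E}

/-- The formula for `curvature` differentiates the Christoffel symbols with frozen arguments. As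
`ΓL` is differentiable as an operator-valued map, evaluation commutes with the derivative. Agreement
on the open set `U` is enough because a derivative sees only the germ. The next two bridges work in
the same way, each resting on the one before. -/
theorem curvature_eq (hU : IsOpen U) (hΓL : ContDiffOn ℝ ∞ ΓL U)
    (h : ∀ y ∈ U, ∀ u v, ΓL y u v = Γ y u v) {y : E} (hy : y ∈ U) (u v w : E) :
    curvature Γ y u v w = curvatureL ΓL y u v w := by
  have hd : DifferentiableAt ℝ ΓL y :=
    (hΓL.contDiffAt (hU.mem_nhds hy)).differentiableAt (by simp)
  have h1 : ∀ a b c, fderiv ℝ (fun z => Γ z b c) y a = fderiv ℝ ΓL y a b c := by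
    intro a b c
    have e : (fun z => Γ z b c) =ᶠ[𝓝 y] fun z => ΓL z b c := by
      filter_upwards [hU.mem_nhds hy] with z hz using (h z hz b c).symm
    rw [e.fderiv_eq, ((hd.hasFDerivAt.clm_apply (hasFDerivAt_const b y)).clm_apply
      (hasFDerivAt_const c y)).fderiv]
    simp
  rw [curvature, curvatureL_apply]
  simp only [h1, h y hy]

theorem nablaCurvature_eq (hU : IsOpen U) (hΓL : ContDiffOn ℝ ∞ ΓL U)
    (h : ∀ y ∈ U, ∀ u v, ΓL y u v = Γ y u v) {y : E} (hy : y ∈ U) (a u v w : E) :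
    nablaCurvature Γ y a u v w = nablaCurvatureL ΓL y a u v w := by
  have hd : DifferentiableAt ℝ (curvatureL ΓL) y :=
    ((contDiffOn_curvatureL hU hΓL).contDiffAt (hU.mem_nhds hy)).differentiableAt (by simp)
  have h1 : fderiv ℝ (fun z => curvature Γ z u v w) y a = fderiv ℝ (curvatureL ΓL) y a u v w := by
    have e : (fun z => curvature Γ z u v w) =ᶠ[𝓝 y] fun z => curvatureL ΓL z u v w := by
      filter_upwards [hU.mem_nhds hy] with z hz using curvature_eq hU hΓL h hz u v w
    rw [e.fderiv_eq, (((hd.hasFDerivAt.clm_apply (hasFDerivAt_const u y)).clm_apply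
      (hasFDerivAt_const v y)).clm_apply (hasFDerivAt_const w y)).fderiv]
    simp
  rw [nablaCurvature, nablaCurvatureL, TensorType.nabla_apply]
  simp only [h1, curvature_eq hU hΓL h hy, add_apply, sub_apply, TensorType.hom_act,
    TensorType.vec_act, h y hy]
  abel

theorem contDiffOn_nablaCurvatureL (hU : IsOpen U) (hΓL : ContDiffOn ℝ ∞ ΓL U) :
    ContDiffOn ℝ ∞ (nablaCurvatureL ΓL) U :=
  (TensorType.vec E).hom.hom.hom.contDiffOn_nabla hU hΓL (contDiffOn_curvatureL hU hΓL)

theorem nablaSqCurvature_eq (hU : IsOpen U) (hΓL : ContDiffOn ℝ ∞ ΓL U)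
    (h : ∀ y ∈ U, ∀ u v, ΓL y u v = Γ y u v) {y : E} (hy : y ∈ U) (b a u v w : E) :
    nablaSqCurvature Γ y b a u v w = nablaSqCurvatureL ΓL y b a u v w := by
  have hd : DifferentiableAt ℝ (nablaCurvatureL ΓL) y :=
    ((contDiffOn_nablaCurvatureL hU hΓL).contDiffAt (hU.mem_nhds hy)).differentiableAt (by simp)
  have h1 : fderiv ℝ (fun z => nablaCurvature Γ z a u v w) y b =
      fderiv ℝ (nablaCurvatureL ΓL) y b a u v w := by
    have e : (fun z => nablaCurvature Γ z a u v w) =ᶠ[𝓝 y]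
        fun z => nablaCurvatureL ΓL z a u v w := by
      filter_upwards [hU.mem_nhds hy] with z hz using nablaCurvature_eq hU hΓL h hz a u v w
    rw [e.fderiv_eq, ((((hd.hasFDerivAt.clm_apply (hasFDerivAt_const a y)).clm_apply
      (hasFDerivAt_const u y)).clm_apply
      (hasFDerivAt_const v y)).clm_apply (hasFDerivAt_const w y)).fderiv]
    simp
  rw [nablaSqCurvature, nablaSqCurvatureL, TensorType.nabla_apply]
  simp only [h1, nablaCurvature_eq hU hΓL h hy, add_apply, sub_apply, TensorType.hom_act,
    TensorType.vec_act, h y hy]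
  abel

end Bridge

end LocalCalculus

/-! ### Change of chart: Christoffel symbols, curvature, gradient and force. -/

section ChartForce

variable {E : Type*} [NormedAddCommGroup E] [NormedSpace ℝ E]
  {Q : Type*} [TopologicalSpace Q] [ChartedSpace E Q]

/-- The change of coordinates from the preferred chart at `p` to the one at `x`. -/
def transition (E : Type*) {Q : Type*} [NormedAddCommGroup E] [NormedSpace ℝ E]
    [TopologicalSpace Q] [ChartedSpace E Q] (p x : Q) : E → E :=
  extChartAt 𝓘(ℝ, E) x ∘ (extChartAt 𝓘(ℝ, E) p).symm

/-- The domain of the change of coordinates `transition E p x`. -/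
def overlap (E : Type*) {Q : Type*} [NormedAddCommGroup E] [NormedSpace ℝ E]
    [TopologicalSpace Q] [ChartedSpace E Q] (p x : Q) : Set E :=
  ((extChartAt 𝓘(ℝ, E) p).symm ≫ extChartAt 𝓘(ℝ, E) x).source

theorem isOpen_overlap (p x : Q) : IsOpen (overlap E p x) := by
  have := isOpen_extChartAt_source (I := 𝓘(ℝ, E)) x
  simp only [overlap, PartialEquiv.trans_source, PartialEquiv.symm_source]
  exact (continuousOn_extChartAt_symm p).isOpen_inter_preimage (isOpen_extChartAt_target p) this

theorem mem_overlap {p x r : Q} (hp : r ∈ (extChartAt 𝓘(ℝ, E) p).source)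
    (hx : r ∈ (extChartAt 𝓘(ℝ, E) x).source) : extChartAt 𝓘(ℝ, E) p r ∈ overlap E p x := by
  refine ⟨(extChartAt 𝓘(ℝ, E) p).map_source hp, ?_⟩
  change (extChartAt 𝓘(ℝ, E) p).symm (extChartAt 𝓘(ℝ, E) p r) ∈ (extChartAt 𝓘(ℝ, E) x).source
  rwa [(extChartAt 𝓘(ℝ, E) p).left_inv hp]

theorem transition_apply {p x r : Q} (hp : r ∈ (extChartAt 𝓘(ℝ, E) p).source) :
    transition E p x (extChartAt 𝓘(ℝ, E) p r) = extChartAt 𝓘(ℝ, E) x r := by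
  simp only [transition, Function.comp_apply, (extChartAt 𝓘(ℝ, E) p).left_inv hp]

theorem transition_mem_target {p x : Q} {z : E} (hz : z ∈ overlap E p x) :
    transition E p x z ∈ (extChartAt 𝓘(ℝ, E) x).target :=
  (extChartAt 𝓘(ℝ, E) x).map_source hz.2

variable [IsManifold 𝓘(ℝ, E) ∞ Q]

theorem contDiffOn_transition (p x : Q) :
    ContDiffOn ℝ ∞ (transition E p x) (overlap E p x) :=
  contDiffOn_ext_coord_change (I := 𝓘(ℝ, E)) (n := ∞) x p

theorem fderiv_transition {p x : Q} {z : E} (hz : z ∈ overlap E p x) :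
    fderiv ℝ (transition E p x) z =
      tangentCoordChange 𝓘(ℝ, E) p x ((extChartAt 𝓘(ℝ, E) p).symm z) := by
  rw [tangentCoordChange_def, (extChartAt 𝓘(ℝ, E) p).right_inv hz.1]
  simp [transition]

theorem fderiv_transition_surjective {p x : Q} {z : E} (hz : z ∈ overlap E p x) :
    Function.Surjective (fderiv ℝ (transition E p x) z) := by
  intro w
  have hz1 : (extChartAt 𝓘(ℝ, E) p).symm z ∈ (extChartAt 𝓘(ℝ, E) p).source :=
    (extChartAt 𝓘(ℝ, E) p).map_target hz.1
  have hz2 : (extChartAt 𝓘(ℝ, E) p).symm z ∈ (extChartAt 𝓘(ℝ, E) x).source := hz.2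
  refine ⟨tangentCoordChange 𝓘(ℝ, E) x p ((extChartAt 𝓘(ℝ, E) p).symm z) w, ?_⟩
  rw [fderiv_transition hz, tangentCoordChange_comp ⟨⟨hz2, hz1⟩, hz2⟩, tangentCoordChange_self hz2]

theorem chartMetric_transition (g : SmoothMetric E Q) {p x : Q} {z : E} (hz : z ∈ overlap E p x)
    (u v : E) : chartMetric g p z u v = chartMetric g x (transition E p x z)
      (fderiv ℝ (transition E p x) z u) (fderiv ℝ (transition E p x) z v) := by
  rw [fderiv_transition hz]
  have hz1 : (extChartAt 𝓘(ℝ, E) p).symm z ∈ (extChartAt 𝓘(ℝ, E) p).source :=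
    (extChartAt 𝓘(ℝ, E) p).map_target hz.1
  have hz2 : (extChartAt 𝓘(ℝ, E) p).symm z ∈ (extChartAt 𝓘(ℝ, E) x).source := hz.2
  have e1 := chartMetric_apply g p _ hz1 u v
  rw [(extChartAt 𝓘(ℝ, E) p).right_inv hz.1] at e1
  have e2 := chartMetric_apply g x _ hz2
    (tangentCoordChange 𝓘(ℝ, E) p x ((extChartAt 𝓘(ℝ, E) p).symm z) u)
    (tangentCoordChange 𝓘(ℝ, E) p x ((extChartAt 𝓘(ℝ, E) p).symm z) v)
  rw [tangentCoordChange_comp ⟨⟨hz1, hz2⟩, mem_extChartAt_source _⟩,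
    tangentCoordChange_comp ⟨⟨hz1, hz2⟩, mem_extChartAt_source _⟩] at e2
  exact e1.trans e2.symm

/-- Allows norms of vectors at all points near a given one to be computed in a single chart. -/
theorem inner_eq_chartMetric (g : SmoothMetric E Q) {p x : Q}
    (hp : p ∈ (extChartAt 𝓘(ℝ, E) x).source) (u v : TangentSpace 𝓘(ℝ, E) p) :
    g.inner p u v = chartMetric g x (extChartAt 𝓘(ℝ, E) x p)
      (tangentCoordChange 𝓘(ℝ, E) p x p u) (tangentCoordChange 𝓘(ℝ, E) p x p v) := by
  have h := mem_extChartAt_source (I := 𝓘(ℝ, E)) p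
  have key : ∀ w : E, tangentCoordChange 𝓘(ℝ, E) x p p (tangentCoordChange 𝓘(ℝ, E) p x p w) = w :=
    fun w => by rw [tangentCoordChange_comp ⟨⟨h, hp⟩, h⟩, tangentCoordChange_self h]
  rw [chartMetric_apply g x p hp]
  exact (congrArg₂ (fun a b : E => g.inner p a b) (key u) (key v)).symm

theorem contDiffOn_chart {V : Q → ℝ} (hV : ContMDiff 𝓘(ℝ, E) 𝓘(ℝ, ℝ) ∞ V) (x : Q) :
    ContDiffOn ℝ ∞ (fun z => V ((extChartAt 𝓘(ℝ, E) x).symm z))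
      (extChartAt 𝓘(ℝ, E) x).target := by
  rw [← contMDiffOn_iff_contDiffOn]
  exact hV.comp_contMDiffOn (contMDiffOn_extChartAt_symm x)

variable [FiniteDimensional ℝ E]

theorem differentiableAt_chartMetric (g : SmoothMetric E Q) {x : Q} {y : E}
    (hy : y ∈ (extChartAt 𝓘(ℝ, E) x).target) : DifferentiableAt ℝ (chartMetric g x) y :=
  ((contDiffOn_chartMetric g x).contDiffAt
    ((isOpen_extChartAt_target x).mem_nhds hy)).differentiableAt (by simp)

theorem exists_chartChristoffel (g : SmoothMetric E Q) (x : Q) :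
    ∃ Γ : E → E →L[ℝ] E →L[ℝ] E, ContDiffOn ℝ ∞ Γ (extChartAt 𝓘(ℝ, E) x).target ∧
      ∀ y ∈ (extChartAt 𝓘(ℝ, E) x).target, ∀ u v, Γ y u v = christoffel (chartMetric g x) y u v :=
  exists_christoffelL (isOpen_extChartAt_target x) (contDiffOn_chartMetric g x)
    (chartMetric_isInvertible g x) (fun y _ => chartMetric_symm g x y)

/-- The Christoffel symbols of `g` in the preferred chart at `x`, as bilinear maps. -/
def chartChristoffel (g : SmoothMetric E Q) (x : Q) : E → E →L[ℝ] E →L[ℝ] E :=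
  (exists_chartChristoffel g x).choose

theorem contDiffOn_chartChristoffel (g : SmoothMetric E Q) (x : Q) :
    ContDiffOn ℝ ∞ (chartChristoffel g x) (extChartAt 𝓘(ℝ, E) x).target :=
  (exists_chartChristoffel g x).choose_spec.1

theorem chartChristoffel_apply (g : SmoothMetric E Q) (x : Q) :
    ∀ y ∈ (extChartAt 𝓘(ℝ, E) x).target, ∀ u v,
      chartChristoffel g x y u v = christoffel (chartMetric g x) y u v :=
  (exists_chartChristoffel g x).choose_spec.2

/-- A change of chart is an isometry between the two chart metrics, so `christoffel_transform`
applies. This is the one non-tensorial law; the tensoriality of the curvature and of all covariant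
derivatives below is deduced from it. -/
theorem chartChristoffel_transition (g : SmoothMetric E Q) (p x : Q) :
    ∀ z ∈ overlap E p x, ∀ u v,
      fderiv ℝ (transition E p x) z (chartChristoffel g p z u v) =
        fderiv ℝ (fderiv ℝ (transition E p x)) z u v +
          chartChristoffel g x (transition E p x z)
            (fderiv ℝ (transition E p x) z u) (fderiv ℝ (transition E p x) z v) := by
  intro z hz u v
  have hτ := (contDiffOn_transition p x).contDiffAt ((isOpen_overlap (E := E) p x).mem_nhds hz)
  rw [chartChristoffel_apply g p z hz.1, chartChristoffel_apply g x _ (transition_mem_target hz)]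
  exact christoffel_transform (differentiableAt_chartMetric g hz.1)
    (differentiableAt_chartMetric g (transition_mem_target hz))
    (hτ.differentiableAt (by simp))
    ((hτ.fderiv_right (m := ∞) (by simp)).differentiableAt (by simp))
    (fun u v => (hτ.isSymmSndFDerivAt
      (by rw [minSmoothness_of_isRCLikeNormedField]; exact WithTop.coe_le_coe.2 le_top)).eq u v)
    (fderiv_transition_surjective hz) (chartMetric_symm g x _)
    (chartMetric_isInvertible g p _ hz.1)
    (chartMetric_isInvertible g x _ (transition_mem_target hz))
    (by filter_upwards [(isOpen_overlap (E := E) p x).mem_nhds hz] with w hw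
        using chartMetric_transition g hw) u v

/-! ### The curvature in charts -/

/-- The curvature in the preferred chart at `x`. -/
def chartCurvature (g : SmoothMetric E Q) (x : Q) : E → E →L[ℝ] E →L[ℝ] E →L[ℝ] E :=
  curvatureL (chartChristoffel g x)

theorem contDiffOn_chartCurvature (g : SmoothMetric E Q) (x : Q) :
    ContDiffOn ℝ ∞ (chartCurvature g x) (extChartAt 𝓘(ℝ, E) x).target :=
  contDiffOn_curvatureL (isOpen_extChartAt_target x) (contDiffOn_chartChristoffel g x)

theorem chartCurvature_transition (g : SmoothMetric E Q) (p x : Q) :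
    ∀ z ∈ overlap E p x, (TensorType.vec E).hom.hom.hom.rel (fderiv ℝ (transition E p x) z)
      (chartCurvature g p z) (chartCurvature g x (transition E p x z)) := by
  intro z hz u v w
  refine curvatureL_transform (isOpen_overlap p x) (contDiffOn_transition p x)
    (fun z hz => ?_) (fun z hz => ?_) (chartChristoffel_transition g p x) hz u v w
  · exact ((contDiffOn_chartChristoffel g p).contDiffAt
      ((isOpen_extChartAt_target p).mem_nhds hz.1)).differentiableAt (by simp)
  · exact ((contDiffOn_chartChristoffel g x).contDiffAt
      ((isOpen_extChartAt_target x).mem_nhds (transition_mem_target hz))).differentiableAt (by simp)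

theorem TensorType.rel_nabla_chart {F : Type*} [NormedAddCommGroup F] [NormedSpace ℝ F]
    (τ : TensorType E F) (g : SmoothMetric E Q) (p x : Q) {A A' : E → F}
    (hA : ContDiffOn ℝ ∞ A (extChartAt 𝓘(ℝ, E) p).target)
    (hA' : ContDiffOn ℝ ∞ A' (extChartAt 𝓘(ℝ, E) x).target)
    (h : ∀ z ∈ overlap E p x, τ.rel (fderiv ℝ (transition E p x) z) (A z)
      (A' (transition E p x z))) :
    ∀ z ∈ overlap E p x, τ.hom.rel (fderiv ℝ (transition E p x) z)
      (τ.nabla (chartChristoffel g p) A z)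
      (τ.nabla (chartChristoffel g x) A' (transition E p x z)) := by
  refine τ.rel_nabla (isOpen_overlap p x) (contDiffOn_transition p x) (fun z hz => ?_)
    (fun z hz => ?_) (chartChristoffel_transition g p x) h
  · exact (hA.contDiffAt ((isOpen_extChartAt_target p).mem_nhds hz.1)).differentiableAt (by simp)
  · exact (hA'.contDiffAt ((isOpen_extChartAt_target x).mem_nhds
      (transition_mem_target hz))).differentiableAt (by simp)

/-- The covariant derivative of the curvature in the preferred chart at `x`. -/
def chartNablaCurvature (g : SmoothMetric E Q) (x : Q) :
    E → E →L[ℝ] E →L[ℝ] E →L[ℝ] E →L[ℝ] E :=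
  nablaCurvatureL (chartChristoffel g x)

theorem contDiffOn_chartNablaCurvature (g : SmoothMetric E Q) (x : Q) :
    ContDiffOn ℝ ∞ (chartNablaCurvature g x) (extChartAt 𝓘(ℝ, E) x).target :=
  contDiffOn_nablaCurvatureL (isOpen_extChartAt_target x) (contDiffOn_chartChristoffel g x)

theorem chartNablaCurvature_transition (g : SmoothMetric E Q) (p x : Q) :
    ∀ z ∈ overlap E p x, (TensorType.vec E).hom.hom.hom.hom.rel (fderiv ℝ (transition E p x) z)
      (chartNablaCurvature g p z) (chartNablaCurvature g x (transition E p x z)) :=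
  (TensorType.vec E).hom.hom.hom.rel_nabla_chart g p x (contDiffOn_chartCurvature g p)
    (contDiffOn_chartCurvature g x) (chartCurvature_transition g p x)

/-- The second covariant derivative of the curvature in the preferred chart at `x`. -/
def chartNablaSqCurvature (g : SmoothMetric E Q) (x : Q) :
    E → E → E →L[ℝ] E →L[ℝ] E →L[ℝ] E →L[ℝ] E :=
  nablaSqCurvatureL (chartChristoffel g x)

theorem chartNablaSqCurvature_transition (g : SmoothMetric E Q) (p x : Q) :
    ∀ z ∈ overlap E p x, ∀ b, (TensorType.vec E).hom.hom.hom.hom.rel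
      (fderiv ℝ (transition E p x) z) (chartNablaSqCurvature g p z b)
      (chartNablaSqCurvature g x (transition E p x z) (fderiv ℝ (transition E p x) z b)) :=
  (TensorType.vec E).hom.hom.hom.hom.rel_nabla_chart g p x (contDiffOn_chartNablaCurvature g p)
    (contDiffOn_chartNablaCurvature g x) (chartNablaCurvature_transition g p x)

/-! ### The gradient in charts -/

theorem contDiffOn_chartGrad (g : SmoothMetric E Q) {V : Q → ℝ}
    (hV : ContMDiff 𝓘(ℝ, E) 𝓘(ℝ, ℝ) ∞ V) (x : Q) :
    ContDiffOn ℝ ∞ (chartGrad g V x) (extChartAt 𝓘(ℝ, E) x).target := by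
  have : CompleteSpace E := FiniteDimensional.complete ℝ E
  have hinv : ContDiffOn ℝ ∞ (fun y => (chartMetric g x y).inverse)
      (extChartAt 𝓘(ℝ, E) x).target := fun y hy =>
    ((chartMetric_isInvertible g x y hy).contDiffAt_map_inverse).comp_contDiffWithinAt y
      (contDiffOn_chartMetric g x y hy)
  exact hinv.clm_apply ((contDiffOn_chart hV x).fderiv_of_isOpen (isOpen_extChartAt_target x)
    (by simp))

/-- Both sides have the same product with every vector of the form `fderiv ℝ (transition E p x) z
c`: on each side it is the derivative of `V` along `c`, since the change of chart is an isometry and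
by the chain rule. These vectors exhaust `E`, and the metric is nondegenerate. -/
theorem chartGrad_transition (g : SmoothMetric E Q) {V : Q → ℝ}
    (hV : ContMDiff 𝓘(ℝ, E) 𝓘(ℝ, ℝ) ∞ V) (p x : Q) :
    ∀ z ∈ overlap E p x, (TensorType.vec E).rel (fderiv ℝ (transition E p x) z)
      (chartGrad g V p z) (chartGrad g V x (transition E p x z)) := by
  intro z hz
  change fderiv ℝ (transition E p x) z (chartGrad g V p z) = chartGrad g V x (transition E p x z)
  have hτ := (contDiffOn_transition p x).contDiffAt ((isOpen_overlap (E := E) p x).mem_nhds hz)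
  have hx := chartMetric_isInvertible g x _ (transition_mem_target hz)
  have hp := chartMetric_isInvertible g p _ hz.1
  have hinj : Function.Injective (chartMetric g x (transition E p x z)) := by
    obtain ⟨e, he⟩ := hx
    rw [← he]; exact e.injective
  have hdV : fderiv ℝ (fun w => V ((extChartAt 𝓘(ℝ, E) p).symm w)) z =
      (fderiv ℝ (fun w => V ((extChartAt 𝓘(ℝ, E) x).symm w)) (transition E p x z)).comp
        (fderiv ℝ (transition E p x) z) := by
    rw [← fderiv_comp z (((contDiffOn_chart hV x).contDiffAt
      ((isOpen_extChartAt_target x).mem_nhds (transition_mem_target hz))).differentiableAt (by simp))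
      (hτ.differentiableAt (by simp))]
    refine EventuallyEq.fderiv_eq ?_
    filter_upwards [(isOpen_overlap (E := E) p x).mem_nhds hz] with w hw
    exact congrArg V ((extChartAt 𝓘(ℝ, E) x).left_inv hw.2).symm
  apply hinj
  ext c'
  obtain ⟨c, rfl⟩ := fderiv_transition_surjective hz c'
  rw [← chartMetric_transition g hz, chartGrad, chartGrad, hp.self_apply_inverse,
    hx.self_apply_inverse, hdV]
  rfl

/-! ### The force in charts -/

/-- The vector `F(X, Y) + ∇_X grad V` in the preferred chart at `x`. -/
def chartForce (g : SmoothMetric E Q) (V : Q → ℝ) (x : Q) (y Y DY D2Y X DX D2X : E) : E :=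
  let R := chartCurvature g x y
  let dR := chartNablaCurvature g x y
  chartNablaSqCurvature g x y Y Y X Y Y + dR DY X Y Y + dR X DY Y Y + R (R X Y Y) Y Y + R X D2Y Y
    + (2 : ℝ) • (dR Y DX Y Y + dR Y X DY Y + R D2X Y Y)
    + (3 : ℝ) • (dR Y X Y DY + R X Y D2Y + R X DY DY)
    + (4 : ℝ) • R DX Y DY
    + (TensorType.vec E).nabla (chartChristoffel g x) (chartGrad g V x) y X

/-- Entry point from the given definitions, which use only the chart centred at the point itself, to
an expression that makes sense in every chart. -/
theorem jacobiTerm_add_nablaGrad (g : SmoothMetric E Q) (V : Q → ℝ) (p : Q)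
    (X DX D2X Y DY D2Y : TangentSpace 𝓘(ℝ, E) p) :
    jacobiTerm g p X DX D2X Y DY D2Y + nablaGrad g V p X =
      chartForce g V p (extChartAt 𝓘(ℝ, E) p p) Y DY D2Y X DX D2X := by
  have hU := isOpen_extChartAt_target (I := 𝓘(ℝ, E)) p
  have hy : extChartAt 𝓘(ℝ, E) p p ∈ (extChartAt 𝓘(ℝ, E) p).target := mem_extChartAt_target _
  have hΓ := contDiffOn_chartChristoffel g p
  have h := chartChristoffel_apply g p
  have hR := fun u v w => curvature_eq hU hΓ h hy u v w
  have hdR := fun a u v w => nablaCurvature_eq hU hΓ h hy a u v w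
  have hddR := fun b a u v w => nablaSqCurvature_eq hU hΓ h hy b a u v w
  suffices H : ∀ X DX D2X Y DY D2Y : E, (jacobiTerm g p X DX D2X Y DY D2Y : E)
      + (nablaGrad g V p X : E) = chartForce g V p (extChartAt 𝓘(ℝ, E) p p) Y DY D2Y X DX D2X from
    H X DX D2X Y DY D2Y
  intro X DX D2X Y DY D2Y
  simp only [jacobiTerm, nablaGrad, hR, hdR, hddR, ← h _ hy]
  rfl

/-- The force is a sum of contractions of $R$, $\nabla R$, $\nabla^2R$ and
$\nabla\operatorname{grad}V$, each of which has been shown to be a tensor, so the differential of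
the change of chart passes through every term. -/
theorem chartForce_transition (g : SmoothMetric E Q) {V : Q → ℝ}
    (hV : ContMDiff 𝓘(ℝ, E) 𝓘(ℝ, ℝ) ∞ V) {p x : Q} {z : E} (hz : z ∈ overlap E p x)
    (Y DY D2Y X DX D2X : E) :
    fderiv ℝ (transition E p x) z (chartForce g V p z Y DY D2Y X DX D2X) =
      chartForce g V x (transition E p x z)
        (fderiv ℝ (transition E p x) z Y) (fderiv ℝ (transition E p x) z DY)
        (fderiv ℝ (transition E p x) z D2Y) (fderiv ℝ (transition E p x) z X)
        (fderiv ℝ (transition E p x) z DX) (fderiv ℝ (transition E p x) z D2X) := by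
  have hR : ∀ u v w, _ = _ := chartCurvature_transition g p x z hz
  have hdR : ∀ a u v w, _ = _ := chartNablaCurvature_transition g p x z hz
  have hddR : ∀ b a u v w, _ = _ := chartNablaSqCurvature_transition g p x z hz
  have hgr : ∀ a, _ = _ := (TensorType.vec E).rel_nabla_chart g p x (contDiffOn_chartGrad g hV p)
    (contDiffOn_chartGrad g hV x) (chartGrad_transition g hV p x) z hz
  simp only [chartForce, map_add, map_smul, hR, hdR, hddR, hgr]

/-- Each summand contains exactly one of `X`, `DX`, `D2X`, and contains it once. -/
theorem isLinearMap_chartForce (g : SmoothMetric E Q) (V : Q → ℝ) (x : Q) (y Y DY D2Y : E) :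
    IsLinearMap ℝ fun u : E × E × E => chartForce g V x y Y DY D2Y u.1 u.2.1 u.2.2 := by
  constructor
  · intro u v
    simp only [chartForce, Prod.fst_add, Prod.snd_add, map_add, add_apply]
    module
  · intro r u
    simp only [chartForce, Prod.smul_fst, Prod.smul_snd, map_smul, smul_apply]
    module

theorem continuousWithinAt_chartForce (g : SmoothMetric E Q) {V : Q → ℝ}
    (hV : ContMDiff 𝓘(ℝ, E) 𝓘(ℝ, ℝ) ∞ V) (x : Q) {y Y DY D2Y X DX D2X : ℝ → E} {S : Set ℝ} {t : ℝ}
    (hy : ContinuousWithinAt y S t) (hyt : y t ∈ (extChartAt 𝓘(ℝ, E) x).target)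
    (hY : ContinuousWithinAt Y S t) (hDY : ContinuousWithinAt DY S t)
    (hD2Y : ContinuousWithinAt D2Y S t) (hX : ContinuousWithinAt X S t)
    (hDX : ContinuousWithinAt DX S t) (hD2X : ContinuousWithinAt D2X S t) :
    ContinuousWithinAt
      (fun s => chartForce g V x (y s) (Y s) (DY s) (D2Y s) (X s) (DX s) (D2X s)) S t := by
  have hU := isOpen_extChartAt_target (I := 𝓘(ℝ, E)) x
  have hΓ := contDiffOn_chartChristoffel g x
  have hR : ContinuousWithinAt (fun s => chartCurvature g x (y s)) S t :=
    ((contDiffOn_chartCurvature g x).continuousOn.continuousAt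
      (hU.mem_nhds hyt)).comp_continuousWithinAt hy
  have hdR : ContinuousWithinAt (fun s => chartNablaCurvature g x (y s)) S t :=
    ((contDiffOn_chartNablaCurvature g x).continuousOn.continuousAt
      (hU.mem_nhds hyt)).comp_continuousWithinAt hy
  have hddR : ContinuousWithinAt (fun s => chartNablaSqCurvature g x (y s) (Y s)) S t :=
    (TensorType.vec E).hom.hom.hom.hom.continuousWithinAt_nabla hU hΓ
      (contDiffOn_chartNablaCurvature g x) hy hY hyt
  have hgr : ContinuousWithinAt (fun s => (TensorType.vec E).nabla (chartChristoffel g x)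
      (chartGrad g V x) (y s) (X s)) S t :=
    (TensorType.vec E).continuousWithinAt_nabla hU hΓ (contDiffOn_chartGrad g hV x) hy hX hyt
  have hR3 : ∀ {u v w : ℝ → E}, ContinuousWithinAt u S t → ContinuousWithinAt v S t →
      ContinuousWithinAt w S t →
      ContinuousWithinAt (fun s => chartCurvature g x (y s) (u s) (v s) (w s)) S t :=
    fun hu hv hw => ((hR.clm_apply hu).clm_apply hv).clm_apply hw
  have hdR4 : ∀ {a u v w : ℝ → E}, ContinuousWithinAt a S t → ContinuousWithinAt u S t →
      ContinuousWithinAt v S t → ContinuousWithinAt w S t →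
      ContinuousWithinAt (fun s => chartNablaCurvature g x (y s) (a s) (u s) (v s) (w s)) S t :=
    fun ha hu hv hw => (((hdR.clm_apply ha).clm_apply hu).clm_apply hv).clm_apply hw
  exact ((((((((((((hddR.clm_apply hY).clm_apply hX).clm_apply hY).clm_apply hY).add
    (hdR4 hDY hX hY hY)).add (hdR4 hX hDY hY hY)).add (hR3 (hR3 hX hY hY) hY hY)).add
    (hR3 hX hD2Y hY)).add
    ((((hdR4 hY hDX hY hY).add (hdR4 hY hX hDY hY)).add (hR3 hD2X hY hY)).const_smul (2 : ℝ))).add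
    ((((hdR4 hY hX hY hDY).add (hR3 hX hY hD2Y)).add (hR3 hX hDY hDY)).const_smul (3 : ℝ))).add
    ((hR3 hDX hY hDY).const_smul (4 : ℝ))).add hgr)

end ChartForce

/-! ### Fields along the curve, and the uniform bound on the force. -/

section Along

variable {E : Type*} [NormedAddCommGroup E] [NormedSpace ℝ E]

/-- The constant is the minimum of the quadratic form on the compact unit sphere. -/
theorem exists_pos_mul_norm_sq_le [FiniteDimensional ℝ E] {B : E →L[ℝ] E →L[ℝ] ℝ}
    (h : ∀ u, u ≠ 0 → 0 < B u u) : ∃ m, 0 < m ∧ ∀ u, m * ‖u‖ ^ 2 ≤ B u u := by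
  have : ProperSpace E := FiniteDimensional.proper ℝ E
  have hc : ContinuousOn (fun u => B u u) (Metric.sphere (0 : E) 1) := by fun_prop
  rcases (Metric.sphere (0 : E) 1).eq_empty_or_nonempty with hS | hS
  -- The sphere is empty only if `E` is zero, and then any constant will do.
  · have h0 : ∀ u : E, u = 0 := by
      intro u
      by_contra hu
      have : (‖u‖⁻¹ • u) ∈ Metric.sphere (0 : E) 1 := by
        rw [mem_sphere_zero_iff_norm, norm_smul, norm_inv, norm_norm,
          inv_mul_cancel₀ (norm_ne_zero_iff.2 hu)]
      rw [hS] at this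
      exact this
    exact ⟨1, one_pos, fun u => by rw [h0 u]; simp⟩
  · obtain ⟨w, hw, hmin⟩ := (isCompact_sphere (0 : E) 1).exists_isMinOn hS hc
    have hw0 : w ≠ 0 := fun h => by simp [h] at hw
    refine ⟨B w w, h w hw0, fun u => ?_⟩
    by_cases hu : u = 0
    · simp [hu]
    have hu' : ‖u‖ ≠ 0 := norm_ne_zero_iff.2 hu
    have hm : (‖u‖⁻¹ • u) ∈ Metric.sphere (0 : E) 1 := by
      rw [mem_sphere_zero_iff_norm, norm_smul, norm_inv, norm_norm, inv_mul_cancel₀ hu']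
    have h1 : B w w ≤ B (‖u‖⁻¹ • u) (‖u‖⁻¹ • u) := hmin hm
    simp only [map_smul, smul_apply, smul_eq_mul] at h1
    calc B w w * ‖u‖ ^ 2 ≤ (‖u‖⁻¹ * (‖u‖⁻¹ * B u u)) * ‖u‖ ^ 2 := by gcongr
      _ = B u u := by field_simp

variable {Q : Type*} [TopologicalSpace Q] [ChartedSpace E Q]

theorem velocityWithin_eq_derivWithin {q : ℝ → Q} {S : Set ℝ} {t : ℝ}
    (hq : MDifferentiableWithinAt 𝓘(ℝ, ℝ) 𝓘(ℝ, E) q S t) :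
    velocityWithin (E := E) q S t =
      derivWithin (fun s => extChartAt 𝓘(ℝ, E) (q t) (q s)) S t := by
  simp only [velocityWithin, mfderivWithin, hq]
  simp [writtenInExtChartAt, derivWithin, Function.comp_def]
  rfl

namespace SmoothCurve

theorem uniqueDiffOn (q : SmoothCurve E Q) : UniqueDiffOn ℝ (Icc 0 q.T) :=
  uniqueDiffOn_Icc q.T_pos

theorem mdifferentiableWithinAt (q : SmoothCurve E Q) {t : ℝ} (ht : t ∈ Icc 0 q.T) :
    MDifferentiableWithinAt 𝓘(ℝ, ℝ) 𝓘(ℝ, E) q.toFun (Icc 0 q.T) t :=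
  (q.contMDiffOn t ht).mdifferentiableWithinAt (by simp)

theorem eventually_mem_source (q : SmoothCurve E Q) {t : ℝ} (ht : t ∈ Icc 0 q.T) {x : Q}
    (hx : q.toFun t ∈ (extChartAt 𝓘(ℝ, E) x).source) :
    ∀ᶠ s in 𝓝[Icc 0 q.T] t, q.toFun s ∈ (extChartAt 𝓘(ℝ, E) x).source :=
  (q.contMDiffOn t ht).continuousWithinAt.eventually
    ((isOpen_extChartAt_source (I := 𝓘(ℝ, E)) x).mem_nhds hx)

end SmoothCurve

variable [IsManifold 𝓘(ℝ, E) ∞ Q]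

/-! ### The metric -/

theorem inner_self_nonneg (g : SmoothMetric E Q) (p : Q) (v : TangentSpace 𝓘(ℝ, E) p) :
    0 ≤ g.inner p v v := by
  by_cases hv : v = 0
  · rw [hv, map_zero]
  · exact (g.pos p v hv).le

/-- Young's inequality: expand $\|u \pm \delta v\|^2 \ge 0$ and divide by $\delta$. The free
parameter is what later allows small terms to be absorbed. -/
theorem abs_two_mul_inner_le (g : SmoothMetric E Q) (p : Q) (u v : TangentSpace 𝓘(ℝ, E) p)
    {δ : ℝ} (hδ : 0 < δ) :
    |2 * g.inner p u v| ≤ δ⁻¹ * g.inner p u u + δ * g.inner p v v := by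
  have h1 := inner_self_nonneg g p (u - δ • v)
  have h2 := inner_self_nonneg g p (u + δ • v)
  simp only [map_sub, map_add, map_smul, sub_apply, add_apply, smul_apply, smul_eq_mul] at h1 h2
  rw [g.symm p v u] at h1 h2
  have e : δ⁻¹ * δ = 1 := inv_mul_cancel₀ hδ.ne'
  have h3 := mul_nonneg (inv_pos.2 hδ).le h1
  have h4 := mul_nonneg (inv_pos.2 hδ).le h2
  rw [abs_le]
  constructor
  · linear_combination h4 + (2 * g.inner p u v + δ * g.inner p v v) * e
  · linear_combination h3 + (-2 * g.inner p u v + δ * g.inner p v v) * e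

theorem chartMetric_pos (g : SmoothMetric E Q) {x : Q} {y : E}
    (hy : y ∈ (extChartAt 𝓘(ℝ, E) x).target) {u : E} (hu : u ≠ 0) : 0 < chartMetric g x y u u := by
  obtain ⟨p, hp, rfl⟩ : ∃ p ∈ (extChartAt 𝓘(ℝ, E) x).source, extChartAt 𝓘(ℝ, E) x p = y :=
    ⟨_, (extChartAt 𝓘(ℝ, E) x).map_target hy, (extChartAt 𝓘(ℝ, E) x).right_inv hy⟩
  rw [chartMetric_apply g x p hp]
  refine g.pos p _ fun h0 => hu ?_
  have h3 := tangentCoordChange_comp (I := 𝓘(ℝ, E)) (w := x) (x := p) (y := x) (z := p) (v := u)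
    ⟨⟨hp, mem_extChartAt_source _⟩, hp⟩
  rw [tangentCoordChange_self hp] at h3
  rw [← h3]
  exact (congrArg (tangentCoordChange 𝓘(ℝ, E) p x p) h0).trans (map_zero _)

/-! ### The velocity -/

/-- The chain rule for the change of chart. The velocity at `t` is defined through the chart at `q
t`; reading it in a fixed chart is what shows that it is a smooth field. -/
theorem coordAlong_velocityWithin {q : ℝ → Q} {S : Set ℝ} {t : ℝ} (htS : t ∈ S)
    (hS : UniqueDiffWithinAt ℝ S t) (hq : MDifferentiableWithinAt 𝓘(ℝ, ℝ) 𝓘(ℝ, E) q S t) {x : Q}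
    (hx : q t ∈ (extChartAt 𝓘(ℝ, E) x).source) :
    coordAlong q (velocityWithin q S) x t =
      derivWithin (fun s => extChartAt 𝓘(ℝ, E) x (q s)) S t := by
  have hpp : q t ∈ (extChartAt 𝓘(ℝ, E) (q t)).source := mem_extChartAt_source _
  have hz := mem_overlap hpp hx
  have hτ := ((contDiffOn_transition (q t) x).contDiffAt
    ((isOpen_overlap (E := E) (q t) x).mem_nhds hz)).differentiableAt (n := ∞) (by simp)
  have hcd : DifferentiableWithinAt ℝ (fun s => extChartAt 𝓘(ℝ, E) (q t) (q s)) S t :=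
    ((mdifferentiableAt_extChartAt (by simp)).comp_mdifferentiableWithinAt t
      hq).differentiableWithinAt
  have hev : (fun s => extChartAt 𝓘(ℝ, E) x (q s)) =ᶠ[𝓝[S] t]
      fun s => transition E (q t) x (extChartAt 𝓘(ℝ, E) (q t) (q s)) := by
    filter_upwards [hq.continuousWithinAt.eventually
      (extChartAt_source_mem_nhds (I := 𝓘(ℝ, E)) (q t))] with s hs
    exact (transition_apply hs).symm
  have hd := (HasFDerivAt.comp_hasDerivWithinAt t hτ.hasFDerivAt
    hcd.hasDerivWithinAt).derivWithin hS
  rw [hev.derivWithin_eq (hev.self_of_nhdsWithin htS)]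
  refine Eq.trans ?_ hd.symm
  rw [fderiv_transition hz, (extChartAt 𝓘(ℝ, E) (q t)).left_inv hpp, coordAlong,
    velocityWithin_eq_derivWithin hq]

namespace SmoothCurve

theorem contDiffWithinAt_chart (q : SmoothCurve E Q) {t : ℝ} (ht : t ∈ Icc 0 q.T) {x : Q}
    (hx : q.toFun t ∈ (extChartAt 𝓘(ℝ, E) x).source) :
    ContDiffWithinAt ℝ ∞ (fun s => extChartAt 𝓘(ℝ, E) x (q.toFun s)) (Icc 0 q.T) t := by
  have h1 : ContMDiffAt 𝓘(ℝ, E) 𝓘(ℝ, E) ∞ (extChartAt 𝓘(ℝ, E) x) (q.toFun t) :=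
    contMDiffAt_extChartAt' (by simpa using hx)
  exact contMDiffWithinAt_iff_contDiffWithinAt.1
    (h1.comp_contMDiffWithinAt t (q.contMDiffOn t ht))

theorem contDiffAlong_velocity (q : SmoothCurve E Q) :
    ContDiffAlong ∞ q.toFun q.velocity (Icc 0 q.T) := by
  rw [contDiffAlong_iff le_rfl q.contMDiffOn]
  intro t ht x hx
  have hev : coordAlong q.toFun q.velocity x =ᶠ[𝓝[Icc 0 q.T] t]
      derivWithin (fun s => extChartAt 𝓘(ℝ, E) x (q.toFun s)) (Icc 0 q.T) := by
    filter_upwards [q.eventually_mem_source ht hx, self_mem_nhdsWithin] with s hs hsS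
    exact coordAlong_velocityWithin hsS (q.uniqueDiffOn s hsS) (q.mdifferentiableWithinAt hsS) hs
  exact ((q.contDiffWithinAt_chart ht hx).derivWithin q.uniqueDiffOn (m := ∞) (by simp)
    ht).congr_of_eventuallyEq hev (hev.self_of_nhdsWithin ht)

theorem continuousWithinAt_coordAlong (q : SmoothCurve E Q) {k : WithTop ℕ∞} (hk : k ≤ ∞)
    {X : ∀ t, TangentSpace 𝓘(ℝ, E) (q.toFun t)} {S : Set ℝ} (hS : S ⊆ Icc 0 q.T)
    (hX : ContDiffAlong k q.toFun X S) {t : ℝ} (ht : t ∈ S) {x : Q}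
    (hx : q.toFun t ∈ (extChartAt 𝓘(ℝ, E) x).source) :
    ContinuousWithinAt (coordAlong q.toFun X x) S t :=
  ((contDiffAlong_iff hk ((q.contMDiffOn.mono hS).of_le hk)).1 hX t ht x hx).continuousWithinAt

variable [FiniteDimensional ℝ E]

theorem contDiffAlong_D (g : SmoothMetric E Q) (q : SmoothCurve E Q)
    {X : ∀ t, TangentSpace 𝓘(ℝ, E) (q.toFun t)} (hX : ContDiffAlong ∞ q.toFun X (Icc 0 q.T)) :
    ContDiffAlong ∞ q.toFun (q.D g X) (Icc 0 q.T) :=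
  contDiffAlong_covDeriv g (n := ⊤) q.uniqueDiffOn q.contMDiffOn hX

/-! ### The force along the curve -/

/-- The vector `F(X, q') + ∇_X grad V` at time `t`, as a function of `X`, `DX/dt` and `D²X/dt²`. -/
def force (g : SmoothMetric E Q) (V : Q → ℝ) (q : SmoothCurve E Q) (t : ℝ)
    (X DX D2X : TangentSpace 𝓘(ℝ, E) (q.toFun t)) : TangentSpace 𝓘(ℝ, E) (q.toFun t) :=
  jacobiTerm g (q.toFun t) X DX D2X (q.velocity t) (q.D g q.velocity t)
    (q.D g (q.D g q.velocity) t) + nablaGrad g V (q.toFun t) X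

/-- The force in the preferred chart at `x`. -/
def coordForce (g : SmoothMetric E Q) (V : Q → ℝ) (q : SmoothCurve E Q) (x : Q) (t : ℝ)
    (X DX D2X : E) : E :=
  chartForce g V x (extChartAt 𝓘(ℝ, E) x (q.toFun t)) (coordAlong q.toFun q.velocity x t)
    (coordAlong q.toFun (q.D g q.velocity) x t)
    (coordAlong q.toFun (q.D g (q.D g q.velocity)) x t) X DX D2X

/-- Replaces the chart at `q t`, which varies with `t`, by a fixed one, in which the coefficients of
the force depend continuously on `t`. -/
theorem coord_force (g : SmoothMetric E Q) {V : Q → ℝ} (hV : ContMDiff 𝓘(ℝ, E) 𝓘(ℝ, ℝ) ∞ V)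
    (q : SmoothCurve E Q) (t : ℝ) {x : Q} (hx : q.toFun t ∈ (extChartAt 𝓘(ℝ, E) x).source)
    (X DX D2X : TangentSpace 𝓘(ℝ, E) (q.toFun t)) :
    tangentCoordChange 𝓘(ℝ, E) (q.toFun t) x (q.toFun t) (q.force g V t X DX D2X) =
      q.coordForce g V x t (tangentCoordChange 𝓘(ℝ, E) (q.toFun t) x (q.toFun t) X)
        (tangentCoordChange 𝓘(ℝ, E) (q.toFun t) x (q.toFun t) DX)
        (tangentCoordChange 𝓘(ℝ, E) (q.toFun t) x (q.toFun t) D2X) := by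
  have hpp : q.toFun t ∈ (extChartAt 𝓘(ℝ, E) (q.toFun t)).source := mem_extChartAt_source _
  have hz := mem_overlap hpp hx
  have h := chartForce_transition g hV hz (q.velocity t) (q.D g q.velocity t)
    (q.D g (q.D g q.velocity) t) X DX D2X
  rw [← jacobiTerm_add_nablaGrad, transition_apply hpp, fderiv_transition hz,
    (extChartAt 𝓘(ℝ, E) (q.toFun t)).left_inv hpp] at h
  exact h

theorem isLinearMap_coordForce (g : SmoothMetric E Q) (V : Q → ℝ) (q : SmoothCurve E Q) (x : Q)
    (t : ℝ) : IsLinearMap ℝ fun u : E × E × E => q.coordForce g V x t u.1 u.2.1 u.2.2 :=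
  isLinearMap_chartForce g V x _ _ _ _

theorem isLinearMap_force (g : SmoothMetric E Q) (V : Q → ℝ) (q : SmoothCurve E Q) (t : ℝ) :
    IsLinearMap ℝ fun u : TangentSpace 𝓘(ℝ, E) (q.toFun t) × TangentSpace 𝓘(ℝ, E) (q.toFun t) ×
      TangentSpace 𝓘(ℝ, E) (q.toFun t) => q.force g V t u.1 u.2.1 u.2.2 := by
  simp only [force, jacobiTerm_add_nablaGrad]
  exact isLinearMap_chartForce g V (q.toFun t) _ _ _ _

theorem continuousWithinAt_coordForce (g : SmoothMetric E Q) {V : Q → ℝ}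
    (hV : ContMDiff 𝓘(ℝ, E) 𝓘(ℝ, ℝ) ∞ V) (q : SmoothCurve E Q) {S : Set ℝ} (hS : S ⊆ Icc 0 q.T)
    {X DX D2X : ℝ → E} {t : ℝ} (ht : t ∈ S) {x : Q}
    (hx : q.toFun t ∈ (extChartAt 𝓘(ℝ, E) x).source) (hX : ContinuousWithinAt X S t)
    (hDX : ContinuousWithinAt DX S t) (hD2X : ContinuousWithinAt D2X S t) :
    ContinuousWithinAt (fun s => q.coordForce g V x s (X s) (DX s) (D2X s)) S t := by
  have hv := q.contDiffAlong_velocity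
  have hDv := q.contDiffAlong_D g hv
  have hDDv := q.contDiffAlong_D g hDv
  exact continuousWithinAt_chartForce g hV x
    ((q.contDiffWithinAt_chart (hS ht) hx).continuousWithinAt.mono hS)
    ((extChartAt 𝓘(ℝ, E) x).map_source hx)
    ((q.continuousWithinAt_coordAlong le_rfl subset_rfl hv (hS ht) hx).mono hS)
    ((q.continuousWithinAt_coordAlong le_rfl subset_rfl hDv (hS ht) hx).mono hS)
    ((q.continuousWithinAt_coordAlong le_rfl subset_rfl hDDv (hS ht) hx).mono hS) hX hDX hD2X

theorem contDiffAlong_force (g : SmoothMetric E Q) {V : Q → ℝ}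
    (hV : ContMDiff 𝓘(ℝ, E) 𝓘(ℝ, ℝ) ∞ V) (q : SmoothCurve E Q) {S : Set ℝ} (hS : S ⊆ Icc 0 q.T)
    {X Z W : ∀ t, TangentSpace 𝓘(ℝ, E) (q.toFun t)} (hX : ContDiffAlong 0 q.toFun X S)
    (hZ : ContDiffAlong 0 q.toFun Z S) (hW : ContDiffAlong 0 q.toFun W S) :
    ContDiffAlong 0 q.toFun (fun t => q.force g V t (X t) (Z t) (W t)) S := by
  have h0 : (0 : WithTop ℕ∞) ≤ ∞ := by simp
  rw [contDiffAlong_iff h0 ((q.contMDiffOn.mono hS).of_le h0)]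
  have hcont : ∀ t ∈ S, ∀ x : Q, q.toFun t ∈ (extChartAt 𝓘(ℝ, E) x).source →
      ContinuousWithinAt (coordAlong q.toFun (fun t => q.force g V t (X t) (Z t) (W t)) x) S t := by
    intro t ht x hx
    have hc := q.continuousWithinAt_coordForce g hV hS ht hx
      (q.continuousWithinAt_coordAlong h0 hS hX ht hx)
      (q.continuousWithinAt_coordAlong h0 hS hZ ht hx)
      (q.continuousWithinAt_coordAlong h0 hS hW ht hx)
    refine hc.congr_of_eventuallyEq ?_ (q.coord_force g hV t hx _ _ _)
    filter_upwards [nhdsWithin_mono t hS (q.eventually_mem_source (hS ht) hx)] with s hs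
    exact q.coord_force g hV s hs _ _ _
  intro t ht x hx
  -- Regularity of order `0` at a point asks for continuity on a neighbourhood in `S`, and for this
  -- reason `hcont` covers all points whose image lies in the domain of the chart.
  rw [contDiffWithinAt_zero ht]
  refine ⟨{s | q.toFun s ∈ (extChartAt 𝓘(ℝ, E) x).source},
    nhdsWithin_mono t hS (q.eventually_mem_source (hS ht) hx), fun s hs => ?_⟩
  exact (hcont s hs.1 x hs.2).mono inter_subset_left

/-- Near a time `t₀`, in the chart at `q t₀`, the force is a linear map depending continuously on
time, and the metric is uniformly equivalent to the norm of `E`. This gives a local constant, and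
compactness of `[0, T]` makes it global. -/
theorem exists_inner_force_le (g : SmoothMetric E Q) {V : Q → ℝ}
    (hV : ContMDiff 𝓘(ℝ, E) 𝓘(ℝ, ℝ) ∞ V) (q : SmoothCurve E Q) :
    ∃ C, 0 ≤ C ∧ ∀ t ∈ Icc 0 q.T, ∀ X DX D2X : TangentSpace 𝓘(ℝ, E) (q.toFun t),
      g.inner (q.toFun t) (q.force g V t X DX D2X) (q.force g V t X DX D2X) ≤
        C * (g.inner (q.toFun t) X X + g.inner (q.toFun t) DX DX + g.inner (q.toFun t) D2X D2X) := by
  have hsum : ∀ t, ∀ X DX D2X : TangentSpace 𝓘(ℝ, E) (q.toFun t), 0 ≤ g.inner (q.toFun t) X X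
      + g.inner (q.toFun t) DX DX + g.inner (q.toFun t) D2X D2X := fun t X DX D2X =>
    add_nonneg (add_nonneg (inner_self_nonneg g _ _) (inner_self_nonneg g _ _))
      (inner_self_nonneg g _ _)
  -- Having a constant on `S` is inherited by subsets and by unions of two sets (add the constants),
  -- so it is enough to have it near each time.
  refine isCompact_Icc.induction_on (p := fun S => ∃ C, 0 ≤ C ∧ ∀ t ∈ S,
    ∀ X DX D2X : TangentSpace 𝓘(ℝ, E) (q.toFun t),
      g.inner (q.toFun t) (q.force g V t X DX D2X) (q.force g V t X DX D2X) ≤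
        C * (g.inner (q.toFun t) X X + g.inner (q.toFun t) DX DX + g.inner (q.toFun t) D2X D2X))
    ⟨0, le_rfl, fun t ht => ht.elim⟩ ?_ ?_ ?_
  · rintro S S' hSS' ⟨C, hC, h⟩
    exact ⟨C, hC, fun t ht => h t (hSS' ht)⟩
  · rintro S S' ⟨C, hC, h⟩ ⟨C', hC', h'⟩
    refine ⟨C + C', add_nonneg hC hC', fun t ht X DX D2X => ?_⟩
    rw [add_mul]
    rcases ht with ht | ht
    · exact (h t ht X DX D2X).trans (le_add_of_nonneg_right (mul_nonneg hC' (hsum t X DX D2X)))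
    · exact (h' t ht X DX D2X).trans (le_add_of_nonneg_left (mul_nonneg hC (hsum t X DX D2X)))
  intro t₀ ht₀
  have hx : q.toFun t₀ ∈ (extChartAt 𝓘(ℝ, E) (q.toFun t₀)).source := mem_extChartAt_source _
  set x := q.toFun t₀ with hxdef
  let G : ℝ → E →L[ℝ] E →L[ℝ] ℝ := fun s => chartMetric g x (extChartAt 𝓘(ℝ, E) x (q.toFun s))
  let J : ℝ → (E × E × E) →L[ℝ] E := fun s =>
    LinearMap.toContinuousLinearMap (IsLinearMap.mk' _ (q.isLinearMap_coordForce g V x s))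
  have hG : ContinuousWithinAt G (Icc 0 q.T) t₀ :=
    ContinuousAt.comp_continuousWithinAt (f := fun s => extChartAt 𝓘(ℝ, E) x (q.toFun s))
      ((contDiffOn_chartMetric g x).continuousOn.continuousAt
        ((isOpen_extChartAt_target x).mem_nhds ((extChartAt 𝓘(ℝ, E) x).map_source hx)))
      (q.contDiffWithinAt_chart ht₀ hx).continuousWithinAt
  have hJ : ContinuousWithinAt J (Icc 0 q.T) t₀ := by
    rw [continuousWithinAt_clm_apply]
    intro u
    exact q.continuousWithinAt_coordForce g hV subset_rfl ht₀ hx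
      (continuousWithinAt_const (b := u.1)) (continuousWithinAt_const (b := u.2.1))
      (continuousWithinAt_const (b := u.2.2))
  obtain ⟨m, hm, hmB⟩ := exists_pos_mul_norm_sq_le (B := G t₀) fun u hu =>
    chartMetric_pos g ((extChartAt 𝓘(ℝ, E) x).map_source hx) hu
  -- On this neighbourhood `G` moves by less than `m / 2`, which keeps the lower bound `m / 2` for
  -- the metric, and `J` moves by less than `1`. The three factors of the constant bound the metric
  -- from above, the square of the norm of `J`, and the squared norm by the metric.
  refine ⟨_, inter_mem (inter_mem (q.eventually_mem_source ht₀ hx)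
    (hG.eventually (Metric.ball_mem_nhds _ (half_pos hm))))
    (hJ.eventually (Metric.ball_mem_nhds _ one_pos)),
    (‖G t₀‖ + m / 2) * (‖J t₀‖ + 1) ^ 2 * (2 / m), by positivity, ?_⟩
  rintro s ⟨⟨hs, hGs⟩, hJs⟩ X DX D2X
  have hs' : q.toFun s ∈ (extChartAt 𝓘(ℝ, E) x).source := hs
  have hGs' : ‖G s - G t₀‖ < m / 2 := by simpa [dist_eq_norm] using hGs
  have hJs' : ‖J s - J t₀‖ < 1 := by simpa [dist_eq_norm] using hJs
  have hG1 : ‖G s‖ ≤ ‖G t₀‖ + m / 2 := by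
    have := norm_add_le (G t₀) (G s - G t₀)
    rw [add_sub_cancel] at this
    linarith
  have hJ1 : ‖J s‖ ≤ ‖J t₀‖ + 1 := by
    have := norm_add_le (J t₀) (J s - J t₀)
    rw [add_sub_cancel] at this
    linarith
  have hlow : ∀ u : E, ‖u‖ ^ 2 ≤ (2 / m) * G s u u := by
    intro u
    have h1 : |(G s - G t₀) u u| ≤ m / 2 * ‖u‖ ^ 2 := by
      calc |(G s - G t₀) u u| ≤ ‖G s - G t₀‖ * ‖u‖ * ‖u‖ := (G s - G t₀).le_opNorm₂ u u
        _ ≤ m / 2 * ‖u‖ * ‖u‖ := by gcongr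
        _ = m / 2 * ‖u‖ ^ 2 := by ring
    have h2 := hmB u
    have h3 := (abs_le.1 h1).1
    simp only [sub_apply] at h3
    have h4 : m / 2 * ‖u‖ ^ 2 ≤ G s u u := by linarith
    calc ‖u‖ ^ 2 = (2 / m) * (m / 2 * ‖u‖ ^ 2) := by field_simp
      _ ≤ _ := by gcongr
  have main : ∀ a b c : E, G s (q.coordForce g V x s a b c) (q.coordForce g V x s a b c) ≤
      (‖G t₀‖ + m / 2) * (‖J t₀‖ + 1) ^ 2 * (2 / m) * (G s a a + G s b b + G s c c) := by
    intro a b c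
    have h1 : ‖q.coordForce g V x s a b c‖ ≤ (‖J t₀‖ + 1) * ‖(a, b, c)‖ :=
      ((J s).le_opNorm (a, b, c)).trans (by gcongr)
    have h2 : ‖(a, b, c)‖ ^ 2 ≤ ‖a‖ ^ 2 + ‖b‖ ^ 2 + ‖c‖ ^ 2 := by
      have e : ‖(a, b, c)‖ = max ‖a‖ (max ‖b‖ ‖c‖) := rfl
      rw [e]
      rcases max_choice ‖a‖ (max ‖b‖ ‖c‖) with h | h <;> rw [h]
      · nlinarith [sq_nonneg ‖b‖, sq_nonneg ‖c‖]
      · rcases max_choice ‖b‖ ‖c‖ with h | h <;> rw [h] <;>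
          nlinarith [sq_nonneg ‖a‖, sq_nonneg ‖b‖, sq_nonneg ‖c‖]
    calc G s (q.coordForce g V x s a b c) (q.coordForce g V x s a b c)
        ≤ ‖G s‖ * ‖q.coordForce g V x s a b c‖ * ‖q.coordForce g V x s a b c‖ :=
          (Real.le_norm_self _).trans ((G s).le_opNorm₂ _ _)
      _ ≤ (‖G t₀‖ + m / 2) * ((‖J t₀‖ + 1) * ‖(a, b, c)‖) * ((‖J t₀‖ + 1) * ‖(a, b, c)‖) := by
          gcongr
      _ = (‖G t₀‖ + m / 2) * (‖J t₀‖ + 1) ^ 2 * ‖(a, b, c)‖ ^ 2 := by ring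
      _ ≤ (‖G t₀‖ + m / 2) * (‖J t₀‖ + 1) ^ 2 *
          ((2 / m) * G s a a + (2 / m) * G s b b + (2 / m) * G s c c) := by
          refine mul_le_mul_of_nonneg_left (h2.trans ?_) (by positivity)
          exact add_le_add (add_le_add (hlow a) (hlow b)) (hlow c)
      _ = _ := by ring
  have h := main (tangentCoordChange 𝓘(ℝ, E) (q.toFun s) x (q.toFun s) X)
    (tangentCoordChange 𝓘(ℝ, E) (q.toFun s) x (q.toFun s) DX)
    (tangentCoordChange 𝓘(ℝ, E) (q.toFun s) x (q.toFun s) D2X)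
  rw [← q.coord_force g hV s hs'] at h
  simp only [inner_eq_chartMetric g hs']
  exact h

end SmoothCurve

end Along

/-! ### A Poincaré inequality with point values, on small intervals. -/

section Estimates

/-- To be read with $f = \|Z\|^2$, $k = 2\langle Z, DZ\rangle$, $f_1 = \|DZ\|^2$. Bounding $f(t)$ by
$f(a)$ plus the integral of $k$ and integrating once more leaves a multiple of $\int f$ on the
right. The choice $\delta = 2(b-a)$ makes it exactly one half, which is moved to the left. -/
theorem integral_le_of_sub_eq_integral {f k f₁ : ℝ → ℝ} {a b : ℝ} (hab : a ≤ b)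
    (hf : IntervalIntegrable f volume a b) (hk : IntervalIntegrable k volume a b)
    (hf₁ : IntervalIntegrable f₁ volume a b) (hf0 : ∀ t, 0 ≤ f t) (hf₁0 : ∀ t, 0 ≤ f₁ t)
    (hsub : ∀ t ∈ Icc a b, f t - f a = ∫ s in a..t, k s)
    (hle : ∀ s, ∀ δ > 0, k s ≤ δ⁻¹ * f s + δ * f₁ s) :
    ∫ t in a..b, f t ≤ 2 * (b - a) * f a + 4 * (b - a) ^ 2 * ∫ t in a..b, f₁ t := by
  rcases hab.eq_or_lt with rfl | hlt
  · simp
  have hh : 0 < b - a := sub_pos.2 hlt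
  set m := ∫ t in a..b, f t
  set m₁ := ∫ t in a..b, f₁ t
  set δ := 2 * (b - a) with hδ
  have hδ0 : 0 < δ := by positivity
  have hint : IntervalIntegrable (fun s => δ⁻¹ * f s + δ * f₁ s) volume a b :=
    (hf.const_mul _).add (hf₁.const_mul _)
  have hR : ∫ s in a..b, (δ⁻¹ * f s + δ * f₁ s) = δ⁻¹ * m + δ * m₁ := by
    rw [intervalIntegral.integral_add (hf.const_mul _) (hf₁.const_mul _),
      intervalIntegral.integral_const_mul, intervalIntegral.integral_const_mul]
  have hpt : ∀ t ∈ Icc a b, f t ≤ f a + (δ⁻¹ * m + δ * m₁) := by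
    intro t ht
    have hsubset : uIcc a t ⊆ uIcc a b := by
      rw [uIcc_of_le ht.1, uIcc_of_le hab]; exact Icc_subset_Icc_right ht.2
    have h1 : ∫ s in a..t, k s ≤ ∫ s in a..t, (δ⁻¹ * f s + δ * f₁ s) :=
      intervalIntegral.integral_mono_on ht.1 (hk.mono_set hsubset) (hint.mono_set hsubset)
        fun s _ => hle s δ hδ0
    have h2 : ∫ s in a..t, (δ⁻¹ * f s + δ * f₁ s) ≤ ∫ s in a..b, (δ⁻¹ * f s + δ * f₁ s) := by
      refine intervalIntegral.integral_mono_interval le_rfl ht.1 ht.2 ?_ hint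
      exact Eventually.of_forall fun s =>
        add_nonneg (mul_nonneg (inv_pos.2 hδ0).le (hf0 s)) (mul_nonneg hδ0.le (hf₁0 s))
    have h3 := hsub t ht
    linarith
  have h4 : m ≤ ∫ _ in a..b, (f a + (δ⁻¹ * m + δ * m₁)) :=
    intervalIntegral.integral_mono_on hab hf intervalIntegrable_const hpt
  rw [intervalIntegral.integral_const, smul_eq_mul] at h4
  have h5 : (b - a) * (δ⁻¹ * m) = m / 2 := by rw [hδ]; field_simp
  have h6 : (b - a) * (f a + (δ⁻¹ * m + δ * m₁)) =
      (b - a) * f a + m / 2 + 2 * (b - a) ^ 2 * m₁ := by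
    rw [mul_add, mul_add, h5, hδ]; ring
  linarith

/-- The previous estimate summed over `N` equal intervals. The nodes are the left end points, so `T`
itself is not among them. -/
theorem integral_le_sum_of_sub_eq_integral {f k f₁ : ℝ → ℝ} {T : ℝ} (hT : 0 ≤ T) {N : ℕ}
    (hN : 0 < N) (hf : IntervalIntegrable f volume 0 T) (hk : IntervalIntegrable k volume 0 T)
    (hf₁ : IntervalIntegrable f₁ volume 0 T) (hf0 : ∀ t, 0 ≤ f t) (hf₁0 : ∀ t, 0 ≤ f₁ t)
    (hsub : ∀ a b, 0 ≤ a → a ≤ b → b ≤ T → f b - f a = ∫ s in a..b, k s)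
    (hle : ∀ s, ∀ δ > 0, k s ≤ δ⁻¹ * f s + δ * f₁ s) :
    ∫ t in 0..T, f t ≤ 2 * (T / N) * ∑ i : Fin N, f (i * (T / N))
      + 4 * (T / N) ^ 2 * ∫ t in 0..T, f₁ t := by
  set h := T / N with hh
  have hN' : (0 : ℝ) < N := by exact_mod_cast hN
  have hh0 : 0 ≤ h := div_nonneg hT hN'.le
  have hNh : (N : ℝ) * h = T := by rw [hh]; field_simp
  have hmono : ∀ i : ℕ, (i : ℝ) * h ≤ ((i + 1 : ℕ) : ℝ) * h := fun i => by
    push_cast; nlinarith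
  have hi0 : ∀ i : ℕ, 0 ≤ (i : ℝ) * h := fun i => by positivity
  have hiT : ∀ i < N, ((i + 1 : ℕ) : ℝ) * h ≤ T := fun i hi => by
    rw [← hNh]; gcongr; exact_mod_cast hi
  have hset : ∀ i < N, uIcc ((i : ℝ) * h) (((i + 1 : ℕ) : ℝ) * h) ⊆ uIcc 0 T := fun i hi => by
    rw [uIcc_of_le (hmono i), uIcc_of_le hT]
    exact Icc_subset_Icc (hi0 i) (hiT i hi)
  have hs : ∀ {u : ℝ → ℝ}, IntervalIntegrable u volume 0 T →
      ∑ i ∈ Finset.range N, ∫ t in ((i : ℝ) * h)..(((i + 1 : ℕ) : ℝ) * h), u t =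
        ∫ t in 0..T, u t := by
    intro u hu
    have := intervalIntegral.sum_integral_adjacent_intervals (f := u) (μ := volume)
      (a := fun i : ℕ => (i : ℝ) * h) (n := N) fun i hi => hu.mono_set (hset i hi)
    rw [this]
    simp only [Nat.cast_zero, zero_mul, hNh]
  rw [← hs hf, ← hs hf₁, Fin.sum_univ_eq_sum_range (fun i => f ((i : ℝ) * h)) N, Finset.mul_sum,
    Finset.mul_sum, ← Finset.sum_add_distrib]
  refine Finset.sum_le_sum fun i hi => ?_
  have hi' := Finset.mem_range.1 hi
  have key := integral_le_of_sub_eq_integral (hmono i) (hf.mono_set (hset i hi'))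
    (hk.mono_set (hset i hi')) (hf₁.mono_set (hset i hi')) hf0 hf₁0
    (fun t ht => hsub _ t (hi0 i) ht.1 (ht.2.trans (hiT i hi'))) hle
  have e : ((i + 1 : ℕ) : ℝ) * h - (i : ℝ) * h = h := by push_cast; ring
  rwa [e] at key

end Estimates

/-! ### Metric compatibility and the fundamental theorem of calculus for variational fields. -/

section Fields

variable {E : Type*} [NormedAddCommGroup E] [NormedSpace ℝ E]

/-- The product rule gives the derivative of `G` along `c'` plus twice the product of `ζ` with `ζ'`.
In `christoffel_eq` with both last arguments equal to `ζ t`, two of the three derivatives cancel,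
and the remaining one is that derivative of `G`. -/
theorem hasDerivAt_apply_self {G : E → E →L[ℝ] E →L[ℝ] ℝ} {c ζ : ℝ → E} {c' ζ' : E} {t : ℝ}
    (hG : DifferentiableAt ℝ G (c t)) (hi : (G (c t)).IsInvertible)
    (hs : ∀ y u v, G y u v = G y v u) (hc : HasDerivAt c c' t) (hζ : HasDerivAt ζ ζ' t) :
    HasDerivAt (fun s => G (c s) (ζ s) (ζ s))
      (2 * G (c t) (ζ t) (ζ' + christoffel G (c t) c' (ζ t))) t := by
  refine (((hG.hasFDerivAt.comp_hasDerivAt t hc).clm_apply hζ).clm_apply hζ).congr_deriv ?_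
  have hchr := christoffel_eq hi hG c' (ζ t) (ζ t)
  have hconst : fderiv ℝ (fun z => G z (ζ t) (ζ t)) (c t) c' = fderiv ℝ G (c t) c' (ζ t) (ζ t) := by
    rw [((hG.hasFDerivAt.clm_apply (hasFDerivAt_const (ζ t) _)).clm_apply
      (hasFDerivAt_const (ζ t) _)).fderiv]
    simp
  rw [map_add, hs _ (ζ t) (christoffel G (c t) c' (ζ t)), hchr, hconst]
  simp only [add_apply, Function.comp_apply]
  rw [hs _ ζ' (ζ t)]
  ring

variable [FiniteDimensional ℝ E]
  {Q : Type*} [TopologicalSpace Q] [ChartedSpace E Q] [IsManifold 𝓘(ℝ, E) ∞ Q]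

namespace SmoothCurve

/-- The Levi-Civita connection is metric. -/
theorem hasDerivAt_inner_self (g : SmoothMetric E Q) (q : SmoothCurve E Q)
    {Z : ∀ t, TangentSpace 𝓘(ℝ, E) (q.toFun t)} {t : ℝ} (ht : t ∈ Ioo 0 q.T)
    (hZ : DifferentiableWithinAt ℝ (coordAlong q.toFun Z (q.toFun t)) (Icc 0 q.T) t) :
    HasDerivAt (fun s => g.inner (q.toFun s) (Z s) (Z s))
      (2 * g.inner (q.toFun t) (Z t) (q.D g Z t)) t := by
  have hI : Icc 0 q.T ∈ 𝓝 t := Icc_mem_nhds ht.1 ht.2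
  have ht' : t ∈ Icc 0 q.T := Ioo_subset_Icc_self ht
  have hx : q.toFun t ∈ (extChartAt 𝓘(ℝ, E) (q.toFun t)).source := mem_extChartAt_source _
  have hy := mem_extChartAt_target (I := 𝓘(ℝ, E)) (q.toFun t)
  have hc := ((q.contDiffWithinAt_chart ht' hx).differentiableWithinAt
    (by simp)).hasDerivWithinAt.hasDerivAt hI
  have hd := hasDerivAt_apply_self (differentiableAt_chartMetric g hy)
    (chartMetric_isInvertible g _ _ hy) (chartMetric_symm g (q.toFun t)) hc
    (hZ.hasDerivWithinAt.hasDerivAt hI)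
  rw [← covDeriv_core g ht' (q.uniqueDiffOn t ht') (q.mdifferentiableWithinAt ht') _ hx hZ] at hd
  refine (hd.congr_of_eventuallyEq ?_).congr_deriv
    (congrArg (2 * ·) (inner_eq_chartMetric g hx (Z t) (q.D g Z t)).symm)
  have hns := q.eventually_mem_source ht' hx
  rw [nhdsWithin_eq_nhds.2 hI] at hns
  filter_upwards [hns] with s hs using inner_eq_chartMetric g hs _ _

/-- A vector field along `q` that is continuous on each of the closed intervals cut out by finitely
many points, up to its values at these points. -/
def PiecewiseContinuous (q : SmoothCurve E Q) (A : ∀ t, TangentSpace 𝓘(ℝ, E) (q.toFun t)) : Prop :=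
  ∃ P : Finset ℝ, ∀ a b, 0 ≤ a → a < b → b ≤ q.T → Disjoint (Ioo a b) (P : Set ℝ) →
    ∃ Z : ∀ t, TangentSpace 𝓘(ℝ, E) (q.toFun t), ContDiffAlong 0 q.toFun Z (Icc a b) ∧
      ∀ t ∈ Ioo a b, A t = Z t

theorem PiecewiseContinuous.intervalIntegrable_inner {q : SmoothCurve E Q}
    {A B : ∀ t, TangentSpace 𝓘(ℝ, E) (q.toFun t)} (hA : q.PiecewiseContinuous A)
    (hB : q.PiecewiseContinuous B) (g : SmoothMetric E Q) :
    IntervalIntegrable (fun t => g.inner (q.toFun t) (A t) (B t)) volume 0 q.T := by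
  rw [intervalIntegrable_iff_integrableOn_Icc_of_le q.T_pos.le]
  obtain ⟨P, hP⟩ := hA
  obtain ⟨R, hR⟩ := hB
  refine integrableOn_of_piecewise (P ∪ R) fun a b ha hab hb hd => ?_
  rw [Finset.coe_union, Set.disjoint_union_right] at hd
  obtain ⟨Z, hZ, hZA⟩ := hP a b ha hab hb hd.1
  obtain ⟨W, hW, hWB⟩ := hR a b ha hab hb hd.2
  refine ⟨fun t => g.inner (q.toFun t) (Z t) (W t), continuousOn_inner g hZ hW
    ((q.contMDiffOn.mono (Icc_subset_Icc ha hb)).of_le (by simp)), fun t ht => ?_⟩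
  simp only [hZA t ht, hWB t ht]

namespace IsVariationalField

variable {g : SmoothMetric E Q} {q : SmoothCurve E Q} {X : ∀ t, TangentSpace 𝓘(ℝ, E) (q.toFun t)}

theorem exists_pieces (hX : IsVariationalField g q X) :
    ∃ P : Finset ℝ, ∀ a b, 0 ≤ a → a < b → b ≤ q.T → Disjoint (Ioo a b) (P : Set ℝ) →
      ∃ Z W : ∀ t, TangentSpace 𝓘(ℝ, E) (q.toFun t), ContDiffAlong 0 q.toFun X (Icc a b) ∧
        ContDiffAlong 0 q.toFun Z (Icc a b) ∧ ContDiffAlong 0 q.toFun W (Icc a b) ∧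
        ∀ t ∈ Ioo a b, q.D g X t = Z t ∧ q.D g (q.D g X) t = W t := by
  obtain ⟨P, hP⟩ := hX.piecewise_smooth
  refine ⟨P, fun a b ha hab hb hd => ?_⟩
  obtain ⟨Z, W, hZ, hW, hZW⟩ := piece g q X ha hab hb (hP a b ha hab hb hd)
  exact ⟨Z, W, (hP a b ha hab hb hd).of_le (by simp), hZ.of_le (by simp), hW.of_le (by simp), hZW⟩

theorem piecewiseContinuous (hX : IsVariationalField g q X) : q.PiecewiseContinuous X := by
  obtain ⟨P, hP⟩ := hX.exists_pieces
  refine ⟨P, fun a b ha hab hb hd => ?_⟩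
  obtain ⟨Z, W, h, -⟩ := hP a b ha hab hb hd
  exact ⟨X, h, fun _ _ => rfl⟩

theorem piecewiseContinuous_D (hX : IsVariationalField g q X) :
    q.PiecewiseContinuous (q.D g X) := by
  obtain ⟨P, hP⟩ := hX.exists_pieces
  refine ⟨P, fun a b ha hab hb hd => ?_⟩
  obtain ⟨Z, W, -, h, -, hZW⟩ := hP a b ha hab hb hd
  exact ⟨Z, h, fun t ht => (hZW t ht).1⟩

theorem piecewiseContinuous_D_D (hX : IsVariationalField g q X) :
    q.PiecewiseContinuous (q.D g (q.D g X)) := by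
  obtain ⟨P, hP⟩ := hX.exists_pieces
  refine ⟨P, fun a b ha hab hb hd => ?_⟩
  obtain ⟨Z, W, -, -, h, hZW⟩ := hP a b ha hab hb hd
  exact ⟨W, h, fun t ht => (hZW t ht).2⟩

theorem piecewiseContinuous_force (hX : IsVariationalField g q X) {V : Q → ℝ}
    (hV : ContMDiff 𝓘(ℝ, E) 𝓘(ℝ, ℝ) ∞ V) :
    q.PiecewiseContinuous (fun t => q.force g V t (X t) (q.D g X t) (q.D g (q.D g X) t)) := by
  obtain ⟨P, hP⟩ := hX.exists_pieces
  refine ⟨P, fun a b ha hab hb hd => ?_⟩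
  obtain ⟨Z, W, hX', hZ, hW, hZW⟩ := hP a b ha hab hb hd
  refine ⟨_, q.contDiffAlong_force g hV (Icc_subset_Icc ha hb) hX' hZ hW, fun t ht => ?_⟩
  simp only [(hZW t ht).1, (hZW t ht).2]

/-- `X` is $C^1$ across the break points, so its covariant derivative does not jump there; this is
what lets $\|DX\|^2$ be recovered by integration over the whole interval. -/
theorem contDiffAlong_zero_D (hX : IsVariationalField g q X) :
    ContDiffAlong 0 q.toFun (q.D g X) (Icc 0 q.T) :=
  contDiffAlong_covDeriv g (n := 0) q.uniqueDiffOn q.contMDiffOn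
    (by simpa using hX.contDiff_one)

/-- Almost-everywhere differentiability would not suffice for the fundamental theorem of calculus; a
finite exceptional set, together with continuity, does. -/
theorem exists_finset_differentiable_D (hX : IsVariationalField g q X) :
    ∃ P : Finset ℝ, ∀ t ∈ Ioo 0 q.T, t ∉ P →
      DifferentiableWithinAt ℝ (coordAlong q.toFun (q.D g X) (q.toFun t)) (Icc 0 q.T) t := by
  obtain ⟨P, hP⟩ := hX.piecewise_smooth
  refine ⟨P, fun t ht htP => ?_⟩
  obtain ⟨a, b, htab, hsub⟩ := (mem_nhds_iff_exists_Ioo_subset (a := t)).1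
    (inter_mem (Ioo_mem_nhds ht.1 ht.2) (P.finite_toSet.isClosed.isOpen_compl.mem_nhds
      (show t ∈ (P : Set ℝ)ᶜ from htP)))
  have hab : a < b := htab.1.trans htab.2
  obtain ⟨ha, hb⟩ := (Ioo_subset_Ioo_iff hab).1 fun s hs => (hsub hs).1
  have hd : Disjoint (Ioo a b) (P : Set ℝ) := Set.disjoint_left.2 fun s hs => (hsub hs).2
  obtain ⟨Z, W, hZ, -, hZW⟩ := piece g q X ha hab hb (hP a b ha hab hb hd)
  have hq : ContMDiffOn 𝓘(ℝ, ℝ) 𝓘(ℝ, E) ∞ q.toFun (Icc a b) :=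
    q.contMDiffOn.mono (Icc_subset_Icc ha hb)
  have h1 := ((contDiffAlong_iff le_rfl hq).1 hZ t ⟨htab.1.le, htab.2.le⟩ _
    (mem_extChartAt_source _)).differentiableWithinAt (by simp)
  have h2 := (h1.differentiableAt (Icc_mem_nhds htab.1 htab.2)).differentiableWithinAt
    (s := Icc 0 q.T)
  refine h2.congr_of_eventuallyEq ?_ (by simp only [coordAlong, (hZW t htab).1])
  filter_upwards [mem_nhdsWithin_of_mem_nhds (Ioo_mem_nhds htab.1 htab.2)] with s hs
  simp only [coordAlong, (hZW s hs).1]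

end IsVariationalField

/-- Metric compatibility gives the derivative of $\|Z\|^2$ off the finite set `P`, and continuity of
`Z` excludes jumps on `P`. -/
theorem inner_self_sub_eq_integral (g : SmoothMetric E Q) (q : SmoothCurve E Q)
    {Z : ∀ t, TangentSpace 𝓘(ℝ, E) (q.toFun t)} (hZ : ContDiffAlong 0 q.toFun Z (Icc 0 q.T))
    {P : Finset ℝ} (hd : ∀ t ∈ Ioo 0 q.T, t ∉ P →
      DifferentiableWithinAt ℝ (coordAlong q.toFun Z (q.toFun t)) (Icc 0 q.T) t)
    (hi : IntervalIntegrable (fun t => g.inner (q.toFun t) (Z t) (q.D g Z t)) volume 0 q.T)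
    {a b : ℝ} (ha : 0 ≤ a) (hab : a ≤ b) (hb : b ≤ q.T) :
    g.inner (q.toFun b) (Z b) (Z b) - g.inner (q.toFun a) (Z a) (Z a) =
      ∫ t in a..b, 2 * g.inner (q.toFun t) (Z t) (q.D g Z t) := by
  symm
  refine MeasureTheory.integral_eq_of_hasDerivAt_off_countable_of_le
    (fun t => g.inner (q.toFun t) (Z t) (Z t)) _ hab P.countable_toSet
    ((continuousOn_inner g hZ hZ (q.contMDiffOn.of_le (by simp))).mono (Icc_subset_Icc ha hb))
    (fun t ht => ?_) ((hi.const_mul 2).mono_set ?_)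
  · have ht' : t ∈ Ioo 0 q.T := ⟨ha.trans_lt ht.1.1, ht.1.2.trans_le hb⟩
    exact q.hasDerivAt_inner_self g ht' (hd t ht' ht.2)
  · rw [uIcc_of_le hab, uIcc_of_le q.T_pos.le]
    exact Icc_subset_Icc ha hb

end SmoothCurve

end Fields

/-! ### Abstract part: extension to the completion, and finiteness of the index. -/

section IndexOfForm

variable {W : Type*} [SeminormedAddCommGroup W] [NormedSpace ℝ W]

/-- The form does not change when `x` is scaled by `s` and `y` by `s⁻¹`, so the additive bound may
be optimised over `s`. The norm is only a seminorm here: if `x` or `y` has norm zero the optimum is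
not attained, and `lim` supplies the limit instead. -/
theorem abs_le_mul_norm_of_abs_le_sq {B : W →ₗ[ℝ] W →ₗ[ℝ] ℝ} {M : ℝ}
    (hB : ∀ x y, |B x y| ≤ M * (‖x‖ ^ 2 + ‖y‖ ^ 2)) (x y : W) :
    |B x y| ≤ 2 * M * ‖x‖ * ‖y‖ := by
  have key : ∀ s : ℝ, 0 < s → |B x y| ≤ M * (s ^ 2 * ‖x‖ ^ 2 + (s⁻¹) ^ 2 * ‖y‖ ^ 2) := by
    intro s hs
    have h := hB (s • x) (s⁻¹ • y)
    rw [map_smul, map_smul, LinearMap.smul_apply, smul_smul, inv_mul_cancel₀ hs.ne', one_smul,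
      norm_smul, norm_smul, mul_pow, mul_pow] at h
    simpa using h
  have lim : ∀ b ε : ℝ, 0 < ε → ∃ s : ℝ, 0 < s ∧ M * (s ^ 2 * b ^ 2) < ε := by
    intro b ε hε
    have ht : Tendsto (fun s : ℝ => M * (s ^ 2 * b ^ 2)) (𝓝[>] 0) (𝓝 (M * (0 ^ 2 * b ^ 2))) :=
      Continuous.tendsto' (by fun_prop) _ _ rfl |>.mono_left nhdsWithin_le_nhds
    simp only [ne_eq, OfNat.ofNat_ne_zero, not_false_eq_true, zero_pow, zero_mul, mul_zero] at ht
    obtain ⟨s, h1, h2⟩ := ((ht.eventually (gt_mem_nhds hε)).and self_mem_nhdsWithin).exists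
    exact ⟨s, h2, h1⟩
  rcases (norm_nonneg x).eq_or_lt with hx | hx
  · rw [← hx, mul_zero, zero_mul]
    refine le_of_forall_pos_le_add fun ε hε => ?_
    obtain ⟨s, hs, h1⟩ := lim ‖y‖ ε hε
    have := key s⁻¹ (inv_pos.2 hs)
    rw [← hx, inv_inv] at this
    simp at this
    linarith
  rcases (norm_nonneg y).eq_or_lt with hy | hy
  · rw [← hy, mul_zero]
    refine le_of_forall_pos_le_add fun ε hε => ?_
    obtain ⟨s, hs, h1⟩ := lim ‖x‖ ε hε
    have := key s hs
    rw [← hy] at this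
    simp at this
    linarith
  -- This scaling makes the two summands equal, each being `‖x‖ * ‖y‖`.
  · have h := key (Real.sqrt (‖y‖ / ‖x‖)) (Real.sqrt_pos.2 (div_pos hy hx))
    rw [inv_pow, Real.sq_sqrt (div_pos hy hx).le] at h
    refine h.trans (le_of_eq ?_)
    field_simp
    ring

/-- A bounded bilinear form on `W` that is positive definite up to a finite rank perturbation extends
to a bounded bilinear form of finite extended index on the completion of `W`. -/
theorem exists_extension_extendedIndex_lt_top (B : W →ₗ[ℝ] W →ₗ[ℝ] ℝ) {M : ℝ}
    (hB : ∀ x y, |B x y| ≤ M * (‖x‖ ^ 2 + ‖y‖ ^ 2))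
    {F : Type*} [NormedAddCommGroup F] [NormedSpace ℝ F] [FiniteDimensional ℝ F]
    (L : W →ₗ[ℝ] F) {K : ℝ} (hL : ∀ x, ‖L x‖ ≤ K * ‖x‖) {c C : ℝ} (hc : 0 < c)
    (h : ∀ x, c * ‖x‖ ^ 2 ≤ B x x + C * ‖L x‖ ^ 2) :
    ∃ I : UniformSpace.Completion W →L[ℝ] UniformSpace.Completion W →L[ℝ] ℝ,
      (∀ x y : W, I (x : UniformSpace.Completion W) (y : UniformSpace.Completion W) = B x y) ∧
      extendedIndex (fun x y => I x y) < ⊤ := by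
  have : CompleteSpace F := FiniteDimensional.complete ℝ F
  let B' : W →L[ℝ] W →L[ℝ] ℝ := B.mkContinuous₂ (2 * M) (abs_le_mul_norm_of_abs_le_sq hB)
  let I : UniformSpace.Completion W →L[ℝ] UniformSpace.Completion W →L[ℝ] ℝ :=
    -- The form is extended in one variable at a time.
    (B'.fromCompletion.flip.fromCompletion).flip
  let L' : UniformSpace.Completion W →L[ℝ] F := (L.mkContinuous K hL).fromCompletion
  have hI : ∀ x y : W, I (x : UniformSpace.Completion W) (y : UniformSpace.Completion W) =
      B x y := fun x y => by
    simp [I, B']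
  have hL' : ∀ x : W, L' (x : UniformSpace.Completion W) = L x := fun x => by
    simp [L']
  -- The inequality is a closed condition and holds on the dense image of `W`.
  have key : ∀ x, c * ‖x‖ ^ 2 ≤ I x x + C * ‖L' x‖ ^ 2 := by
    intro x
    induction x using UniformSpace.Completion.induction_on with
    | hp => exact isClosed_le (by fun_prop) (by fun_prop)
    | ih x => rw [hI, hL', UniformSpace.Completion.norm_coe]; exact h x
  refine ⟨I, hI, lt_of_le_of_lt (iSup₂_le fun S hS => ?_)
    (ENat.natCast_lt_top (Module.finrank ℝ F))⟩
  let f : S →ₗ[ℝ] F := (L' : UniformSpace.Completion W →ₗ[ℝ] F).comp S.subtype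
  -- If `L' x = 0` and `I x x ≤ 0`, then `key` forces `x = 0`. Hence the dimension of `S` is at most
  -- that of `F`.
  have hf : Function.Injective f := by
    rw [injective_iff_map_eq_zero]
    rintro ⟨x, hx⟩ h0
    have h0' : L' x = 0 := h0
    have h1 := key x
    have h2 : I x x ≤ 0 := hS x hx
    rw [h0', norm_zero] at h1
    have h3 : ‖x‖ ^ 2 ≤ 0 := by
      by_contra hcon
      have := mul_pos hc (not_le.1 hcon)
      linarith
    have h4 : x = 0 := norm_eq_zero.1 (pow_eq_zero_iff two_ne_zero |>.1 (le_antisymm h3 (sq_nonneg _)))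
    exact Subtype.ext h4
  have : Module.Finite ℝ S := Module.Finite.of_injective f hf
  rw [← Module.finrank_eq_rank, Cardinal.toENat_nat]
  exact_mod_cast LinearMap.finrank_le_finrank_of_injective hf

end IndexOfForm

/-! ### The index form: bilinearity, boundedness, Gårding inequality, evaluation at nodes. -/

section IndexForm

variable {E : Type*} [NormedAddCommGroup E] [NormedSpace ℝ E]
  {Q : Type*} [TopologicalSpace Q] [ChartedSpace E Q] [IsManifold 𝓘(ℝ, E) ∞ Q]

namespace SmoothCurve

theorem sobolevDensity_nonneg (g : SmoothMetric E Q) (q : SmoothCurve E Q)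
    (X : ∀ t, TangentSpace 𝓘(ℝ, E) (q.toFun t)) (t : ℝ) : 0 ≤ q.sobolevDensity g X X t :=
  add_nonneg (add_nonneg (inner_self_nonneg g _ _) (inner_self_nonneg g _ _))
    (inner_self_nonneg g _ _)

variable [FiniteDimensional ℝ E]

/-- The integrand of the index form. -/
def indexDensity (g : SmoothMetric E Q) (V : Q → ℝ) (q : SmoothCurve E Q)
    (X Y : ∀ t, TangentSpace 𝓘(ℝ, E) (q.toFun t)) (t : ℝ) : ℝ :=
  g.inner (q.toFun t) (q.D g (q.D g X) t) (q.D g (q.D g Y) t)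
    + g.inner (q.toFun t) (Y t) (q.force g V t (X t) (q.D g X t) (q.D g (q.D g X) t))

theorem indexForm_eq (g : SmoothMetric E Q) (V : Q → ℝ) (q : SmoothCurve E Q)
    (X Y : q.VariationalField g) :
    q.indexForm g V X Y = ∫ t in (0)..q.T, q.indexDensity g V X.1 Y.1 t := rfl

theorem intervalIntegrable_indexDensity (g : SmoothMetric E Q) {V : Q → ℝ}
    (hV : ContMDiff 𝓘(ℝ, E) 𝓘(ℝ, ℝ) ∞ V) (q : SmoothCurve E Q)
    {X Y : ∀ t, TangentSpace 𝓘(ℝ, E) (q.toFun t)} (hX : IsVariationalField g q X)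
    (hY : IsVariationalField g q Y) :
    IntervalIntegrable (q.indexDensity g V X Y) volume 0 q.T :=
  (hX.piecewiseContinuous_D_D.intervalIntegrable_inner hY.piecewiseContinuous_D_D g).add
    (hY.piecewiseContinuous.intervalIntegrable_inner (hX.piecewiseContinuous_force hV) g)

theorem indexForm_add_left (g : SmoothMetric E Q) {V : Q → ℝ}
    (hV : ContMDiff 𝓘(ℝ, E) 𝓘(ℝ, ℝ) ∞ V) (q : SmoothCurve E Q) (X X' Y : q.VariationalField g) :
    q.indexForm g V (X + X') Y = q.indexForm g V X Y + q.indexForm g V X' Y := by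
  simp only [indexForm_eq]
  rw [← intervalIntegral.integral_add (q.intervalIntegrable_indexDensity g hV X.2 Y.2)
    (q.intervalIntegrable_indexDensity g hV X'.2 Y.2)]
  refine intervalIntegral.integral_congr_ae ?_
  -- Second covariant derivatives may fail to exist at break points, so additivity of the integrand
  -- is only available almost everywhere.
  filter_upwards [q.ae_D_D_add g X.2 X'.2] with t h2 ht
  have ht' : t ∈ Icc 0 q.T := by
    rw [uIoc_of_le q.T_pos.le] at ht; exact Ioc_subset_Icc_self ht
  change q.indexDensity g V (X.1 + X'.1) Y.1 t = _
  simp only [indexDensity]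
  have hf := (q.isLinearMap_force g V t).map_add (X.1 t, q.D g X.1 t, q.D g (q.D g X.1) t)
    (X'.1 t, q.D g X'.1 t, q.D g (q.D g X'.1) t)
  simp only [Prod.mk_add_mk] at hf
  rw [h2 ht', q.D_add g X.2.contDiff_one X'.2.contDiff_one ht', Pi.add_apply, hf]
  simp only [map_add, add_apply]
  ring

theorem indexForm_smul_left (g : SmoothMetric E Q) (V : Q → ℝ) (q : SmoothCurve E Q) (r : ℝ)
    (X Y : q.VariationalField g) :
    q.indexForm g V (r • X) Y = r * q.indexForm g V X Y := by
  simp only [indexForm_eq]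
  rw [← intervalIntegral.integral_const_mul]
  refine intervalIntegral.integral_congr_ae ?_
  filter_upwards [q.ae_D_D_smul g r X.2] with t h2 ht
  have ht' : t ∈ Icc 0 q.T := by
    rw [uIoc_of_le q.T_pos.le] at ht; exact Ioc_subset_Icc_self ht
  change q.indexDensity g V (r • X.1) Y.1 t = _
  simp only [indexDensity]
  have hf := (q.isLinearMap_force g V t).map_smul r (X.1 t, q.D g X.1 t, q.D g (q.D g X.1) t)
  simp only [Prod.smul_mk] at hf
  rw [h2 ht', q.D_smul g r X.2.contDiff_one ht', Pi.smul_apply, hf]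
  simp only [map_smul, smul_apply, smul_eq_mul]
  ring

theorem indexForm_add_right (g : SmoothMetric E Q) {V : Q → ℝ}
    (hV : ContMDiff 𝓘(ℝ, E) 𝓘(ℝ, ℝ) ∞ V) (q : SmoothCurve E Q) (X Y Y' : q.VariationalField g) :
    q.indexForm g V X (Y + Y') = q.indexForm g V X Y + q.indexForm g V X Y' := by
  simp only [indexForm_eq]
  rw [← intervalIntegral.integral_add (q.intervalIntegrable_indexDensity g hV X.2 Y.2)
    (q.intervalIntegrable_indexDensity g hV X.2 Y'.2)]
  refine intervalIntegral.integral_congr_ae ?_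
  filter_upwards [q.ae_D_D_add g Y.2 Y'.2] with t h2 ht
  have ht' : t ∈ Icc 0 q.T := by
    rw [uIoc_of_le q.T_pos.le] at ht; exact Ioc_subset_Icc_self ht
  change q.indexDensity g V X.1 (Y.1 + Y'.1) t = _
  simp only [indexDensity]
  rw [h2 ht', Pi.add_apply]
  simp only [map_add, add_apply]
  ring

theorem indexForm_smul_right (g : SmoothMetric E Q) (V : Q → ℝ) (q : SmoothCurve E Q) (r : ℝ)
    (X Y : q.VariationalField g) :
    q.indexForm g V X (r • Y) = r * q.indexForm g V X Y := by
  simp only [indexForm_eq]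
  rw [← intervalIntegral.integral_const_mul]
  refine intervalIntegral.integral_congr_ae ?_
  filter_upwards [q.ae_D_D_smul g r Y.2] with t h2 ht
  have ht' : t ∈ Icc 0 q.T := by
    rw [uIoc_of_le q.T_pos.le] at ht; exact Ioc_subset_Icc_self ht
  change q.indexDensity g V X.1 (r • Y.1) t = _
  simp only [indexDensity]
  rw [h2 ht', Pi.smul_apply]
  simp only [map_smul, smul_apply, smul_eq_mul]
  ring

/-- The index form as a bilinear map. -/
def indexBilin (g : SmoothMetric E Q) {V : Q → ℝ} (hV : ContMDiff 𝓘(ℝ, E) 𝓘(ℝ, ℝ) ∞ V)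
    (q : SmoothCurve E Q) : q.VariationalField g →ₗ[ℝ] q.VariationalField g →ₗ[ℝ] ℝ :=
  LinearMap.mk₂ ℝ (q.indexForm g V) (q.indexForm_add_left g hV) (q.indexForm_smul_left g V)
    (q.indexForm_add_right g hV) (q.indexForm_smul_right g V)

theorem norm_sq_eq_integral (g : SmoothMetric E Q) (q : SmoothCurve E Q)
    (X : q.VariationalField g) :
    ‖X‖ ^ 2 = ∫ t in (0)..q.T, q.sobolevDensity g X.1 X.1 t :=
  q.norm_sq_variationalField g X

/-- Young's inequality with parameter `1` on both terms of the integrand, and the uniform bound on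
the force. The sum of squares is enough, since `abs_le_mul_norm_of_abs_le_sq` turns it into a
product of norms. -/
theorem exists_abs_indexForm_le (g : SmoothMetric E Q) {V : Q → ℝ}
    (hV : ContMDiff 𝓘(ℝ, E) 𝓘(ℝ, ℝ) ∞ V) (q : SmoothCurve E Q) :
    ∃ M, ∀ X Y : q.VariationalField g,
      |q.indexForm g V X Y| ≤ M * (‖X‖ ^ 2 + ‖Y‖ ^ 2) := by
  obtain ⟨C, hC, hle⟩ := q.exists_inner_force_le g hV
  refine ⟨1 + C, fun X Y => ?_⟩
  have hiX := q.intervalIntegrable_sobolevDensity g X.2 X.2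
  have hiY := q.intervalIntegrable_sobolevDensity g Y.2 Y.2
  rw [norm_sq_eq_integral, norm_sq_eq_integral, ← intervalIntegral.integral_add hiX hiY,
    ← intervalIntegral.integral_const_mul, indexForm_eq]
  refine (intervalIntegral.abs_integral_le_integral_abs q.T_pos.le).trans
    (intervalIntegral.integral_mono_on q.T_pos.le
      (q.intervalIntegrable_indexDensity g hV X.2 Y.2).abs ((hiX.add hiY).const_mul _)
      fun t ht => ?_)
  have h1 := abs_two_mul_inner_le g (q.toFun t) (q.D g (q.D g X.1) t) (q.D g (q.D g Y.1) t) one_pos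
  have h2 := abs_two_mul_inner_le g (q.toFun t) (Y.1 t)
    (q.force g V t (X.1 t) (q.D g X.1 t) (q.D g (q.D g X.1) t)) one_pos
  have h3 := hle t ht (X.1 t) (q.D g X.1 t) (q.D g (q.D g X.1) t)
  change _ ≤ C * q.sobolevDensity g X.1 X.1 t at h3
  have h4 := mul_nonneg hC (q.sobolevDensity_nonneg g Y.1 t)
  have a1 := inner_self_nonneg g (q.toFun t) (X.1 t)
  have a2 := inner_self_nonneg g (q.toFun t) (q.D g X.1 t)
  have a3 := inner_self_nonneg g (q.toFun t) (q.D g (q.D g X.1) t)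
  have b1 := inner_self_nonneg g (q.toFun t) (Y.1 t)
  have b2 := inner_self_nonneg g (q.toFun t) (q.D g Y.1 t)
  have b3 := inner_self_nonneg g (q.toFun t) (q.D g (q.D g Y.1) t)
  have h5 := mul_nonneg hC (q.sobolevDensity_nonneg g X.1 t)
  have lX : g.inner (q.toFun t) (q.D g (q.D g X.1) t) (q.D g (q.D g X.1) t) ≤
      q.sobolevDensity g X.1 X.1 t := by rw [sobolevDensity]; linarith
  have lY : g.inner (q.toFun t) (q.D g (q.D g Y.1) t) (q.D g (q.D g Y.1) t) +
      g.inner (q.toFun t) (Y.1 t) (Y.1 t) ≤ q.sobolevDensity g Y.1 Y.1 t := by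
    rw [sobolevDensity]; linarith
  rw [abs_le] at h1 h2 ⊢
  rw [inv_one] at h1 h2
  rw [indexDensity, add_mul, mul_add, mul_add]
  have h6 := q.sobolevDensity_nonneg g X.1 t
  have h7 := q.sobolevDensity_nonneg g Y.1 t
  constructor <;> linarith [h1.1, h1.2, h2.1, h2.2]

/-! ### Point evaluations -/

theorem integral_D_eq (g : SmoothMetric E Q) (q : SmoothCurve E Q)
    {X : ∀ t, TangentSpace 𝓘(ℝ, E) (q.toFun t)} (hX : IsVariationalField g q X) {a b : ℝ}
    (ha : 0 ≤ a) (hab : a ≤ b) (hb : b ≤ q.T) :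
    g.inner (q.toFun b) (X b) (X b) - g.inner (q.toFun a) (X a) (X a) =
      ∫ t in a..b, 2 * g.inner (q.toFun t) (X t) (q.D g X t) :=
  -- `X` is $C^1$ on the whole interval, so there is no exceptional time; for its covariant
  -- derivative the exceptional set is that of `exists_finset_differentiable_D`.
  q.inner_self_sub_eq_integral g (hX.contDiff_one.of_le (by simp)) (P := ∅)
    (fun _ ht _ => q.differentiableWithinAt_coord hX.contDiff_one (Ioo_subset_Icc_self ht))
    (hX.piecewiseContinuous.intervalIntegrable_inner hX.piecewiseContinuous_D g) ha hab hb

theorem integral_D_D_eq (g : SmoothMetric E Q) (q : SmoothCurve E Q)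
    {X : ∀ t, TangentSpace 𝓘(ℝ, E) (q.toFun t)} (hX : IsVariationalField g q X) {a b : ℝ}
    (ha : 0 ≤ a) (hab : a ≤ b) (hb : b ≤ q.T) :
    g.inner (q.toFun b) (q.D g X b) (q.D g X b) - g.inner (q.toFun a) (q.D g X a) (q.D g X a) =
      ∫ t in a..b, 2 * g.inner (q.toFun t) (q.D g X t) (q.D g (q.D g X) t) := by
  obtain ⟨P, hP⟩ := hX.exists_finset_differentiable_D
  exact q.inner_self_sub_eq_integral g hX.contDiffAlong_zero_D hP
    (hX.piecewiseContinuous_D.intervalIntegrable_inner hX.piecewiseContinuous_D_D g) ha hab hb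

theorem integral_two_mul_inner_le (g : SmoothMetric E Q) (q : SmoothCurve E Q)
    {X : ∀ t, TangentSpace 𝓘(ℝ, E) (q.toFun t)} (hX : IsVariationalField g q X)
    {A B : ∀ t, TangentSpace 𝓘(ℝ, E) (q.toFun t)} (hA : q.PiecewiseContinuous A)
    (hB : q.PiecewiseContinuous B)
    (hle : ∀ t, g.inner (q.toFun t) (A t) (A t) + g.inner (q.toFun t) (B t) (B t) ≤
      q.sobolevDensity g X X t) {b : ℝ} (hb : b ∈ Icc 0 q.T) :
    ∫ t in (0)..b, 2 * g.inner (q.toFun t) (A t) (B t) ≤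
      ∫ t in (0)..q.T, q.sobolevDensity g X X t := by
  have hsub : uIcc 0 b ⊆ uIcc 0 q.T := by
    rw [uIcc_of_le hb.1, uIcc_of_le q.T_pos.le]; exact Icc_subset_Icc_right hb.2
  have hi := q.intervalIntegrable_sobolevDensity g hX hX
  refine (intervalIntegral.integral_mono_on hb.1
    (((hA.intervalIntegrable_inner hB g).const_mul 2).mono_set hsub) (hi.mono_set hsub)
    fun t _ => ?_).trans (intervalIntegral.integral_mono_interval le_rfl hb.1 hb.2
      (Eventually.of_forall fun t => q.sobolevDensity_nonneg g X t) hi)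
  have h := (le_abs_self _).trans (abs_two_mul_inner_le g (q.toFun t) (A t) (B t) one_pos)
  rw [inv_one, one_mul, one_mul] at h
  exact h.trans (hle t)

/-- As $X(0) = 0$, $\|X(t)\|^2 = \int_0^t 2\langle X, DX\rangle \le \int_0^T(\|X\|^2 + \|DX\|^2)$.
The same argument, with $DX(0) = 0$, bounds $DX$ pointwise. This is the continuity of point
evaluations. -/
theorem inner_self_le_norm_sq (g : SmoothMetric E Q) (q : SmoothCurve E Q)
    (X : q.VariationalField g) {t : ℝ} (ht : t ∈ Icc 0 q.T) :
    g.inner (q.toFun t) (X.1 t) (X.1 t) ≤ ‖X‖ ^ 2 := by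
  have h := q.integral_D_eq g X.2 le_rfl ht.1 ht.2
  have h0 : g.inner (q.toFun 0) (X.1 0) (X.1 0) = 0 := by rw [X.2.left, map_zero]
  rw [h0, sub_zero] at h
  rw [h, norm_sq_eq_integral]
  exact q.integral_two_mul_inner_le g X.2 X.2.piecewiseContinuous X.2.piecewiseContinuous_D
    (fun t => le_add_of_nonneg_right (inner_self_nonneg g _ _)) ht

theorem inner_self_D_le_norm_sq (g : SmoothMetric E Q) (q : SmoothCurve E Q)
    (X : q.VariationalField g) {t : ℝ} (ht : t ∈ Icc 0 q.T) :
    g.inner (q.toFun t) (q.D g X.1 t) (q.D g X.1 t) ≤ ‖X‖ ^ 2 := by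
  have h := q.integral_D_D_eq g X.2 le_rfl ht.1 ht.2
  have h0 : g.inner (q.toFun 0) (q.D g X.1 0) (q.D g X.1 0) = 0 := by rw [X.2.D_left, map_zero]
  rw [h0, sub_zero] at h
  rw [h, norm_sq_eq_integral]
  refine q.integral_two_mul_inner_le g X.2 X.2.piecewiseContinuous_D X.2.piecewiseContinuous_D_D
    (fun t => ?_) ht
  rw [sobolevDensity, add_assoc]
  exact le_add_of_nonneg_left (inner_self_nonneg g _ _)

/-- The values of a variational field and of its covariant derivative at finitely many times. -/
def eval (g : SmoothMetric E Q) (q : SmoothCurve E Q) {ι : Type*} (τ : ι → ℝ)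
    (hτ : ∀ i, τ i ∈ Icc 0 q.T) : q.VariationalField g →ₗ[ℝ] ι → E × E where
  toFun X i := (X.1 (τ i), q.D g X.1 (τ i))
  map_add' X Y := by
    funext i
    exact congrArg (Prod.mk (X.1 (τ i) + Y.1 (τ i) : E))
      (q.D_add g X.2.contDiff_one Y.2.contDiff_one (hτ i))
  map_smul' r X := by
    funext i
    exact congrArg (Prod.mk (r • X.1 (τ i) : E)) (q.D_smul g r X.2.contDiff_one (hτ i))

/-- The target carries the norm of `E`, which is unrelated to the metric. The two are equivalent at
each node, and the finitely many constants are added. -/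
theorem exists_norm_eval_le (g : SmoothMetric E Q) (q : SmoothCurve E Q) {ι : Type*} [Fintype ι]
    (τ : ι → ℝ) (hτ : ∀ i, τ i ∈ Icc 0 q.T) :
    ∃ K, ∀ X : q.VariationalField g, ‖q.eval g τ hτ X‖ ≤ K * ‖X‖ := by
  let B : ι → E →L[ℝ] E →L[ℝ] ℝ := fun i => g.inner (q.toFun (τ i))
  have h1 : ∀ i, ∃ m, 0 < m ∧ ∀ v : E, m * ‖v‖ ^ 2 ≤ B i v v := fun i =>
    exists_pos_mul_norm_sq_le (B := B i) (g.pos (q.toFun (τ i)))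
  choose m hm hmle using h1
  have h2 : ∀ i (v : E) (r : ℝ), 0 ≤ r → B i v v ≤ r ^ 2 →
      ‖v‖ ≤ Real.sqrt (m i)⁻¹ * r := by
    intro i v r hr hv
    rw [← Real.sqrt_sq hr, ← Real.sqrt_mul (inv_pos.2 (hm i)).le]
    refine Real.le_sqrt_of_sq_le ?_
    rw [inv_mul_eq_div, le_div_iff₀ (hm i), mul_comm]
    exact (hmle i v).trans hv
  refine ⟨∑ i, Real.sqrt (m i)⁻¹, fun X => ?_⟩
  have h3 : ∀ i, Real.sqrt (m i)⁻¹ * ‖X‖ ≤ (∑ i, Real.sqrt (m i)⁻¹) * ‖X‖ := fun i =>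
    mul_le_mul_of_nonneg_right (Finset.single_le_sum (f := fun i => Real.sqrt (m i)⁻¹)
      (fun i _ => Real.sqrt_nonneg _) (Finset.mem_univ i)) (norm_nonneg _)
  rw [pi_norm_le_iff_of_nonneg (mul_nonneg (Finset.sum_nonneg fun i _ => Real.sqrt_nonneg _)
    (norm_nonneg _))]
  intro i
  exact max_le
    ((h2 i (X.1 (τ i)) ‖X‖ (norm_nonneg X) (q.inner_self_le_norm_sq g X (hτ i))).trans (h3 i))
    ((h2 i (q.D g X.1 (τ i)) ‖X‖ (norm_nonneg X)
      (q.inner_self_D_le_norm_sq g X (hτ i))).trans (h3 i))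

/-- The opposite comparison, which turns the node values left by the Poincaré inequality into the
norm of the evaluation map. -/
theorem exists_sum_inner_le_eval (g : SmoothMetric E Q) (q : SmoothCurve E Q) {ι : Type*}
    [Fintype ι] (τ : ι → ℝ) (hτ : ∀ i, τ i ∈ Icc 0 q.T) :
    ∃ K, ∀ X : q.VariationalField g, ∑ i, g.inner (q.toFun (τ i)) (X.1 (τ i)) (X.1 (τ i)) +
      ∑ i, g.inner (q.toFun (τ i)) (q.D g X.1 (τ i)) (q.D g X.1 (τ i)) ≤
        K * ‖q.eval g τ hτ X‖ ^ 2 := by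
  let B : ι → E →L[ℝ] E →L[ℝ] ℝ := fun i => g.inner (q.toFun (τ i))
  have hB : ∀ i (v : E) (r : ℝ), ‖v‖ ≤ r → B i v v ≤ ‖B i‖ * r ^ 2 := by
    intro i v r hv
    calc B i v v ≤ ‖B i‖ * ‖v‖ * ‖v‖ := (Real.le_norm_self _).trans ((B i).le_opNorm₂ v v)
      _ ≤ ‖B i‖ * r * r := by
          have := (norm_nonneg v).trans hv
          gcongr
      _ = ‖B i‖ * r ^ 2 := by ring
  refine ⟨∑ i, ‖B i‖ + ∑ i, ‖B i‖, fun X => ?_⟩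
  have hle : ∀ i, ‖q.eval g τ hτ X i‖ ≤ ‖q.eval g τ hτ X‖ := norm_le_pi_norm _
  rw [add_mul, Finset.sum_mul]
  exact add_le_add
    (Finset.sum_le_sum fun i _ => hB i (X.1 (τ i)) _ ((le_max_left _ _).trans (hle i)))
    (Finset.sum_le_sum fun i _ => hB i (q.D g X.1 (τ i)) _ ((le_max_right _ _).trans (hle i)))

/-- The Gårding inequality for the index form. -/
theorem exists_norm_sq_le_indexForm (g : SmoothMetric E Q) {V : Q → ℝ}
    (hV : ContMDiff 𝓘(ℝ, E) 𝓘(ℝ, ℝ) ∞ V) (q : SmoothCurve E Q) :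
    ∃ C, 0 ≤ C ∧ ∀ X : q.VariationalField g, 3 / 4 * ‖X‖ ^ 2 ≤ q.indexForm g V X X +
      C * ((∫ t in (0)..q.T, g.inner (q.toFun t) (X.1 t) (X.1 t)) +
        ∫ t in (0)..q.T, g.inner (q.toFun t) (q.D g X.1 t) (q.D g X.1 t)) := by
  obtain ⟨C, hC, hle⟩ := q.exists_inner_force_le g hV
  -- `C + 1` pays for the $\|X\|^2$ term of Young's inequality, and one more unit supplies $\|X\|^2$
  -- and $\|DX\|^2$ on the left, which the principal part does not contain.
  refine ⟨C + 2, by linarith, fun X => ?_⟩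
  have hiX := q.intervalIntegrable_sobolevDensity g X.2 X.2
  have hi0 := X.2.piecewiseContinuous.intervalIntegrable_inner X.2.piecewiseContinuous g
  have hi1 := X.2.piecewiseContinuous_D.intervalIntegrable_inner X.2.piecewiseContinuous_D g
  have hiI := q.intervalIntegrable_indexDensity g hV X.2 X.2
  rw [norm_sq_eq_integral, indexForm_eq, ← intervalIntegral.integral_add hi0 hi1,
    ← intervalIntegral.integral_const_mul, ← intervalIntegral.integral_const_mul,
    ← intervalIntegral.integral_add hiI ((hi0.add hi1).const_mul _)]
  refine intervalIntegral.integral_mono_on q.T_pos.le (hiX.const_mul _)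
    (hiI.add ((hi0.add hi1).const_mul _)) fun t ht => ?_
  have h3 := hle t ht (X.1 t) (q.D g X.1 t) (q.D g (q.D g X.1) t)
  -- With this parameter the force, which contains $D^2X$, costs at most a quarter of the Sobolev
  -- density; hence the factor `3 / 4`.
  have hδ : (0 : ℝ) < (2 * (C + 1))⁻¹ := by positivity
  have h2 := (abs_le.1 (abs_two_mul_inner_le g (q.toFun t) (X.1 t)
    (q.force g V t (X.1 t) (q.D g X.1 t) (q.D g (q.D g X.1) t)) hδ)).1
  rw [inv_inv] at h2
  have h4 := mul_le_mul_of_nonneg_left h3 hδ.le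
  have a1 := inner_self_nonneg g (q.toFun t) (X.1 t)
  have a2 := inner_self_nonneg g (q.toFun t) (q.D g X.1 t)
  have a3 := inner_self_nonneg g (q.toFun t) (q.D g (q.D g X.1) t)
  rw [sobolevDensity, indexDensity]
  set u := g.inner (q.toFun t) (X.1 t) (X.1 t)
  set v := g.inner (q.toFun t) (q.D g X.1 t) (q.D g X.1 t)
  set w := g.inner (q.toFun t) (q.D g (q.D g X.1) t) (q.D g (q.D g X.1) t)
  have h5 : (2 * (C + 1))⁻¹ * (C * (u + v + w)) ≤ 1 / 2 * (u + v + w) := by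
    rw [← mul_assoc]
    refine mul_le_mul_of_nonneg_right ?_ (by positivity)
    rw [inv_mul_eq_div, div_le_div_iff₀ (by positivity) two_pos]
    linarith
  have h6 : 0 ≤ C * v := mul_nonneg hC a2
  linarith

/-- The Gårding inequality, with its two lower-order integrals bounded by the Poincaré inequality on
a fine subdivision, applied to `X` and to its covariant derivative. This is the positivity up to
finite rank that the abstract part needs. -/
theorem exists_eval_estimate (g : SmoothMetric E Q) {V : Q → ℝ}
    (hV : ContMDiff 𝓘(ℝ, E) 𝓘(ℝ, ℝ) ∞ V) (q : SmoothCurve E Q) :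
    ∃ (N : ℕ) (τ : Fin N → ℝ) (hτ : ∀ i, τ i ∈ Icc 0 q.T) (C : ℝ), ∀ X : q.VariationalField g,
      1 / 2 * ‖X‖ ^ 2 ≤ q.indexForm g V X X + C * ‖q.eval g τ hτ X‖ ^ 2 := by
  obtain ⟨C, hC, hgar⟩ := q.exists_norm_sq_le_indexForm g hV
  -- Chosen so that `hh` below holds: it amounts to `16 * C * q.T ^ 2 ≤ N ^ 2`, which follows from
  -- the bound on `N` and `1 < N`.
  obtain ⟨N, hN⟩ := exists_nat_gt (16 * (C + 1) * (q.T ^ 2 + 1))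
  have hN1 : (1 : ℝ) < N := by nlinarith [sq_nonneg q.T]
  have hN0 : (0 : ℝ) < N := by linarith
  have hNpos : 0 < N := by exact_mod_cast hN0
  have hτ : ∀ i : Fin N, (i : ℝ) * (q.T / N) ∈ Icc 0 q.T := fun i => by
    have hi : (i : ℝ) ≤ N := by exact_mod_cast i.2.le
    refine ⟨mul_nonneg (Nat.cast_nonneg _) (div_nonneg q.T_pos.le hN0.le), ?_⟩
    calc (i : ℝ) * (q.T / N) ≤ N * (q.T / N) :=
          mul_le_mul_of_nonneg_right hi (div_nonneg q.T_pos.le hN0.le)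
      _ = q.T := by field_simp
  obtain ⟨K, hK⟩ := q.exists_sum_inner_le_eval g (fun i : Fin N => (i : ℝ) * (q.T / N)) hτ
  refine ⟨N, _, hτ, C * (2 * (q.T / N)) * K, fun X => ?_⟩
  have hh : C * (4 * (q.T / N) ^ 2) ≤ 1 / 4 := by
    rw [div_pow, ← mul_div_assoc, ← mul_div_assoc, div_le_iff₀ (by positivity)]
    nlinarith [sq_nonneg q.T]
  have p0 := X.2.piecewiseContinuous
  have p1 := X.2.piecewiseContinuous_D
  have p2 := X.2.piecewiseContinuous_D_D
  have hi0 := p0.intervalIntegrable_inner p0 g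
  have hi1 := p1.intervalIntegrable_inner p1 g
  have hi2 := p2.intervalIntegrable_inner p2 g
  have hnn : ∀ (A : ∀ t, TangentSpace 𝓘(ℝ, E) (q.toFun t)) t, 0 ≤ g.inner (q.toFun t) (A t) (A t) :=
    fun A t => inner_self_nonneg g _ _
  have e0 := integral_le_sum_of_sub_eq_integral q.T_pos.le hNpos hi0
    ((p0.intervalIntegrable_inner p1 g).const_mul 2) hi1 (hnn _) (hnn _)
    (fun a b ha hab hb => q.integral_D_eq g X.2 ha hab hb)
    (fun s δ hδ => (le_abs_self _).trans (abs_two_mul_inner_le g _ _ _ hδ))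
  have e1 := integral_le_sum_of_sub_eq_integral q.T_pos.le hNpos hi1
    ((p1.intervalIntegrable_inner p2 g).const_mul 2) hi2 (hnn _) (hnn _)
    (fun a b ha hab hb => q.integral_D_D_eq g X.2 ha hab hb)
    (fun s δ hδ => (le_abs_self _).trans (abs_two_mul_inner_le g _ _ _ hδ))
  have hnorm : ‖X‖ ^ 2 = (∫ t in (0)..q.T, g.inner (q.toFun t) (X.1 t) (X.1 t)) +
      (∫ t in (0)..q.T, g.inner (q.toFun t) (q.D g X.1 t) (q.D g X.1 t)) +
      ∫ t in (0)..q.T, g.inner (q.toFun t) (q.D g (q.D g X.1) t) (q.D g (q.D g X.1) t) := by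
    rw [← intervalIntegral.integral_add hi0 hi1, ← intervalIntegral.integral_add (hi0.add hi1) hi2]
    exact q.norm_sq_eq_integral g X
  have hα := intervalIntegral.integral_nonneg (μ := volume) q.T_pos.le fun t _ => hnn X.1 t
  have hG := hgar X
  have hKX := mul_le_mul_of_nonneg_left (hK X)
    (mul_nonneg hC (mul_nonneg zero_le_two (div_nonneg q.T_pos.le hN0.le)))
  set α := ∫ t in (0)..q.T, g.inner (q.toFun t) (X.1 t) (X.1 t)
  set β := ∫ t in (0)..q.T, g.inner (q.toFun t) (q.D g X.1 t) (q.D g X.1 t)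
  set γ := ∫ t in (0)..q.T, g.inner (q.toFun t) (q.D g (q.D g X.1) t) (q.D g (q.D g X.1) t)
  -- The derivative terms on the right add up to `β + γ ≤ ‖X‖ ^ 2`, with a coefficient of at most `1
  -- / 4`. Absorbing them lowers `3 / 4` to `1 / 2`.
  have s0 := mul_le_mul_of_nonneg_left (add_le_add e0 e1) hC
  have s1 : C * (4 * (q.T / N) ^ 2) * (β + γ) ≤ C * (4 * (q.T / N) ^ 2) * ‖X‖ ^ 2 :=
    mul_le_mul_of_nonneg_left (by linarith) (by positivity)
  have s2 : C * (4 * (q.T / N) ^ 2) * ‖X‖ ^ 2 ≤ 1 / 4 * ‖X‖ ^ 2 :=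
    mul_le_mul_of_nonneg_right hh (sq_nonneg _)
  linarith

end SmoothCurve

end IndexForm

end

end VariationalObstacle

theorem mainTheorem3
    {E : Type*} [NormedAddCommGroup E] [NormedSpace ℝ E] [FiniteDimensional ℝ E]
    {Q : Type*} [TopologicalSpace Q] [ChartedSpace E Q] [IsManifold 𝓘(ℝ, E) ∞ Q]
    (g : VariationalObstacle.SmoothMetric E Q)
    (V : Q → ℝ) (hV : ContMDiff 𝓘(ℝ, E) 𝓘(ℝ, ℝ) ∞ V)
    (q : VariationalObstacle.SmoothCurve E Q) :
    ∃ I : q.SobolevSpace g →L[ℝ] q.SobolevSpace g →L[ℝ] ℝ,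
      (∀ X Y : q.VariationalField g,
        I (X : q.SobolevSpace g) (Y : q.SobolevSpace g) = q.indexForm g V X Y) ∧
      VariationalObstacle.extendedIndex (fun x y => I x y) < ⊤ := by
  obtain ⟨M, hM⟩ := q.exists_abs_indexForm_le g hV
  obtain ⟨N, τ, hτ, C, hC⟩ := q.exists_eval_estimate g hV
  obtain ⟨K, hK⟩ := q.exists_norm_eval_le g τ hτ
  exact VariationalObstacle.exists_extension_extendedIndex_lt_top (q.indexBilin g hV) hM
    (q.eval g τ hτ) hK one_half_pos hC
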